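/- Let $L$ be a link diagram on the oriented sphere $S^2$ with a marked point $p$ that is not a crossing. Let $\mathbb F_L$ be the field of fractions of the polynomial ring over $\mathbb Z/2$ with one variable $x_f$ for every face $f$ of $L$ (a face is a component of the complement of the projection); for a union $A$ of faces put $[A]=\sum_{f\subset A}x_f$. For a set $S$ of crossings let $L_S$ be the complete resolution of $L$ in which a crossing $c\notin S$ is resolved so as to join the two regions swept out when the overstrand is turned counterclockwise, and a crossing $c\in S$ so as to join the other two regions. Let $O_i(L)$ be the set of those $T$ with $|T|=i$ for which $L_T$ is a single circle, let $CT_i(L)$ be the $\mathbb F_L$-vector space with basis $O_i(L)$, and let $\partial:CT_i(L)\to CT_{i+2}(L)$ be given by $$\partial T=\sum_{T'\in O_{i+2}(L),\ T\subset T'}\langle T,T'\rangle\,T',\qquad \langle T,T'\rangle=\frac1{[B_{T,T'}]}+\frac1{[W_{T,T'}]},$$ where, for $T'=T\cup\{c_1,c_2\}$, the regions $B_{T,T'}$ and $W_{T,T'}$ are the discs not containing $p$ that are bounded by the unmarked circle of the two-circle resolutions $L_{T\cup\{c_1\}}$ and $L_{T\cup\{c_2\}}$, respectively. Let $\underline{HT}_i(L)$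 be the homology of $(CT(L),\partial)$ at $CT_i(L)$, and, when $L$ is oriented with $n_+(L)$ positive crossings, let $HT_i(L)=\underline{HT}_{i+n_+(L)}(L)$. Let $c$ be a crossing of $L$, and let $L_0$ and $L_1$ be the diagrams obtained by resolving $c$ by the rule for $c\notin S$ and for $c\in S$, respectively. Let $\mathbb F_{L_0}$ and $\mathbb F_{L_1}$ be embedded in $\mathbb F_L$ by sending the variable of a face to the sum of the variables of the faces of $L$ contained in it. (So if the four faces around $c$ are distinct, the variable of the face in which two opposite faces $f,f'$ at $c$ are merged goes to $x_f+x_{f'}$, and all other variables are unchanged.) All tensor products below are over $\mathbb F_{L_0}$ or $\mathbb F_{L_1}$ along these embeddings. 1. $CT(L)$, $CT(L_0)$ and $CT(L_1)$ are chain complexes. For $T\in O_i(L_0)$ put $\tau_c(T)=\sum_{T'}\langle T,T'\cup\{c\}\rangle\,T'$, the sum being over the $T'\in O_{i+1}(L_1)$ with $T\subset T'$, with the coefficients computed in $L$. Then $\tau_c$ is a chain map $CT_i(L_0)\otimes\mathbb F_L\to CT_{i+1}(L_1)\otimes\mathbb F_L$, and $CT(L)$ is isomorphic as a graded complex over $\mathbb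 F_L$ to its mapping cone $CT_i(L_0)\otimes\mathbb F_L\,\oplus\,CT_{i-1}(L_1)\otimes\mathbb F_L$ with differential $(a,a')\mapsto(\partial a,\ \tau_c a+\partial a')$. 2. There is a long exact sequence $$\cdots\to\underline{HT}_{i-1}(L_1)\otimes\mathbb F_L\to\underline{HT}_i(L)\to\underline{HT}_i(L_0)\otimes\mathbb F_L\xrightarrow{\tau_{c,*}}\underline{HT}_{i+1}(L_1)\otimes\mathbb F_L\to\underline{HT}_{i+2}(L)\to\cdots$$ whose maps are induced by the inclusion into the cone, the projection from the cone, and $\tau_c$. 3. If $L$ is oriented and $c$ is positive, give $L_0$ the inherited orientation and $L_1$ any orientation, and let $e=n_+(L)-n_+(L_1)$. Then the same maps give a long exact sequence $$\cdots\to HT_{i+e-1}(L_1)\otimes\mathbb F_L\to HT_i(L)\to HT_{i+1}(L_0)\otimes\mathbb F_L\xrightarrow{\tau_{c,*}}HT_{i+e+1}(L_1)\otimes\mathbb F_L\to\cdots.$$ 4. If $L$ is oriented and $c$ is negative, give $L_1$ the inherited orientation and $L_0$ any orientation, and let $f=n_+(L)-n_+(L_0)$. Then the same maps give a long exact sequence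 $$\cdots\to HT_{i-1}(L_1)\otimes\mathbb F_L\to HT_i(L)\to HT_{i+f}(L_0)\otimes\mathbb F_L\xrightarrow{\tau_{c,*}}HT_{i+1}(L_1)\otimes\mathbb F_L\to\cdots.$$ -/

import Mathlib

open scoped TensorProduct

noncomputable section

/-!  ## Link diagrams on the sphere  -/

/-- The combinatorial data of a marked (unoriented) link diagram on the oriented sphere `S²`,
possibly disconnected and possibly with crossingless circles.

The projection is a graph drawn on `S²` whose vertices are the crossings (valency four) and
auxiliary points of valency two on the strands (so that closed curves without crossings, and the
result of resolving a crossing, are covered).  `D` is the set of darts (half-edges), each pointing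
away from its vertex, and `X` is the set of crossings.

That the data is drawn on a sphere is the predicate `LinkDiagram.IsPlanar`. -/
structure LinkDiagram (D X : Type*) where
  /-- the other half of the same edge -/
  edge : Equiv.Perm D
  edge_edge : ∀ d, edge (edge d) = d
  edge_ne : ∀ d, edge d ≠ d
  /-- the next dart, counterclockwise, at the same vertex -/
  rot : Equiv.Perm D
  /-- the crossing at which a dart starts, `none` if it starts at a vertex of valency two -/
  crossing : D → Option X
  crossing_surj : ∀ x, ∃ d, crossing d = some x
  crossing_rot : ∀ d, crossing (rot d) = crossing d
  crossing_eq : ∀ d d' x, crossing d = some x → crossing d' = some x →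
    d' = d ∨ d' = rot d ∨ d' = rot (rot d) ∨ d' = rot (rot (rot d))
  rot_four : ∀ d x, crossing d = some x → rot (rot (rot (rot d))) = d
  rot_two_ne : ∀ d x, crossing d = some x → rot (rot d) ≠ d
  bivalent_rot : ∀ d, crossing d = none → rot (rot d) = d
  bivalent_ne : ∀ d, crossing d = none → rot d ≠ d
  /-- whether a dart at a crossing belongs to the overstrand (irrelevant at other vertices) -/
  isOver : D → Bool
  isOver_rot : ∀ d x, crossing d = some x → isOver (rot d) = !isOver d
  /-- two darts are related when the faces on their left-hand sides are the same -/
  sameFace : Setoid D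
  /-- walking along `d` with a face on the left, one continues along `rot⁻¹ (edge d)` -/
  sameFace_walk : ∀ d, sameFace (rot.symm (edge d)) d
  /-- the marked point lies in the interior of the edge of this dart -/
  mark : D

namespace LinkDiagram

variable {D X : Type*}

section Basic

variable (L : LinkDiagram D X)

/-- Connected components of the projection (as a graph). -/
def componentSetoid : Setoid D :=
  Relation.EqvGen.setoid fun d d' => d' = L.edge d ∨ d' = L.rot d

/-- The diagram lies on a sphere: the surface obtained by gluing the faces to the projection is
connected, and Euler's formula `V - E + F = 1 + k` for a graph with `k` components drawn on the
sphere holds.  (Faces need not be discs.  For a connected surface, `V - E + F ≤ 1 + k`, with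
equality exactly when every component of the graph has genus zero and the components and faces
form a tree, i.e. when the surface is a sphere cut into planar regions.) -/
def IsPlanar : Prop :=
  (∀ d d' : D, Relation.EqvGen
    (fun a b => b = L.edge a ∨ b = L.rot a ∨ L.sameFace a b) d d') ∧
  Nat.card (Quotient (Equiv.Perm.SameCycle.setoid L.rot)) + Nat.card (Quotient L.sameFace) =
    Nat.card (Quotient (Equiv.Perm.SameCycle.setoid L.edge)) +
      (Nat.card (Quotient L.componentSetoid) + 1)

/-- The faces of the diagram: components of the complement of the projection. -/
def Face : Type _ := Quotient L.sameFace

/-- The face on the left of a dart. -/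
def face (d : D) : L.Face := Quotient.mk L.sameFace d

instance [Finite D] : Finite L.Face := inferInstanceAs (Finite (Quotient L.sameFace))

instance [Finite D] : Fintype L.Face := Fintype.ofFinite _

/-- The polynomial ring over `ℤ/2` with one variable for every face. -/
abbrev FaceRing : Type _ := MvPolynomial L.Face (ZMod 2)

/-- The field `𝔽_L` of rational functions over `ℤ/2` with one variable for every face. -/
def FaceField : Type _ := FractionRing L.FaceRing

instance : Field L.FaceField := inferInstanceAs (Field (FractionRing L.FaceRing))

instance : Algebra L.FaceRing L.FaceField :=
  inferInstanceAs (Algebra L.FaceRing (FractionRing L.FaceRing))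

instance : IsFractionRing L.FaceRing L.FaceField :=
  inferInstanceAs (IsFractionRing L.FaceRing (FractionRing L.FaceRing))

/-- The formal variable of a face. -/
def var (f : L.Face) : L.FaceField := algebraMap L.FaceRing L.FaceField (MvPolynomial.X f)

open Classical in
/-- The formal area of a union of faces. -/
def area [Finite D] (A : Set L.Face) : L.FaceField := ∑ f with f ∈ A, L.var f

theorem crossing_rot_symm (d : D) : L.crossing (L.rot.symm d) = L.crossing d := by
  have h := L.crossing_rot (L.rot.symm d)
  simpa using h.symm

theorem isOver_rot_symm (d : D) (x : X) (h : L.crossing d = some x) :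
    L.isOver (L.rot.symm d) = !L.isOver d := by
  have h := L.isOver_rot (L.rot.symm d) x (by rw [crossing_rot_symm, h])
  simp at h
  simp [h]

theorem rot_symm_eq (d : D) (x : X) (h : L.crossing d = some x) :
    L.rot.symm d = L.rot (L.rot (L.rot d)) := by
  rw [Equiv.symm_apply_eq]; exact (L.rot_four d x h).symm

end Basic

/-!  ## Complete resolutions  -/

section Resolutions

variable [DecidableEq X] (L : LinkDiagram D X)

/-- In the complete resolution `L_S` the strand which arrives at a vertex along `d` leaves it along
`L.turn S d`.  At a crossing not in `S` the resolution joins the two regions which are swept out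
when the overstrand is turned counterclockwise (the corners counterclockwise from the darts of the
overstrand); at a crossing in `S` it joins the other two. -/
def turn (S : Finset X) (d : D) : D :=
  match L.crossing d with
  | none => L.rot d
  | some x => if (L.isOver d = true ↔ x ∈ S) then L.rot d else L.rot.symm d

/-- Two darts lie on the same circle of `L_S`. -/
def circleSetoid (S : Finset X) : Setoid D :=
  Relation.EqvGen.setoid fun d d' => d' = L.edge d ∨ d' = L.turn S d

/-- The circles of `L_S`. -/
def Circle (S : Finset X) : Type _ := Quotient (L.circleSetoid S)

/-- The circle of `L_S` through a dart. -/
def circle (S : Finset X) (d : D) : L.Circle S := Quotient.mk (L.circleSetoid S) d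

/-- `L_S` is a single circle, i.e. `S ∈ O(L)`. -/
def IsSingleCircle (S : Finset X) : Prop := ∀ d d' : D, L.circle S d = L.circle S d'

/-- The faces `f` and `f'` lie in the same component of `S² \ C`, for a circle `C` of `L_S`: one
can pass from one to the other through the gaps opened by the resolution and across the edges of
the circles other than `C`. -/
def SameSide (S : Finset X) (C : L.Circle S) : L.Face → L.Face → Prop :=
  Relation.EqvGen fun f f' =>
    (∃ d x, L.crossing d = some x ∧ (L.isOver d = true ↔ x ∉ S) ∧
      f = L.face d ∧ f' = L.face (L.rot (L.rot d))) ∨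
    (∃ d, L.circle S d ≠ C ∧ f = L.face d ∧ f' = L.face (L.edge d))

/-- The interior of an unmarked circle `C` of `L_S`: the component of `S² \ C` which does not
contain the marked point, as a set of faces. -/
def interior (S : Finset X) (C : L.Circle S) : Set L.Face :=
  {f | ¬ L.SameSide S C f (L.face L.mark)}

/-- The union of the interiors of the unmarked circles of `L_S`.  When `L_S` consists of two
circles, this is the region cut off from the marked point by the unmarked one. -/
def cutRegion (S : Finset X) : Set L.Face :=
  {f | ∃ C : L.Circle S, C ≠ L.circle S L.mark ∧ f ∈ L.interior S C}

/-- The coefficient `⟨T, T'⟩ = 1/[B] + 1/[W]` for `T' = T ∪ {c₁, c₂}`: the regions `B` and `W` are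
those cut off from the marked point in the resolutions `T ∪ {c₁}` and `T ∪ {c₂}`. -/
def pairing [Finite D] (T T' : Finset X) : L.FaceField :=
  ∑ c ∈ T' \ T, (L.area (L.cutRegion (insert c T)))⁻¹

/-- The resolutions `T ∈ O(L)` with `|T| = i`. -/
def Single (i : ℤ) : Type _ := {T : Finset X // L.IsSingleCircle T ∧ (T.card : ℤ) = i}

instance [Finite X] (i : ℤ) : Finite (L.Single i) :=
  inferInstanceAs (Finite {T : Finset X // L.IsSingleCircle T ∧ (T.card : ℤ) = i})

instance [Finite X] (i : ℤ) : Fintype (L.Single i) := Fintype.ofFinite _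

/-- The chain group `CT_i(L)`: the vector space over `𝔽_L` with basis the single circle
resolutions `T` with `|T| = i`. -/
abbrev CT (i : ℤ) : Type _ := L.Single i →₀ L.FaceField

/-- The differential of the spanning tree complex,
`∂ T = ∑ ⟨T, T'⟩ T'` over the `T' ∈ O(L)` with `T ⊆ T'` and `|T'| = |T| + 2`.
Its component `CT_i(L) → CT_j(L)` vanishes unless `j = i + 2`. -/
def del [Finite D] [Finite X] (i j : ℤ) : L.CT i →ₗ[L.FaceField] L.CT j :=
  Finsupp.linearCombination L.FaceField fun T : L.Single i =>
    ∑ T' : L.Single j,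
      if T.1 ⊆ T'.1 ∧ T'.1.card = T.1.card + 2
      then Finsupp.single T' (L.pairing T.1 T'.1) else 0

end Resolutions

/-!  ## Resolving one crossing  -/

section Resolve

variable [DecidableEq X] (L : LinkDiagram D X) (c : X) (b : Bool)

/-- Rotation about the vertices after resolving `c` (by the rule for `c ∉ S` if `b = false`, and
for `c ∈ S` if `b = true`): the crossing is replaced by two vertices of valency two. -/
def resolveRotFun (d : D) : D :=
  if L.crossing d = some c then (if L.isOver d = b then L.rot d else L.rot.symm d) else L.rot d

theorem resolveRotFun_invol (d : D) (h : L.crossing d = some c) :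
    L.resolveRotFun c b (L.resolveRotFun c b d) = d := by
  have h1 := L.isOver_rot d c h
  have h2 := L.isOver_rot_symm d c h
  have h3 := L.crossing_rot d
  have h4 := L.crossing_rot_symm d
  unfold resolveRotFun
  by_cases hb : L.isOver d = b <;> cases b <;> simp_all

/-- Rotation about the vertices after resolving `c`. -/
def resolveRot : Equiv.Perm D where
  toFun := L.resolveRotFun c b
  invFun d := if L.crossing d = some c then L.resolveRotFun c b d else L.rot.symm d
  left_inv d := by
    by_cases h : L.crossing d = some c
    · have h' : L.crossing (L.resolveRotFun c b d) = some c := by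
        unfold resolveRotFun
        split_ifs <;> simp [crossing_rot, crossing_rot_symm, h]
      simp only [h', if_true]
      exact L.resolveRotFun_invol c b d h
    · simp [resolveRotFun, h, crossing_rot]
  right_inv d := by
    by_cases h : L.crossing d = some c
    · simp only [h, if_true]
      exact L.resolveRotFun_invol c b d h
    · have h' : ¬ L.crossing (L.rot.symm d) = some c := by rwa [crossing_rot_symm]
      simp only [h, if_false]
      simp [resolveRotFun, h']

/-- The crossing at which a dart starts, after `c` has been resolved. -/
def resolveCrossing (d : D) : Option {x : X // x ≠ c} :=
  match L.crossing d with
  | none => none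
  | some x => if h : x = c then none else some ⟨x, h⟩

theorem resolveCrossing_eq_some (d : D) (x : {x : X // x ≠ c}) :
    L.resolveCrossing c d = some x ↔ L.crossing d = some x.1 := by
  unfold resolveCrossing
  split
  · rename_i h; simp [h]
  · rename_i y h
    rw [h]
    by_cases hy : y = c
    · subst hy
      simp [x.2.symm]
    · simp [hy, Subtype.ext_iff]

theorem resolveCrossing_eq_none (d : D) :
    L.resolveCrossing c d = none ↔ L.crossing d = none ∨ L.crossing d = some c := by
  unfold resolveCrossing
  split
  · rename_i h; simp [h]
  · rename_i y h
    rw [h]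
    by_cases hy : y = c <;> simp [hy]

theorem resolveRot_of_eq (d : D) (h : L.crossing d = some c) :
    L.resolveRot c b d = if L.isOver d = b then L.rot d else L.rot.symm d := by
  simp [resolveRot, resolveRotFun, h]

theorem resolveRot_of_ne (d : D) (h : L.crossing d ≠ some c) :
    L.resolveRot c b d = L.rot d := by
  simp [resolveRot, resolveRotFun, h]

theorem resolveRot_invol (d : D) (h : L.crossing d = some c) :
    L.resolveRot c b (L.resolveRot c b d) = d :=
  L.resolveRotFun_invol c b d h

theorem crossing_resolveRot (d : D) : L.crossing (L.resolveRot c b d) = L.crossing d := by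
  by_cases h : L.crossing d = some c
  · rw [resolveRot_of_eq _ _ _ _ h]
    split_ifs <;> simp [crossing_rot, crossing_rot_symm]
  · rw [resolveRot_of_ne _ _ _ _ h, crossing_rot]

/-- Faces after resolving `c`: the two opposite faces which meet in the gap at `c` are merged. -/
def resolveSameFace : Setoid D :=
  L.sameFace ⊔ Relation.EqvGen.setoid fun d d' =>
    L.crossing d = some c ∧ L.isOver d = !b ∧ d' = L.rot (L.rot d)

/-- The diagram obtained from `L` by resolving the crossing `c`: `L₀` (the rule for `c ∉ S`) if
`b = false`, and `L₁` (the rule for `c ∈ S`) if `b = true`.  The marked point is kept. -/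
def resolve : LinkDiagram D {x : X // x ≠ c} where
  edge := L.edge
  edge_edge := L.edge_edge
  edge_ne := L.edge_ne
  rot := L.resolveRot c b
  crossing := L.resolveCrossing c
  crossing_surj x := by
    obtain ⟨d, hd⟩ := L.crossing_surj x.1
    exact ⟨d, (L.resolveCrossing_eq_some c d x).2 hd⟩
  crossing_rot d := by
    unfold resolveCrossing
    rw [crossing_resolveRot]
  crossing_eq d d' x h h' := by
    rw [resolveCrossing_eq_some] at h h'
    have e : ∀ a, L.crossing a = some x.1 → L.resolveRot c b a = L.rot a := fun a ha =>
      L.resolveRot_of_ne c b a (by rw [ha]; simpa using x.2)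
    rw [e d h, e (L.rot d) (by rw [crossing_rot, h]),
      e (L.rot (L.rot d)) (by rw [crossing_rot, crossing_rot, h])]
    exact L.crossing_eq d d' x.1 h h'
  rot_four d x h := by
    rw [resolveCrossing_eq_some] at h
    have e : ∀ a, L.crossing a = some x.1 → L.resolveRot c b a = L.rot a := fun a ha =>
      L.resolveRot_of_ne c b a (by rw [ha]; simpa using x.2)
    rw [e d h, e (L.rot d) (by rw [crossing_rot, h]),
      e (L.rot (L.rot d)) (by rw [crossing_rot, crossing_rot, h]),
      e (L.rot (L.rot (L.rot d))) (by rw [crossing_rot, crossing_rot, crossing_rot, h])]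
    exact L.rot_four d x.1 h
  rot_two_ne d x h := by
    rw [resolveCrossing_eq_some] at h
    have e : ∀ a, L.crossing a = some x.1 → L.resolveRot c b a = L.rot a := fun a ha =>
      L.resolveRot_of_ne c b a (by rw [ha]; simpa using x.2)
    rw [e d h, e (L.rot d) (by rw [crossing_rot, h])]
    exact L.rot_two_ne d x.1 h
  bivalent_rot d h := by
    rw [resolveCrossing_eq_none] at h
    rcases h with h | h
    · have e : ∀ a, L.crossing a = none → L.resolveRot c b a = L.rot a := fun a ha =>
        L.resolveRot_of_ne c b a (by rw [ha]; simp)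
      rw [e d h, e (L.rot d) (by rw [crossing_rot, h])]
      exact L.bivalent_rot d h
    · exact L.resolveRot_invol c b d h
  bivalent_ne d h := by
    rw [resolveCrossing_eq_none] at h
    rcases h with h | h
    · rw [resolveRot_of_ne _ _ _ _ (by rw [h]; simp)]
      exact L.bivalent_ne d h
    · intro e
      have h1 := L.isOver_rot d c h
      have h2 := L.isOver_rot_symm d c h
      rw [resolveRot_of_eq _ _ _ _ h] at e
      split_ifs at e
      · rw [e] at h1; simp at h1
      · rw [e] at h2; simp at h2
  isOver := L.isOver
  isOver_rot d x h := by
    rw [resolveCrossing_eq_some] at h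
    rw [resolveRot_of_ne _ _ _ _ (by rw [h]; simpa using x.2)]
    exact L.isOver_rot d x.1 h
  sameFace := L.resolveSameFace c b
  sameFace_walk d := by
    have hle : L.sameFace ≤ L.resolveSameFace c b := le_sup_left
    have hw := hle (L.sameFace_walk d)
    set y := L.edge d with hy
    by_cases h : L.crossing y = some c
    · have hi : (L.resolveRot c b).symm y = L.resolveRot c b y := by
        rw [Equiv.symm_apply_eq, resolveRot_invol _ _ _ _ h]
      rw [hi, resolveRot_of_eq _ _ _ _ h]
      split_ifs with ho
      · refine (L.resolveSameFace c b).trans ?_ hw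
        refine (L.resolveSameFace c b).symm ?_
        have hle' : Relation.EqvGen.setoid (fun d d' =>
          L.crossing d = some c ∧ L.isOver d = !b ∧ d' = L.rot (L.rot d)) ≤
            L.resolveSameFace c b := le_sup_right
        refine hle' (Relation.EqvGen.rel _ _ ⟨?_, ?_, ?_⟩)
        · rw [crossing_rot_symm, h]
        · rw [isOver_rot_symm _ _ _ h, ho]
        · simp
      · exact hw
    · have hi : (L.resolveRot c b).symm y = L.rot.symm y := by
        rw [Equiv.symm_apply_eq, resolveRot_of_ne _ _ _ _ (by rwa [crossing_rot_symm])]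
        simp
      rw [hi]; exact hw
  mark := L.mark

/-- Every face of `L` lies in a face of the resolved diagram. -/
def faceMap : L.Face → (L.resolve c b).Face :=
  Quotient.map' id fun _ _ h => (le_sup_left : L.sameFace ≤ L.resolveSameFace c b) h

theorem faceMap_surjective : Function.Surjective (L.faceMap c b) := by
  intro g
  induction g using Quotient.inductionOn with
  | h d => exact ⟨L.face d, rfl⟩

open Classical in
/-- The ring map sending the variable of a face of the resolved diagram to the sum of the variables
of the faces of `L` which it contains: the variable of the face in which two faces `x`, `x'` of `L`
are merged goes to `x + x'`, the other variables are unchanged. -/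
def faceRingMap [Finite D] : (L.resolve c b).FaceRing →+* L.FaceRing :=
  (MvPolynomial.aeval (R := ZMod 2) fun g : (L.resolve c b).Face =>
    ∑ f : L.Face with L.faceMap c b f = g, (MvPolynomial.X f : L.FaceRing)).toRingHom

theorem faceRingMap_injective [Finite D] : Function.Injective (L.faceRingMap c b) := by
  classical
  obtain ⟨s, hs⟩ := (L.faceMap_surjective c b).hasRightInverse
  let r : L.FaceRing →ₐ[ZMod 2] (L.resolve c b).FaceRing :=
    MvPolynomial.aeval fun f : L.Face =>
      if s (L.faceMap c b f) = f then
        (MvPolynomial.X (L.faceMap c b f) : (L.resolve c b).FaceRing) else 0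
  have key : r.comp (MvPolynomial.aeval (R := ZMod 2) fun g : (L.resolve c b).Face =>
      ∑ f : L.Face with L.faceMap c b f = g, (MvPolynomial.X f : L.FaceRing)) =
      AlgHom.id _ _ := by
    apply MvPolynomial.algHom_ext
    intro g
    simp only [AlgHom.comp_apply, MvPolynomial.aeval_X, map_sum, AlgHom.id_apply, r]
    rw [Finset.sum_eq_single (s g)]
    · simp [hs g]
    · intro f hf hne
      simp only [Finset.mem_filter, Finset.mem_univ, true_and] at hf
      rw [hf, if_neg (Ne.symm hne)]
    · intro h
      exact absurd (by simp [hs g]) h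
  intro p q hpq
  have := congrArg r hpq
  have e : ∀ p, r (L.faceRingMap c b p) = p := fun p => DFunLike.congr_fun key p
  rwa [e, e] at this

/-- The induced embedding of fields `𝔽_{L₀} → 𝔽_L` or `𝔽_{L₁} → 𝔽_L`. -/
def fieldMap [Finite D] : (L.resolve c b).FaceField →+* L.FaceField :=
  IsFractionRing.lift (A := (L.resolve c b).FaceRing)
    (g := (algebraMap L.FaceRing L.FaceField).comp (L.faceRingMap c b))
    ((IsFractionRing.injective L.FaceRing L.FaceField).comp (L.faceRingMap_injective c b))

instance resolveAlgebra [Finite D] : Algebra (L.resolve c b).FaceField L.FaceField :=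
  (L.fieldMap c b).toAlgebra

end Resolve

/-!  ## Orientations  -/

section Orientations

/-- An orientation of the link: `out d` says that the edge of `d` is directed away from the vertex
of `d`.  Strands go straight through crossings. -/
structure Orientation (L : LinkDiagram D X) where
  out : D → Bool
  out_edge : ∀ d, out (L.edge d) = !out d
  out_crossing : ∀ d x, L.crossing d = some x → out (L.rot (L.rot d)) = !out d
  out_bivalent : ∀ d, L.crossing d = none → out (L.rot d) = !out d

variable {L : LinkDiagram D X}

/-- A crossing is positive (right-handed) if the outgoing dart of the understrand comes
immediately after the outgoing dart of the overstrand in counterclockwise order. -/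
def Orientation.IsPositive (o : L.Orientation) (c : X) : Prop :=
  ∃ d, L.crossing d = some c ∧ L.isOver d = true ∧ o.out d = true ∧ o.out (L.rot d) = true

/-- A crossing is negative (left-handed) if the outgoing dart of the understrand comes
immediately before the outgoing dart of the overstrand in counterclockwise order. -/
def Orientation.IsNegative (o : L.Orientation) (c : X) : Prop :=
  ∃ d, L.crossing d = some c ∧ L.isOver d = true ∧ o.out d = true ∧ o.out (L.rot d) = false

/-- The number `n₊` of positive crossings. -/
def Orientation.nPlus (o : L.Orientation) : ℤ := Nat.card {c : X // o.IsPositive c}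

theorem Orientation.out_rot_of_isPositive {o : L.Orientation} {c : X} (hc : o.IsPositive c) (d : D)
    (hd : L.crossing d = some c) (ho : L.isOver d = false) : o.out (L.rot d) = !o.out d := by
  obtain ⟨a, ha, hao, h0, h1⟩ := hc
  have h2 := o.out_crossing a c ha
  have h3 := o.out_crossing (L.rot a) c (by rw [L.crossing_rot, ha])
  have v1 := L.isOver_rot a c ha
  have v2 := L.isOver_rot (L.rot a) c (by rw [L.crossing_rot, ha])
  have h4 := L.rot_four a c ha
  rcases L.crossing_eq a d c ha hd with h | h | h | h <;> subst h <;> simp_all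

theorem Orientation.out_rot_of_isNegative {o : L.Orientation} {c : X} (hc : o.IsNegative c) (d : D)
    (hd : L.crossing d = some c) (ho : L.isOver d = true) : o.out (L.rot d) = !o.out d := by
  obtain ⟨a, ha, hao, h0, h1⟩ := hc
  have h2 := o.out_crossing a c ha
  have h3 := o.out_crossing (L.rot a) c (by rw [L.crossing_rot, ha])
  have v1 := L.isOver_rot a c ha
  have v2 := L.isOver_rot (L.rot a) c (by rw [L.crossing_rot, ha])
  have v3 := L.isOver_rot (L.rot (L.rot a)) c (by rw [L.crossing_rot, L.crossing_rot, ha])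
  have h4 := L.rot_four a c ha
  rcases L.crossing_eq a d c ha hd with h | h | h | h <;> subst h <;> simp_all

variable [DecidableEq X]

/-- The orientation inherited by a resolution at `c` that is compatible with the orientation. -/
def Orientation.inherit (o : L.Orientation) (c : X) (b : Bool)
    (h : ∀ d, L.crossing d = some c → L.isOver d = b → o.out (L.rot d) = !o.out d) :
    (L.resolve c b).Orientation where
  out := o.out
  out_edge := o.out_edge
  out_crossing d x hd := by
    have hd : L.crossing d = some x.1 := (L.resolveCrossing_eq_some c d x).1 hd
    have e : ∀ a, L.crossing a = some x.1 → L.resolveRot c b a = L.rot a := fun a ha =>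
      L.resolveRot_of_ne c b a (by rw [ha]; simpa using x.2)
    change o.out (L.resolveRot c b (L.resolveRot c b d)) = _
    rw [e d hd, e (L.rot d) (by rw [crossing_rot, hd])]
    exact o.out_crossing d x.1 hd
  out_bivalent d hd := by
    change o.out (L.resolveRot c b d) = _
    rcases (L.resolveCrossing_eq_none c d).1 hd with hd | hd
    · rw [resolveRot_of_ne _ _ _ _ (by rw [hd]; simp)]
      exact o.out_bivalent d hd
    · rw [resolveRot_of_eq _ _ _ _ hd]
      split_ifs with ho
      · exact h d hd ho
      · have hb : L.isOver (L.rot.symm d) = b := by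
          rw [isOver_rot_symm _ _ _ hd]
          cases hx : L.isOver d <;> cases b <;> simp_all
        have := h (L.rot.symm d) (by rw [crossing_rot_symm, hd]) hb
        simp at this
        simp [this]

/-- The orientation of `L₀` inherited from `L` when `c` is positive. -/
def Orientation.resolvePositive (o : L.Orientation) {c : X} (hc : o.IsPositive c) :
    (L.resolve c false).Orientation :=
  o.inherit c false (Orientation.out_rot_of_isPositive hc)

/-- The orientation of `L₁` inherited from `L` when `c` is negative. -/
def Orientation.resolveNegative (o : L.Orientation) {c : X} (hc : o.IsNegative c) :
    (L.resolve c true).Orientation :=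
  o.inherit c true (Orientation.out_rot_of_isNegative hc)

end Orientations

end LinkDiagram

/-!  ## Homology of graded vector spaces with a differential of degree two  -/

section GradedHomology

variable {k : Type*} [Field k] {M : ℤ → Type*} [∀ i, AddCommGroup (M i)] [∀ i, Module k (M i)]

/-- `ker (∂ : M_i → M_{i+2})` modulo `im (∂ : M_{i-2} → M_i)`. -/
abbrev GradedHomology (d : ∀ i j, M i →ₗ[k] M j) (i : ℤ) : Type _ :=
  LinearMap.ker (d i (i + 2)) ⧸
    (LinearMap.range (d (i - 2) i)).submoduleOf (LinearMap.ker (d i (i + 2)))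

/-- The homology class `x` is represented by the cycle `m`. -/
def GradedHomology.Represents (d : ∀ i j, M i →ₗ[k] M j) (i : ℤ)
    (x : GradedHomology d i) (m : M i) : Prop :=
  ∃ z : LinearMap.ker (d i (i + 2)), Submodule.Quotient.mk z = x ∧ (z : M i) = m

/-- The element `x` of `K ⊗ H_i(M)` is represented by the element `m` of `K ⊗ M_i`: for some
`a_r ∈ K` and cycles `z_r`, `x = ∑ a_r ⊗ [z_r]` and `m = ∑ a_r ⊗ z_r`. -/
def GradedHomology.RepresentsTensor (K : Type*) [Field K] [Algebra k K]
    (d : ∀ i j, M i →ₗ[k] M j) (i : ℤ)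
    (x : K ⊗[k] GradedHomology d i) (m : K ⊗[k] M i) : Prop :=
  ∃ w : K ⊗[k] LinearMap.ker (d i (i + 2)),
    (Submodule.mkQ ((LinearMap.range (d (i - 2) i)).submoduleOf
      (LinearMap.ker (d i (i + 2))))).baseChange K w = x ∧
    (LinearMap.ker (d i (i + 2))).subtype.baseChange K w = m

end GradedHomology

/-- The sequence
`⋯ → A_{i+a-1} → B_i → C_{i+s} → A_{i+a+1} → B_{i+2} → ⋯` is exact everywhere, for every `i`
(of the maps in the families, only those occurring in these sequences matter). -/
def IsLongExact {K : Type*} [Field K] {A B C : ℤ → Type*}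
    [∀ i, AddCommGroup (A i)] [∀ i, Module K (A i)]
    [∀ i, AddCommGroup (B i)] [∀ i, Module K (B i)]
    [∀ i, AddCommGroup (C i)] [∀ i, Module K (C i)] (a s : ℤ)
    (f : ∀ j i, A j →ₗ[K] B i) (g : ∀ i l, B i →ₗ[K] C l) (h : ∀ l j, C l →ₗ[K] A j) : Prop :=
  ∀ i : ℤ,
    Function.Exact (f (i + a - 1) i) (g i (i + s)) ∧
    Function.Exact (g i (i + s)) (h (i + s) (i + a + 1)) ∧
    Function.Exact (h (i + s) (i + a + 1)) (f (i + a + 1) (i + 2))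

namespace LinkDiagram

variable {D X : Type*} [Finite D] [Finite X] [DecidableEq X] (L : LinkDiagram D X)

/-- The unshifted spanning tree homology in degree `i`. -/
abbrev unHT (i : ℤ) : Type _ := GradedHomology L.del i

/-- The spanning tree homology in degree `i` of an oriented diagram: the unshifted homology with
its grading shifted by `[-n₊]`. -/
abbrev HT (o : L.Orientation) (i : ℤ) : Type _ := L.unHT (i + o.nPlus)

variable (c : X) (b : Bool)

/-- `CT_i(L₀) ⊗ 𝔽_L` (for `b = false`) or `CT_i(L₁) ⊗ 𝔽_L` (for `b = true`). -/
abbrev CTResolved (i : ℤ) : Type _ :=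
  L.FaceField ⊗[(L.resolve c b).FaceField] (L.resolve c b).CT i

/-- The differential of `CT(L₀) ⊗ 𝔽_L` or `CT(L₁) ⊗ 𝔽_L`. -/
def delResolved (i j : ℤ) : L.CTResolved c b i →ₗ[L.FaceField] L.CTResolved c b j :=
  ((L.resolve c b).del i j).baseChange L.FaceField

/-- `unHT_i(L₀) ⊗ 𝔽_L` (for `b = false`) or `unHT_i(L₁) ⊗ 𝔽_L` (for `b = true`). -/
abbrev unHTResolved (i : ℤ) : Type _ :=
  L.FaceField ⊗[(L.resolve c b).FaceField] (L.resolve c b).unHT i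

/-- `HT_i(L₀) ⊗ 𝔽_L` (for `b = false`) or `HT_i(L₁) ⊗ 𝔽_L` (for `b = true`), for an orientation of
the resolved diagram. -/
abbrev HTResolved (o : (L.resolve c b).Orientation) (i : ℤ) : Type _ :=
  L.FaceField ⊗[(L.resolve c b).FaceField] (L.resolve c b).HT o i

/-- A set of crossings of the resolved diagram, as a set of crossings of `L`. -/
def lift (T : Finset {x : X // x ≠ c}) : Finset X := T.map (Function.Embedding.subtype _)

/-- The map `τ_c : CT_i(L₀) ⊗ 𝔽_L → CT_j(L₁) ⊗ 𝔽_L`, `τ_c(T) = ∑ ⟨T, T'⟩ T'` over the single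
circle resolutions `T'` of `L₁` which (as resolutions of `L`) arise from `T` by changing `c` and
exactly one other crossing.  It vanishes unless `j = i + 1`. -/
def tau (i j : ℤ) : L.CTResolved c false i →ₗ[L.FaceField] L.CTResolved c true j :=
  (Algebra.TensorProduct.basis L.FaceField
    (Finsupp.basisSingleOne (R := (L.resolve c false).FaceField)
      (ι := (L.resolve c false).Single i))).constr L.FaceField
    fun T => ∑ T' : (L.resolve c true).Single j,
      if T.1 ⊆ T'.1 ∧ T'.1.card = T.1.card + 1 then
        L.pairing (lift c T.1) (insert c (lift c T'.1)) •
          ((1 : L.FaceField) ⊗ₜ[(L.resolve c true).FaceField]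
            Finsupp.single T' (1 : (L.resolve c true).FaceField))
      else 0

/-- The mapping cone of `τ_c`, in degree `i`: the direct sum of `CT_i(L₀) ⊗ 𝔽_L` and
`CT_{i-1}(L₁) ⊗ 𝔽_L`. -/
abbrev Cone (i : ℤ) : Type _ := L.CTResolved c false i × L.CTResolved c true (i - 1)

/-- The differential of the mapping cone, `∂ (a, a') = (∂ a, τ_c a + ∂ a')` (there are no signs,
since the characteristic is two). -/
def coneDel (i j : ℤ) : L.Cone c i →ₗ[L.FaceField] L.Cone c j :=
  ((L.delResolved c false i j).comp (LinearMap.fst _ _ _)).prod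
    ((L.tau c i (j - 1)).comp (LinearMap.fst _ _ _) +
      (L.delResolved c true (i - 1) (j - 1)).comp (LinearMap.snd _ _ _))

end LinkDiagram

end

/-! The main point is `∂² = 0`; the rest is a block decomposition and the homological algebra of
cones. Planar topology is turned into linear algebra over `ℤ/2` on functions on faces. Such a
function has a jump across every edge and, for a resolution `S`, a gap at every crossing: the
difference between the two faces joined there. On a connected surface satisfying Euler's formula
every mod two cycle of edges bounds a set of faces (`IsPlanar.exists_jump_eq`). Hence `L_S` is a
single circle exactly when zero is the only gapless function vanishing on both faces at the marked
point (`IsPlanar.eq_zero_of_gap`, `IsPlanar.isSingleCircle_of_gap`).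

Let `L_T` be a single circle and `x ∉ T`. Changing `x` gives two circles, by a parity argument, and
the region cut off is the unique rooted function `φ_x` whose only gap is at `x` (`IsCut`,
`IsPlanar.cutRegion_eq`). The gaps `m_xy` of `φ_x` at `y ∉ T` for the other resolution of `y` form
the interlacement matrix. It is symmetric because intersection numbers on the sphere vanish
(`IsCut.gap_true_comm`); it is zero between crossings of equal checkerboard colour; and `T ∪ {x, y}`
is a single circle iff `m_xy = 1`. Passing to `T ∪ {x, y}` is a pivot, `φ_k ↦ φ_k + m_kx φ_y + m_ky
φ_x`. In characteristic two areas add under symmetric difference, so an entry of `∂²` is a rational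
function of four areas governed by an invertible two by two matrix over `ℤ/2`. Either the
interlacement graph is two disjoint edges, and two equal terms cancel, or it is a path, and
`sum_inv_mul_inv_of_two_eq_zero` applies.

A resolution of `L₀` or `L₁` is a resolution of `L` with the state of `c` fixed; circles agree and
cut regions pull back along the map of faces, so coefficients agree under the field embedding.
Sorting the basis of `CT(L)` by the state of `c` makes `∂` block triangular with off-diagonal block
`τ_c`, which is the cone. The blocks of `∂² = 0` for `L` say that the extended complexes of `L₀` and
`L₁` are complexes and that `τ_c` is a chain map; faithful flatness removes the field extension. The
exact sequences are those of a cone, flatness identifying homology after extension of the field. The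
oriented versions are shifts of degree: `n₊` drops by one from `L` to `L₀` at a positive crossing,
and is the same for `L` and `L₁` at a negative one. -/

theorem Equiv.Perm.SameCycle.rel_of_step {α : Type*} [Finite α] {f : Equiv.Perm α} (r : Setoid α)
    (h : ∀ a, r a (f a)) {x y : α} (hxy : f.SameCycle x y) : r x y := by
  obtain ⟨n, rfl⟩ := hxy.exists_nat_pow_eq
  clear hxy
  induction n with
  | zero => exact r.refl _
  | succ n ih =>
    rw [pow_succ']
    exact r.trans ih (h _)

theorem ZMod.two_add_eq_zero_iff {a b : ZMod 2} : a + b = 0 ↔ a = b := by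
  revert a b; decide

theorem ZMod.two_ne_zero_iff {a : ZMod 2} : a ≠ 0 ↔ a = 1 := by
  revert a; decide

/-! ### Functions on faces modulo two and their jumps across edges -/

namespace LinkDiagram

variable {D X : Type*} (L : LinkDiagram D X)

/-- The left side of the reversed dart is the right side of `d`, the corner just clockwise of `d`.
Jumps are therefore differences of adjacent corners at a vertex. -/
theorem face_edge (d : D) : L.face (L.edge d) = L.face (L.rot.symm d) := by
  have h := L.sameFace_walk (L.edge d)
  rw [L.edge_edge] at h
  exact (Quotient.sound h).symm

theorem face_edge_rot (d : D) : L.face (L.edge (L.rot d)) = L.face d := by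
  rw [face_edge]; simp

/-- The difference of a function on faces across the edge of a dart. -/
def jump (φ : L.Face → ZMod 2) (d : D) : ZMod 2 := φ (L.face d) + φ (L.face (L.edge d))

theorem jump_edge (φ : L.Face → ZMod 2) (d : D) : L.jump φ (L.edge d) = L.jump φ d := by
  unfold jump
  rw [L.edge_edge, add_comm]

theorem jump_eq (φ : L.Face → ZMod 2) (d : D) :
    L.jump φ d = φ (L.face d) + φ (L.face (L.rot.symm d)) := by
  rw [jump, face_edge]

theorem jump_rot (φ : L.Face → ZMod 2) (d : D) :
    L.jump φ (L.rot d) = φ (L.face (L.rot d)) + φ (L.face d) := by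
  simp [jump_eq]

theorem jump_add (φ ψ : L.Face → ZMod 2) (d : D) :
    L.jump (φ + ψ) d = L.jump φ d + L.jump ψ d := by
  simp only [jump, Pi.add_apply]; ring

variable {L}

/-- Faces of a planar diagram are connected by passing across edges. -/
theorem IsPlanar.face_induction (hL : L.IsPlanar) {P : L.Face → Prop}
    (hP : ∀ d, P (L.face d) → P (L.face (L.edge d))) {f : L.Face} (hf : P f) (f' : L.Face) :
    P f' := by
  have hP' : ∀ d, P (L.face d) ↔ P (L.face (L.edge d)) := fun d =>
    ⟨hP d, fun h => by simpa [L.edge_edge] using hP _ h⟩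
  have key : ∀ d d' : D, P (L.face d) ↔ P (L.face d') := by
    intro d d'
    induction hL.1 d d' with
    | rel a b h =>
      rcases h with rfl | rfl | h
      · exact hP' a
      · rw [hP' (L.rot a), face_edge_rot]
      · have : L.face a = L.face b := Quotient.sound h
        rw [this]
    | refl a => exact Iff.rfl
    | symm a b _ h => exact h.symm
    | trans a b c _ _ h h' => exact h.trans h'
  induction f using Quotient.inductionOn with
  | h d =>
    induction f' using Quotient.inductionOn with
    | h d' => exact (key d d').1 hf

theorem IsPlanar.eq_of_jump_eq_zero (hL : L.IsPlanar) {φ : L.Face → ZMod 2}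
    (h : ∀ d, L.jump φ d = 0) (f f' : L.Face) : φ f = φ f' :=
  hL.face_induction (P := fun g => φ f = φ g)
    (fun d hd => hd.trans (ZMod.two_add_eq_zero_iff.1 (h d))) rfl f'

/-! ### Mod two cycles bound, by Euler's formula -/

section Jordan

open Classical in
/-- The incidence matrix of the projection, with coefficients in `ℤ/2`. -/
noncomputable def incidence [Fintype D] (L : LinkDiagram D X) :
    Matrix (Quotient (Equiv.Perm.SameCycle.setoid L.rot))
      (Quotient (Equiv.Perm.SameCycle.setoid L.edge)) (ZMod 2) :=
  fun v e => ∑ d : D, if (⟦d⟧ : Quotient (Equiv.Perm.SameCycle.setoid L.rot)) = v ∧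
    (⟦d⟧ : Quotient (Equiv.Perm.SameCycle.setoid L.edge)) = e then 1 else 0

open Classical in
theorem incidence_mulVec [Fintype D] (z : Quotient (Equiv.Perm.SameCycle.setoid L.edge) → ZMod 2)
    (v : Quotient (Equiv.Perm.SameCycle.setoid L.rot)) :
    L.incidence.mulVec z v = ∑ d : D with ⟦d⟧ = v, z ⟦d⟧ := by
  simp only [Matrix.mulVec, dotProduct, incidence, Finset.sum_mul, ite_and]
  rw [Finset.sum_comm, Finset.sum_filter]
  refine Finset.sum_congr rfl fun d _ => ?_
  split_ifs <;> simp

theorem sameCycle_edge_iff [Finite D] (d d' : D) :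
    L.edge.SameCycle d d' ↔ d' = d ∨ d' = L.edge d := by
  constructor
  · intro h
    obtain ⟨n, rfl⟩ := h.exists_nat_pow_eq
    clear h
    induction n with
    | zero => simp
    | succ n ih =>
      rw [pow_succ', Equiv.Perm.mul_apply]
      rcases ih with ih | ih <;> simp [ih, L.edge_edge]
  · rintro (rfl | rfl)
    · exact Equiv.Perm.SameCycle.refl _ _
    · exact (Equiv.Perm.sameCycle_apply_right).2 (Equiv.Perm.SameCycle.refl _ _)

open Classical in
theorem incidence_transpose_mulVec [Fintype D]
    (w : Quotient (Equiv.Perm.SameCycle.setoid L.rot) → ZMod 2) (d : D) :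
    L.incidence.transpose.mulVec w ⟦d⟧ = w ⟦d⟧ + w ⟦L.edge d⟧ := by
  have h1 : L.incidence.transpose.mulVec w ⟦d⟧ =
      ∑ d' : D with (⟦d'⟧ : Quotient (Equiv.Perm.SameCycle.setoid L.edge)) = ⟦d⟧, w ⟦d'⟧ := by
    simp only [Matrix.mulVec, dotProduct, incidence, Matrix.transpose_apply, Finset.sum_mul,
      and_comm, ite_and]
    rw [Finset.sum_comm, Finset.sum_filter]
    refine Finset.sum_congr rfl fun d _ => ?_
    split_ifs <;> simp
  have h2 : (Finset.univ.filter fun d' : D =>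
      (⟦d'⟧ : Quotient (Equiv.Perm.SameCycle.setoid L.edge)) = ⟦d⟧) = {d, L.edge d} := by
    ext d'
    simp only [Finset.mem_filter, Finset.mem_univ, true_and, Finset.mem_insert,
      Finset.mem_singleton]
    rw [← sameCycle_edge_iff, Equiv.Perm.sameCycle_comm]
    exact Quotient.eq
  rw [h1, h2, Finset.sum_pair (L.edge_ne d).symm]

theorem componentSetoid_of_sameCycle [Finite D] {d d' : D} (h : L.rot.SameCycle d d') :
    L.componentSetoid d d' :=
  h.rel_of_step L.componentSetoid fun _ => Relation.EqvGen.rel _ _ (Or.inr rfl)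

open Classical in
-- A function on vertices with zero coboundary is constant along edges, hence pulled back from the
-- set of connected components.
theorem finrank_ker_incidence_transpose [Fintype D] :
    Module.finrank (ZMod 2) (LinearMap.ker L.incidence.transpose.mulVecLin) =
      Nat.card (Quotient L.componentSetoid) := by
  classical
  let π : Quotient (Equiv.Perm.SameCycle.setoid L.rot) → Quotient L.componentSetoid :=
    Quotient.map' id fun _ _ h => componentSetoid_of_sameCycle h
  have hπ : Function.Surjective π := by
    intro q
    induction q using Quotient.inductionOn with
    | h d => exact ⟨⟦d⟧, rfl⟩
  let F : (Quotient L.componentSetoid → ZMod 2) →ₗ[ZMod 2]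
      (Quotient (Equiv.Perm.SameCycle.setoid L.rot) → ZMod 2) := LinearMap.funLeft _ _ π
  have hF : Function.Injective F := LinearMap.funLeft_injective_of_surjective _ _ _ hπ
  have hr : LinearMap.range F = LinearMap.ker L.incidence.transpose.mulVecLin := by
    ext w
    rw [LinearMap.mem_ker, LinearMap.mem_range]
    constructor
    · rintro ⟨u, rfl⟩
      ext e
      induction e using Quotient.inductionOn with
      | h d =>
        rw [Matrix.mulVecLin_apply, incidence_transpose_mulVec, Pi.zero_apply,
          ZMod.two_add_eq_zero_iff]
        exact congrArg u (Quotient.sound (Relation.EqvGen.rel _ _ (Or.inl rfl)))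
    · intro h
      have h' : ∀ d, w ⟦d⟧ = w ⟦L.edge d⟧ := fun d => by
        rw [← ZMod.two_add_eq_zero_iff, ← incidence_transpose_mulVec]
        exact congrFun h _
      refine ⟨Quotient.lift (fun d => w ⟦d⟧) ?_, ?_⟩
      · intro a b hab
        induction hab with
        | rel a b hab =>
          rcases hab with rfl | rfl
          · exact h' a
          · exact congrArg w (Quotient.sound (Equiv.Perm.sameCycle_apply_right.2
              (Equiv.Perm.SameCycle.refl _ _)))
        | refl a => rfl
        | symm a b _ h => exact h.symm
        | trans a b c _ _ h h' => exact h.trans h'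
      · ext v
        induction v using Quotient.inductionOn with
        | h d => rfl
  rw [← hr, LinearMap.finrank_range_of_inj hF, Module.finrank_fintype_fun_eq_card,
    Nat.card_eq_fintype_card]

/-- The boundary map from functions on faces to functions on edges. -/
def faceBoundary (L : LinkDiagram D X) [Finite D] : (L.Face → ZMod 2) →ₗ[ZMod 2]
    (Quotient (Equiv.Perm.SameCycle.setoid L.edge) → ZMod 2) where
  toFun φ := Quotient.lift (L.jump φ) (by
    intro a b hab
    rcases (sameCycle_edge_iff a b).1 hab with rfl | rfl
    · rfl
    · exact (L.jump_edge φ a).symm)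
  map_add' φ ψ := by
    ext e
    induction e using Quotient.inductionOn with
    | h d => exact L.jump_add φ ψ d
  map_smul' c φ := by
    ext e
    induction e using Quotient.inductionOn with
    | h d => simp [jump, mul_add]

theorem faceBoundary_mk [Finite D] (φ : L.Face → ZMod 2) (d : D) :
    L.faceBoundary φ ⟦d⟧ = L.jump φ d := rfl

/-- Only constants have no jumps, because the surface is connected. -/
theorem IsPlanar.finrank_ker_faceBoundary [Finite D] (hL : L.IsPlanar) :
    Module.finrank (ZMod 2) (LinearMap.ker L.faceBoundary) = 1 := by
  rw [finrank_eq_one_iff']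
  refine ⟨⟨fun _ => 1, ?_⟩, ?_, ?_⟩
  · rw [LinearMap.mem_ker]
    ext e
    induction e using Quotient.inductionOn with
    | h d => rw [faceBoundary_mk, jump]; rfl
  · intro h
    have := congrFun (congrArg Subtype.val h) (L.face L.mark)
    simp at this
  · rintro ⟨φ, hφ⟩
    refine ⟨φ (L.face L.mark), Subtype.ext ?_⟩
    ext f
    have : φ (L.face L.mark) = φ f := hL.eq_of_jump_eq_zero (fun d => by
      rw [← faceBoundary_mk, LinearMap.mem_ker.1 hφ]; rfl) _ _
    simp [this]

open Classical in
-- In the sum of the jumps around a vertex every corner is counted twice, once from each of its two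
-- sides.
theorem range_faceBoundary_le [Fintype D] :
    LinearMap.range L.faceBoundary ≤ LinearMap.ker L.incidence.mulVecLin := by
  classical
  rintro _ ⟨φ, rfl⟩
  rw [LinearMap.mem_ker]
  ext v
  rw [Matrix.mulVecLin_apply, incidence_mulVec, Pi.zero_apply]
  simp only [faceBoundary_mk, jump_eq]
  rw [Finset.sum_add_distrib, ZMod.two_add_eq_zero_iff]
  refine Finset.sum_equiv L.rot (fun d => ?_) (fun d _ => by simp)
  simp only [Finset.mem_filter, Finset.mem_univ, true_and]
  have : (⟦L.rot d⟧ : Quotient (Equiv.Perm.SameCycle.setoid L.rot)) = ⟦d⟧ :=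
    Quotient.sound (Equiv.Perm.sameCycle_apply_left.2 (Equiv.Perm.SameCycle.refl _ _))
  rw [this]

open Classical in
-- A dimension count: boundaries have dimension `F - 1`, cycles have dimension `E - (V - k)`, and
-- these agree by Euler's formula.
theorem IsPlanar.range_faceBoundary [Fintype D] (hL : L.IsPlanar) :
    LinearMap.range L.faceBoundary = LinearMap.ker L.incidence.mulVecLin := by
  classical
  refine Submodule.eq_of_le_of_finrank_eq range_faceBoundary_le ?_
  have h1 := LinearMap.finrank_range_add_finrank_ker L.faceBoundary
  have h2 := LinearMap.finrank_range_add_finrank_ker L.incidence.mulVecLin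
  have h3 := LinearMap.finrank_range_add_finrank_ker L.incidence.transpose.mulVecLin
  have h4 := Matrix.rank_transpose L.incidence
  have h5 := hL.2
  rw [hL.finrank_ker_faceBoundary, Module.finrank_fintype_fun_eq_card,
    ← Nat.card_eq_fintype_card] at h1
  rw [Module.finrank_fintype_fun_eq_card, ← Nat.card_eq_fintype_card] at h2
  rw [finrank_ker_incidence_transpose, Module.finrank_fintype_fun_eq_card,
    ← Nat.card_eq_fintype_card] at h3
  change Module.finrank _ (LinearMap.range L.incidence.transpose.mulVecLin) =
    Module.finrank _ (LinearMap.range L.incidence.mulVecLin) at h4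
  change _ = Nat.card (Quotient L.sameFace) at h1
  omega

/-- A cycle modulo two in the projection of a planar diagram, given together with a matching of the
darts at each vertex which it respects, is the boundary of a set of faces. -/
theorem IsPlanar.exists_jump_eq [Finite D] (hL : L.IsPlanar) (z : D → ZMod 2)
    (hz : ∀ d, z (L.edge d) = z d) (τ : D → D) (hτ : ∀ d, τ (τ d) = d) (hne : ∀ d, τ d ≠ d)
    (hrot : ∀ d, L.rot.SameCycle d (τ d)) (hzτ : ∀ d, z (τ d) = z d) :
    ∃ φ : L.Face → ZMod 2, φ (L.face L.mark) = 0 ∧ ∀ d, L.jump φ d = z d := by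
  classical
  have := Fintype.ofFinite D
  let ζ : Quotient (Equiv.Perm.SameCycle.setoid L.edge) → ZMod 2 := Quotient.lift z (by
    intro a b hab
    rcases (sameCycle_edge_iff a b).1 hab with rfl | rfl
    · rfl
    · exact (hz a).symm)
  have hmem : ζ ∈ LinearMap.ker L.incidence.mulVecLin := by
    rw [LinearMap.mem_ker]
    ext v
    rw [Matrix.mulVecLin_apply, incidence_mulVec, Pi.zero_apply]
    -- The matching pairs the darts at a vertex into equal terms, so the sum is zero modulo two.
    refine Finset.sum_involution (fun d _ => τ d) (fun d _ => ?_) (fun d _ _ => hne d)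
      (fun d hd => ?_) (fun d _ => hτ d)
    · exact ZMod.two_add_eq_zero_iff.2 (hzτ d).symm
    · simp only [Finset.mem_filter, Finset.mem_univ, true_and] at hd ⊢
      rw [← hd]
      exact (Quotient.sound (hrot d)).symm
  rw [← hL.range_faceBoundary] at hmem
  obtain ⟨φ, hφ⟩ := hmem
  refine ⟨fun f => φ f + φ (L.face L.mark), ZMod.two_add_eq_zero_iff.2 rfl, fun d => ?_⟩
  have h : L.jump φ d = z d := by rw [← faceBoundary_mk, hφ]; rfl
  rw [← h]
  change φ _ + φ _ + (φ _ + φ _) = φ _ + φ _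
  generalize φ (L.face d) = a, φ (L.face (L.edge d)) = b, φ (L.face L.mark) = c
  revert a b c; decide

end Jordan

end LinkDiagram

namespace LinkDiagram

variable {D X : Type*} (L : LinkDiagram D X)

/-! ### The darts at a crossing and the strands of a resolution -/

section Darts

theorem exists_isOver (x : X) : ∃ d, L.crossing d = some x ∧ L.isOver d = true := by
  obtain ⟨d, hd⟩ := L.crossing_surj x
  by_cases h : L.isOver d = true
  · exact ⟨d, hd, h⟩
  · exact ⟨L.rot d, by rw [L.crossing_rot, hd], by rw [L.isOver_rot d x hd]; simpa using h⟩

/-- A dart at `x` with the gap opened by the resolution of `x` on its left, for the resolution of a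
crossing outside of `S` if `b = false` and in `S` if `b = true`. -/
noncomputable def gapDart (b : Bool) (x : X) : D :=
  if b then L.rot (L.exists_isOver x).choose else (L.exists_isOver x).choose

theorem gapDart_true (x : X) : L.gapDart true x = L.rot (L.gapDart false x) := by
  simp [gapDart]

theorem crossing_gapDart (b : Bool) (x : X) : L.crossing (L.gapDart b x) = some x := by
  have h := (L.exists_isOver x).choose_spec.1
  unfold gapDart
  split_ifs
  · rw [L.crossing_rot, h]
  · exact h

theorem isOver_gapDart (b : Bool) (x : X) : L.isOver (L.gapDart b x) = !b := by
  have h := (L.exists_isOver x).choose_spec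
  unfold gapDart
  split_ifs with hb
  · rw [L.isOver_rot _ x h.1, h.2, hb]
  · rw [h.2]; simpa using hb

theorem rot_four_gapDart (b : Bool) (x : X) :
    L.rot (L.rot (L.rot (L.rot (L.gapDart b x)))) = L.gapDart b x :=
  L.rot_four _ x (L.crossing_gapDart b x)

theorem rot_symm_gapDart (b : Bool) (x : X) :
    L.rot.symm (L.gapDart b x) = L.rot (L.rot (L.rot (L.gapDart b x))) :=
  L.rot_symm_eq _ x (L.crossing_gapDart b x)

theorem eq_of_crossing_eq (b : Bool) {x : X} {d : D} (h : L.crossing d = some x) :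
    d = L.gapDart b x ∨ d = L.rot (L.gapDart b x) ∨ d = L.rot (L.rot (L.gapDart b x)) ∨
      d = L.rot (L.rot (L.rot (L.gapDart b x))) :=
  L.crossing_eq _ d x (L.crossing_gapDart b x) h

theorem isOver_rot_gapDart (b : Bool) (x : X) : L.isOver (L.rot (L.gapDart b x)) = b := by
  rw [L.isOver_rot _ x (L.crossing_gapDart b x), isOver_gapDart, Bool.not_not]

theorem isOver_rot_rot_gapDart (b : Bool) (x : X) :
    L.isOver (L.rot (L.rot (L.gapDart b x))) = !b := by
  rw [L.isOver_rot _ x (by rw [L.crossing_rot, crossing_gapDart]), isOver_rot_gapDart]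

theorem isOver_rot_rot_rot_gapDart (b : Bool) (x : X) :
    L.isOver (L.rot (L.rot (L.rot (L.gapDart b x)))) = b := by
  rw [L.isOver_rot _ x (by rw [L.crossing_rot, L.crossing_rot, crossing_gapDart]),
    isOver_rot_rot_gapDart, Bool.not_not]

end Darts

section Turn

variable [DecidableEq X]

theorem turn_of_eq_none (S : Finset X) {d : D} (h : L.crossing d = none) :
    L.turn S d = L.rot d := by
  simp [turn, h]

theorem turn_of_eq_some (S : Finset X) {d : D} {x : X} (h : L.crossing d = some x) :
    L.turn S d = if (L.isOver d = true ↔ x ∈ S) then L.rot d else L.rot.symm d := by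
  simp [turn, h]

theorem turn_congr {S S' : Finset X} {d : D} {x : X} (h : L.crossing d = some x)
    (hx : x ∈ S ↔ x ∈ S') : L.turn S d = L.turn S' d := by
  simp only [L.turn_of_eq_some _ h, hx]

/-- Starting from the gap dart `g`, the strands join `g` to `rot³ g` and `rot g` to `rot² g`, which
leaves the corners of `g` and `rot² g` open to each other. This and the next three lemmas tabulate
it. -/
theorem turn_gapDart (S : Finset X) (x : X) :
    L.turn S (L.gapDart (decide (x ∈ S)) x) =
      L.rot (L.rot (L.rot (L.gapDart (decide (x ∈ S)) x))) := by
  rw [L.turn_of_eq_some S (L.crossing_gapDart _ x), isOver_gapDart, rot_symm_gapDart]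
  simp

theorem turn_rot_gapDart (S : Finset X) (x : X) :
    L.turn S (L.rot (L.gapDart (decide (x ∈ S)) x)) =
      L.rot (L.rot (L.gapDart (decide (x ∈ S)) x)) := by
  rw [L.turn_of_eq_some S (by rw [L.crossing_rot, crossing_gapDart]), isOver_rot_gapDart]
  simp

theorem turn_rot_rot_gapDart (S : Finset X) (x : X) :
    L.turn S (L.rot (L.rot (L.gapDart (decide (x ∈ S)) x))) =
      L.rot (L.gapDart (decide (x ∈ S)) x) := by
  rw [L.turn_of_eq_some S (by rw [L.crossing_rot, L.crossing_rot, crossing_gapDart]),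
    isOver_rot_rot_gapDart]
  simp

theorem turn_rot_rot_rot_gapDart (S : Finset X) (x : X) :
    L.turn S (L.rot (L.rot (L.rot (L.gapDart (decide (x ∈ S)) x)))) =
      L.gapDart (decide (x ∈ S)) x := by
  rw [L.turn_of_eq_some S
    (by rw [L.crossing_rot, L.crossing_rot, L.crossing_rot, crossing_gapDart]),
    isOver_rot_rot_rot_gapDart, rot_four_gapDart]
  simp

theorem crossing_turn (S : Finset X) (d : D) : L.crossing (L.turn S d) = L.crossing d := by
  unfold turn
  split
  · exact L.crossing_rot d
  · split_ifs
    · exact L.crossing_rot d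
    · exact L.crossing_rot_symm d

theorem turn_turn (S : Finset X) (d : D) : L.turn S (L.turn S d) = d := by
  cases h : L.crossing d with
  | none =>
    rw [L.turn_of_eq_none S (d := L.turn S d) (by rw [crossing_turn, h]), L.turn_of_eq_none S h,
      L.bivalent_rot d h]
  | some x =>
    rcases L.eq_of_crossing_eq (decide (x ∈ S)) h with rfl | rfl | rfl | rfl
    · rw [turn_gapDart, turn_rot_rot_rot_gapDart]
    · rw [turn_rot_gapDart, turn_rot_rot_gapDart]
    · rw [turn_rot_rot_gapDart, turn_rot_gapDart]
    · rw [turn_rot_rot_rot_gapDart, turn_gapDart]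

omit [DecidableEq X] in
theorem rot_ne (d : D) : L.rot d ≠ d := by
  cases h : L.crossing d with
  | none => exact L.bivalent_ne d h
  | some x =>
    intro e
    have := L.isOver_rot d x h
    rw [e] at this
    simp at this

theorem turn_eq_rot_or (S : Finset X) (d : D) :
    L.turn S d = L.rot d ∨ L.turn S d = L.rot.symm d := by
  unfold turn
  split
  · exact Or.inl rfl
  · split_ifs
    · exact Or.inl rfl
    · exact Or.inr rfl

theorem turn_ne (S : Finset X) (d : D) : L.turn S d ≠ d := by
  rcases L.turn_eq_rot_or S d with h | h <;> rw [h]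
  · exact L.rot_ne d
  · intro e
    rw [Equiv.symm_apply_eq] at e
    exact L.rot_ne d e.symm

theorem sameCycle_turn (S : Finset X) (d : D) : L.rot.SameCycle d (L.turn S d) := by
  rcases L.turn_eq_rot_or S d with h | h <;> rw [h]
  · exact Equiv.Perm.sameCycle_apply_right.2 (Equiv.Perm.SameCycle.refl _ _)
  · rw [← Equiv.Perm.sameCycle_apply_right, Equiv.apply_symm_apply]

theorem circle_edge (S : Finset X) (d : D) : L.circle S (L.edge d) = L.circle S d :=
  (Quotient.sound (s := L.circleSetoid S) (Relation.EqvGen.rel _ _ (Or.inl rfl))).symm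

theorem circle_turn (S : Finset X) (d : D) : L.circle S (L.turn S d) = L.circle S d :=
  (Quotient.sound (s := L.circleSetoid S) (Relation.EqvGen.rel _ _ (Or.inr rfl))).symm

variable {L}

theorem eq_of_circle_eq {S : Finset X} {α : Sort*} (u : D → α) (he : ∀ d, u (L.edge d) = u d)
    (ht : ∀ d, u (L.turn S d) = u d) {d d' : D} (h : L.circle S d = L.circle S d') :
    u d = u d' := by
  have h' : L.circleSetoid S d d' := Quotient.exact h
  clear h
  induction h' with
  | rel a b h =>
    rcases h with rfl | rfl
    · exact (he a).symm
    · exact (ht a).symm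
  | refl a => rfl
  | symm a b _ h => exact h.symm
  | trans a b c _ _ h h' => exact h.trans h'

end Turn

/-! ### Gaps, and the linear criterion for a single circle -/

section Gap

/-- The difference of a function on faces across the gap opened by a resolution of `x`. -/
noncomputable def gap (b : Bool) (x : X) : (L.Face → ZMod 2) →ₗ[ZMod 2] ZMod 2 :=
  LinearMap.proj (R := ZMod 2) (φ := fun _ : L.Face => ZMod 2) (L.face (L.gapDart b x)) +
    LinearMap.proj (R := ZMod 2) (φ := fun _ : L.Face => ZMod 2) (L.face (L.rot (L.rot (L.gapDart b x))))

theorem gap_apply (b : Bool) (x : X) (φ : L.Face → ZMod 2) : L.gap b x φ =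
    φ (L.face (L.gapDart b x)) + φ (L.face (L.rot (L.rot (L.gapDart b x)))) := rfl

/-- Functions which vanish on the two faces at the marked point. -/
def rooted : Submodule (ZMod 2) (L.Face → ZMod 2) where
  carrier := {φ | φ (L.face L.mark) = 0 ∧ φ (L.face (L.edge L.mark)) = 0}
  zero_mem' := ⟨rfl, rfl⟩
  add_mem' h h' := ⟨by simp [h.1, h'.1], by simp [h.2, h'.2]⟩
  smul_mem' c φ h := ⟨by simp [h.1], by simp [h.2]⟩

theorem jump_gapDart (b : Bool) (x : X) (φ : L.Face → ZMod 2) : L.jump φ (L.gapDart b x) =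
    φ (L.face (L.gapDart b x)) + φ (L.face (L.rot (L.rot (L.rot (L.gapDart b x))))) := by
  rw [jump_eq, rot_symm_gapDart]

/-- The two joined corners can be connected through either of the corners between them; the two ways
round give this formula and the next. -/
theorem gap_eq_jump (b : Bool) (x : X) (φ : L.Face → ZMod 2) : L.gap b x φ =
    L.jump φ (L.rot (L.gapDart b x)) + L.jump φ (L.rot (L.rot (L.gapDart b x))) := by
  rw [gap_apply, jump_rot, jump_rot]
  generalize φ _ = p, φ _ = q, φ _ = r
  revert p q r; decide

theorem gap_eq_jump' (b : Bool) (x : X) (φ : L.Face → ZMod 2) : L.gap b x φ =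
    L.jump φ (L.gapDart b x) + L.jump φ (L.rot (L.rot (L.rot (L.gapDart b x)))) := by
  rw [gap_apply, jump_rot, jump_gapDart]
  generalize φ _ = p, φ _ = q, φ _ = r
  revert p q r; decide

variable {L} [DecidableEq X]

/-- The two darts of a strand at a crossing are those met on one way round from one joined corner to
the other, so a zero gap makes their jumps equal. -/
theorem jump_turn {S : Finset X} {φ : L.Face → ZMod 2}
    (h : ∀ x, L.gap (decide (x ∈ S)) x φ = 0) (d : D) : L.jump φ (L.turn S d) = L.jump φ d := by
  cases hd : L.crossing d with
  | none =>
    rw [L.turn_of_eq_none S hd, jump_rot, jump_eq, add_comm]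
    congr 3
    rw [Equiv.eq_symm_apply, L.bivalent_rot d hd]
  | some x =>
    have h1 := h x
    have h2 := h x
    rw [gap_eq_jump, ZMod.two_add_eq_zero_iff] at h1
    rw [gap_eq_jump', ZMod.two_add_eq_zero_iff] at h2
    rcases L.eq_of_crossing_eq (decide (x ∈ S)) hd with rfl | rfl | rfl | rfl
    · rw [turn_gapDart, h2]
    · rw [turn_rot_gapDart, h1]
    · rw [turn_rot_rot_gapDart, h1]
    · rw [turn_rot_rot_rot_gapDart, h2]

theorem jump_eq_of_circle_eq {S : Finset X} {φ : L.Face → ZMod 2}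
    (h : ∀ x, L.gap (decide (x ∈ S)) x φ = 0) {d d' : D} (hd : L.circle S d = L.circle S d') :
    L.jump φ d = L.jump φ d' :=
  eq_of_circle_eq (L.jump φ) (L.jump_edge φ) (jump_turn h) hd

omit [DecidableEq X] in
theorem jump_mark {φ : L.Face → ZMod 2} (h : φ ∈ L.rooted) : L.jump φ L.mark = 0 := by
  rw [jump, h.1, h.2]; rfl

/-- Without gaps the jump is constant along the only circle, and it is zero at the marked point. -/
theorem IsPlanar.eq_zero_of_gap (hL : L.IsPlanar) {S : Finset X} (hS : L.IsSingleCircle S)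
    {φ : L.Face → ZMod 2} (hφ : φ ∈ L.rooted) (h : ∀ x, L.gap (decide (x ∈ S)) x φ = 0) :
    φ = 0 := by
  ext f
  rw [hL.eq_of_jump_eq_zero (φ := φ) (fun d => ?_) f (L.face L.mark), hφ.1]
  · rfl
  · rw [jump_eq_of_circle_eq h (hS d L.mark), jump_mark hφ]

variable [Finite D]

open Classical in
-- A Jordan curve theorem: the matching `turn S` preserves a circle, which is thus a mod two cycle
-- and bounds. The gaps vanish because both darts of a strand lie on the same circle.
theorem IsPlanar.exists_jump_circle (hL : L.IsPlanar) (S : Finset X) (C : L.Circle S) :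
    ∃ φ : L.Face → ZMod 2, φ (L.face L.mark) = 0 ∧
      (∀ d, L.jump φ d = if L.circle S d = C then 1 else 0) ∧
      ∀ x, L.gap (decide (x ∈ S)) x φ = 0 := by
  obtain ⟨φ, h0, hφ⟩ := hL.exists_jump_eq (fun d => if L.circle S d = C then 1 else 0)
    (fun d => by rw [circle_edge]) (L.turn S) (L.turn_turn S) (L.turn_ne S)
    (L.sameCycle_turn S) (fun d => by rw [circle_turn])
  refine ⟨φ, h0, hφ, fun x => ?_⟩
  rw [gap_eq_jump, ZMod.two_add_eq_zero_iff, hφ, hφ, ← turn_rot_gapDart, circle_turn]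

omit [DecidableEq X] [Finite D] in
theorem rooted_of_jump_mark {φ : L.Face → ZMod 2} (h : φ (L.face L.mark) = 0)
    (h' : L.jump φ L.mark = 0) : φ ∈ L.rooted := by
  refine ⟨h, ?_⟩
  rw [jump, h, zero_add] at h'
  exact h'

/-- An unmarked circle would bound a nonzero gapless rooted function. -/
theorem IsPlanar.isSingleCircle_of_gap (hL : L.IsPlanar) {S : Finset X}
    (h : ∀ φ ∈ L.rooted, (∀ x, L.gap (decide (x ∈ S)) x φ = 0) → φ = 0) :
    L.IsSingleCircle S := by
  classical
  have key : ∀ d, L.circle S d = L.circle S L.mark := by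
    intro d
    by_contra hne
    obtain ⟨φ, h0, hφ, hg⟩ := hL.exists_jump_circle S (L.circle S d)
    have hz := h φ (rooted_of_jump_mark h0 (by rw [hφ, if_neg (Ne.symm hne)])) hg
    have := hφ d
    rw [hz, if_pos rfl] at this
    simp [jump] at this
  exact fun d d' => (key d).trans (key d').symm

theorem IsPlanar.exists_checkerboard (hL : L.IsPlanar) :
    ∃ χ : L.Face → ZMod 2, ∀ d, L.jump χ d = 1 := by
  -- All edges together form a cycle because valencies are even. Any matching at the vertices will
  -- do; that of the resolution `∅` is at hand.
  obtain ⟨χ, -, h⟩ := hL.exists_jump_eq (fun _ => 1) (fun _ => rfl) (L.turn ∅) (L.turn_turn ∅)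
    (L.turn_ne ∅) (L.sameCycle_turn ∅) (fun _ => rfl)
  exact ⟨χ, h⟩

omit [DecidableEq X] [Finite D] in
theorem checkerboard_rot {χ : L.Face → ZMod 2} (h : ∀ d, L.jump χ d = 1) (d : D) :
    χ (L.face (L.rot d)) = χ (L.face d) + 1 := by
  have := h (L.rot d)
  rw [jump_rot] at this
  revert this
  generalize χ _ = p, χ _ = q
  revert p q; decide

omit [DecidableEq X] [Finite D] in
theorem checkerboard_edge {χ : L.Face → ZMod 2} (h : ∀ d, L.jump χ d = 1) (d : D) :
    χ (L.face (L.edge d)) = χ (L.face d) + 1 := by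
  have := h d
  rw [jump] at this
  revert this
  generalize χ _ = p, χ _ = q
  revert p q; decide

omit [Finite D] in
theorem checkerboard_turn {χ : L.Face → ZMod 2} (h : ∀ d, L.jump χ d = 1) (S : Finset X) (d : D) :
    χ (L.face (L.turn S d)) = χ (L.face d) + 1 := by
  rcases L.turn_eq_rot_or S d with e | e <;> rw [e]
  · exact checkerboard_rot h d
  · have := checkerboard_rot h (L.rot.symm d)
    simp only [Equiv.apply_symm_apply] at this
    rw [this]
    generalize χ _ = p
    revert p; decide

end Gap

end LinkDiagram

/-! ### Parity of the number of circles -/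

theorem Equiv.Perm.isCycle_and_support_eq_univ {α : Type*} [Fintype α] [DecidableEq α]
    {σ : Equiv.Perm α} {a b : α} (hab : a ≠ b) (h : ∀ x y, σ.SameCycle x y) :
    σ.IsCycle ∧ σ.support = Finset.univ := by
  have hfix : ∀ x, σ x ≠ x := by
    intro x hx
    have key : ∀ y, y = x := by
      intro y
      obtain ⟨n, rfl⟩ := (h x y)
      exact Equiv.Perm.zpow_apply_eq_self_of_apply_eq_self hx n
    exact hab ((key a).trans (key b).symm)
  exact ⟨⟨a, hfix a, fun y _ => h a y⟩, by ext x; simp [hfix x]⟩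

/-- Composing a permutation with a transposition changes the parity of the number of orbits. -/
theorem Equiv.Perm.not_transitive_mul_swap {α : Type*} [Finite α] [DecidableEq α]
    {σ : Equiv.Perm α} {a b : α} (hab : a ≠ b) (h : ∀ x y, σ.SameCycle x y)
    (h' : ∀ x y, (σ * Equiv.swap a b).SameCycle x y) : False := by
  have := Fintype.ofFinite α
  obtain ⟨h1, h2⟩ := Equiv.Perm.isCycle_and_support_eq_univ hab h
  obtain ⟨h3, h4⟩ := Equiv.Perm.isCycle_and_support_eq_univ hab h'
  -- Two cycles moving every point have the same sign, whereas a transposition changes the sign.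
  have e1 := h1.sign
  have e2 := h3.sign
  rw [h4, ← h2, ← e1, Equiv.Perm.sign_mul, Equiv.Perm.sign_swap hab] at e2
  rcases Int.units_eq_one_or (Equiv.Perm.sign σ) with h | h <;> rw [h] at e2 <;>
    exact absurd e2 (by decide)

theorem ZMod.two_add_one_add_one (a : ZMod 2) : a + 1 + 1 = a := by
  revert a; decide

theorem ZMod.two_add_one_eq_of_ne {a b : ZMod 2} (h : a ≠ b) : a + 1 = b := by
  revert a b; decide

namespace LinkDiagram

variable {D X : Type*} {L : LinkDiagram D X} [DecidableEq X] [Finite D]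

/-- Traversing the circles of `L_S` with a given colour on the left. -/
def walk (S : Finset X) {χ : L.Face → ZMod 2} (h : ∀ d, L.jump χ d = 1) (k : ZMod 2) :
    Equiv.Perm {d : D // χ (L.face d) = k} where
  toFun d := ⟨L.edge (L.turn S d.1), by
    rw [checkerboard_edge h, checkerboard_turn h, d.2,
      ZMod.two_add_one_add_one]⟩
  invFun d := ⟨L.turn S (L.edge d.1), by
    rw [checkerboard_turn h, checkerboard_edge h, d.2,
      ZMod.two_add_one_add_one]⟩
  left_inv d := by simp [L.edge_edge, L.turn_turn]
  right_inv d := by simp [L.edge_edge, L.turn_turn]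

omit [Finite D] in
-- Every edge has exactly one dart with colour `k` on its left. Assigning to a dart the orbit of the
-- one on its edge gives a function constant along circles.
theorem walk_sameCycle {S : Finset X} (hS : L.IsSingleCircle S) {χ : L.Face → ZMod 2}
    (h : ∀ d, L.jump χ d = 1) (k : ZMod 2) (a b : {d : D // χ (L.face d) = k}) :
    (walk S h k).SameCycle a b := by
  classical
  have flip : ∀ {d}, χ (L.face d) ≠ k → χ (L.face (L.edge d)) = k := by
    intro d hd
    rw [checkerboard_edge h]
    exact ZMod.two_add_one_eq_of_ne hd
  have flip' : ∀ {d}, χ (L.face d) = k → ¬ χ (L.face (L.edge d)) = k := by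
    intro d hd
    rw [checkerboard_edge h, hd]
    simp
  let ρ : D → {d : D // χ (L.face d) = k} := fun d =>
    if hd : χ (L.face d) = k then ⟨d, hd⟩ else ⟨L.edge d, flip hd⟩
  let u : D → Quotient (Equiv.Perm.SameCycle.setoid (walk S h k)) := fun d => ⟦ρ d⟧
  have step : ∀ x, (⟦walk S h k x⟧ : Quotient (Equiv.Perm.SameCycle.setoid (walk S h k))) = ⟦x⟧ :=
    fun x => Quotient.sound (Equiv.Perm.sameCycle_apply_left.2 (Equiv.Perm.SameCycle.refl _ _))
  have he : ∀ d, u (L.edge d) = u d := by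
    intro d
    suffices hs : ρ (L.edge d) = ρ d from
      congrArg (Quotient.mk (Equiv.Perm.SameCycle.setoid (walk S h k))) hs
    by_cases hd : χ (L.face d) = k
    · simp only [ρ, dif_pos hd, dif_neg (flip' hd), L.edge_edge]
    · simp only [ρ, dif_neg hd, dif_pos (flip hd)]
  have hpos : ∀ d, χ (L.face d) = k → u (L.turn S d) = u d := by
    intro d hd
    have h1 : ρ d = ⟨d, hd⟩ := by simp [ρ, hd]
    have hd' : ¬ χ (L.face (L.turn S d)) = k := by
      rw [checkerboard_turn h, ← checkerboard_edge h]
      exact flip' hd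
    have h2 : ρ (L.turn S d) = walk S h k ⟨d, hd⟩ := by
      simp [ρ, hd', walk]
    change (⟦ρ (L.turn S d)⟧ : Quotient _) = ⟦ρ d⟧
    rw [h1, h2, step]
  have ht : ∀ d, u (L.turn S d) = u d := by
    intro d
    by_cases hd : χ (L.face d) = k
    · exact hpos d hd
    · have := hpos (L.turn S d) (by
        rw [checkerboard_turn h, ← checkerboard_edge h]; exact flip hd)
      rw [L.turn_turn] at this
      exact this.symm
  have hu := eq_of_circle_eq u he ht (hS a.1 b.1)
  have ha : ρ a.1 = a := by simp [ρ, a.2]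
  have hb : ρ b.1 = b := by simp [ρ, b.2]
  change (⟦ρ a.1⟧ : Quotient _) = ⟦ρ b.1⟧ at hu
  rw [ha, hb] at hu
  exact Quotient.exact hu

/-! ### Changing one crossing of a single circle; cut regions -/

section Insert

variable {T : Finset X} {x : X}

omit [Finite D] in
theorem turn_insert_of_ne {d : D} (h : L.crossing d ≠ some x) :
    L.turn (insert x T) d = L.turn T d := by
  cases hd : L.crossing d with
  | none => rw [L.turn_of_eq_none _ hd, L.turn_of_eq_none _ hd]
  | some y =>
    refine L.turn_congr hd ?_
    have : y ≠ x := by rintro rfl; exact h hd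
    simp [this]

omit [Finite D] in
theorem turn_insert_rot :
    L.turn (insert x T) (L.gapDart false x) = L.rot (L.gapDart false x) ∧
    L.turn (insert x T) (L.rot (L.gapDart false x)) = L.gapDart false x ∧
    L.turn (insert x T) (L.rot (L.rot (L.gapDart false x))) =
      L.rot (L.rot (L.rot (L.gapDart false x))) ∧
    L.turn (insert x T) (L.rot (L.rot (L.rot (L.gapDart false x)))) =
      L.rot (L.rot (L.gapDart false x)) := by
  have h1 := L.turn_gapDart (insert x T) x
  have h2 := L.turn_rot_gapDart (insert x T) x
  have h3 := L.turn_rot_rot_gapDart (insert x T) x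
  have h4 := L.turn_rot_rot_rot_gapDart (insert x T) x
  simp only [Finset.mem_insert_self, decide_true, gapDart_true, rot_four_gapDart] at h1 h2 h3 h4
  exact ⟨h4, h1, h2, h3⟩

omit [Finite D] in
theorem turn_of_notMem (hx : x ∉ T) :
    L.turn T (L.gapDart false x) = L.rot (L.rot (L.rot (L.gapDart false x))) ∧
    L.turn T (L.rot (L.gapDart false x)) = L.rot (L.rot (L.gapDart false x)) ∧
    L.turn T (L.rot (L.rot (L.gapDart false x))) = L.rot (L.gapDart false x) ∧
    L.turn T (L.rot (L.rot (L.rot (L.gapDart false x)))) = L.gapDart false x := by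
  have h1 := L.turn_gapDart T x
  have h2 := L.turn_rot_gapDart T x
  have h3 := L.turn_rot_rot_gapDart T x
  have h4 := L.turn_rot_rot_rot_gapDart T x
  simp only [hx, decide_false] at h1 h2 h3 h4
  exact ⟨h1, h2, h3, h4⟩

omit [Finite D] in
theorem circle_insert_gapDart :
    L.circle (insert x T) (L.rot (L.gapDart false x)) =
      L.circle (insert x T) (L.gapDart false x) ∧
    L.circle (insert x T) (L.rot (L.rot (L.rot (L.gapDart false x)))) =
      L.circle (insert x T) (L.rot (L.rot (L.gapDart false x))) := by
  obtain ⟨h1, -, h3, -⟩ := turn_insert_rot (L := L) (T := T) (x := x)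
  exact ⟨by rw [← h1, circle_turn], by rw [← h3, circle_turn]⟩

omit [Finite D] in
/-- Changing the resolution of one crossing of a single circle produces at most two circles. -/
theorem circle_insert_eq_or (hT : L.IsSingleCircle T) (hx : x ∉ T) (d : D) :
    L.circle (insert x T) d = L.circle (insert x T) (L.rot (L.gapDart false x)) ∨
      L.circle (insert x T) d = L.circle (insert x T) (L.rot (L.rot (L.gapDart false x))) := by
  obtain ⟨e1, e2⟩ := circle_insert_gapDart (L := L) (T := T) (x := x)
  obtain ⟨t1, t2, t3, t4⟩ := turn_of_notMem (L := L) hx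
  let u : D → Prop := fun d =>
    L.circle (insert x T) d = L.circle (insert x T) (L.rot (L.gapDart false x)) ∨
      L.circle (insert x T) d = L.circle (insert x T) (L.rot (L.rot (L.gapDart false x)))
  have hu : u d = u (L.rot (L.gapDart false x)) := by
    refine eq_of_circle_eq u (fun d => by simp only [u, circle_edge]) (fun d => ?_) (hT _ _)
    by_cases hd : L.crossing d = some x
    · have key : ∀ d, L.crossing d = some x → u d := by
        intro d hd
        rcases L.eq_of_crossing_eq false hd with rfl | rfl | rfl | rfl
        · exact Or.inl e1.symm
        · exact Or.inl rfl
        · exact Or.inr rfl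
        · exact Or.inr e2
      exact propext ⟨fun _ => key d hd, fun _ => key _ (by rw [crossing_turn, hd])⟩
    · simp only [u]
      rw [← turn_insert_of_ne (T := T) hd, circle_turn]
  change u d
  rw [hu]
  exact Or.inl rfl

/-- Changing the resolution of one crossing of a single circle produces at least two circles. -/
theorem IsPlanar.circle_insert_ne (hL : L.IsPlanar) (hT : L.IsSingleCircle T) (hx : x ∉ T) :
    L.circle (insert x T) (L.rot (L.gapDart false x)) ≠
      L.circle (insert x T) (L.rot (L.rot (L.gapDart false x))) := by
  classical
  intro heq
  have hT' : L.IsSingleCircle (insert x T) := by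
    have key : ∀ d, L.circle (insert x T) d =
        L.circle (insert x T) (L.rot (L.rot (L.gapDart false x))) := by
      intro d
      rcases circle_insert_eq_or hT hx d with h | h
      · exact h.trans heq
      · exact h
    exact fun d d' => (key d).trans (key d').symm
  obtain ⟨χ, hχ⟩ := hL.exists_checkerboard
  set p := L.gapDart false x with hp
  have hp2 : χ (L.face (L.rot (L.rot p))) = χ (L.face p) := by
    rw [checkerboard_rot hχ, checkerboard_rot hχ]
    generalize χ _ = k
    revert k; decide
  let a : {d : D // χ (L.face d) = χ (L.face p)} := ⟨p, rfl⟩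
  let b : {d : D // χ (L.face d) = χ (L.face p)} := ⟨L.rot (L.rot p), hp2⟩
  have hab : a ≠ b := by
    intro h
    exact L.rot_two_ne p x (L.crossing_gapDart _ _) (congrArg Subtype.val h).symm
  refine Equiv.Perm.not_transitive_mul_swap hab (walk_sameCycle hT hχ _) ?_
  -- Only two of the four darts at `x` have the chosen colour, and changing the resolution
  -- interchanges their continuations.
  have hw : walk T hχ (χ (L.face p)) * Equiv.swap a b = walk (insert x T) hχ (χ (L.face p)) := by
    obtain ⟨i1, -, i3, -⟩ := turn_insert_rot (L := L) (T := T) (x := x)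
    obtain ⟨t1, -, t3, -⟩ := turn_of_notMem (L := L) hx
    ext ⟨d, hd⟩
    rw [Equiv.Perm.mul_apply]
    by_cases hc : L.crossing d = some x
    · rcases L.eq_of_crossing_eq false hc with e | e | e | e
      · have : (⟨d, hd⟩ : {d : D // χ (L.face d) = χ (L.face p)}) = a := Subtype.ext e
        rw [this, Equiv.swap_apply_left]
        simp [walk, a, b, p, i1, t3]
      · exfalso
        rw [e, checkerboard_rot hχ, ← hp] at hd
        simp at hd
      · have : (⟨d, hd⟩ : {d : D // χ (L.face d) = χ (L.face p)}) = b := Subtype.ext e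
        rw [this, Equiv.swap_apply_right]
        simp [walk, a, b, p, i3, t1]
      · exfalso
        rw [e, checkerboard_rot hχ, ← hp, hp2] at hd
        simp at hd
    · rw [Equiv.swap_apply_of_ne_of_ne]
      · simp [walk, turn_insert_of_ne hc]
      · intro h
        have := congrArg Subtype.val h
        simp only [a] at this
        exact hc (by rw [this, L.crossing_gapDart])
      · intro h
        have := congrArg Subtype.val h
        simp only [b] at this
        exact hc (by rw [this, L.crossing_rot, L.crossing_rot, L.crossing_gapDart])
  rw [hw]
  exact walk_sameCycle hT' hχ _

/-- `φ` is the indicator of the region cut off from the marked point when the gap opened at `x` by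
the resolution `L_T` is closed. -/
structure IsCut (T : Finset X) (x : X) (φ : L.Face → ZMod 2) : Prop where
  rooted : φ ∈ L.rooted
  gap_self : L.gap (decide (x ∈ T)) x φ = 1
  gap_of_ne : ∀ y ≠ x, L.gap (decide (y ∈ T)) y φ = 0

omit [Finite D] in
theorem IsCut.ne_zero {φ : L.Face → ZMod 2} (h : IsCut T x φ) : φ ≠ 0 := by
  rintro rfl
  have := h.gap_self
  simp at this

omit [Finite D] in
theorem IsPlanar.isCut_unique (hL : L.IsPlanar) (hT : L.IsSingleCircle T) {φ ψ : L.Face → ZMod 2}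
    (hφ : IsCut T x φ) (hψ : IsCut T x ψ) : φ = ψ := by
  have : φ + ψ = 0 := by
    refine hL.eq_zero_of_gap hT (Submodule.add_mem _ hφ.rooted hψ.rooted) fun y => ?_
    rw [map_add, ZMod.two_add_eq_zero_iff]
    by_cases hy : y = x
    · rw [hy, hφ.gap_self, hψ.gap_self]
    · rw [hφ.gap_of_ne y hy, hψ.gap_of_ne y hy]
  ext f
  exact ZMod.two_add_eq_zero_iff.1 (congrFun this f)

/-- Take the function bounded by a circle of `L_{T ∪ {x}}` which misses the marked point. Away from
`x` it inherits zero gaps; at `x` the gap for `T` is the sum of its jumps at two darts lying on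
different circles, so it is one. -/
theorem IsPlanar.exists_isCut (hL : L.IsPlanar) (hT : L.IsSingleCircle T) (hx : x ∉ T) :
    ∃ φ, IsCut (L := L) T x φ := by
  classical
  have hne := hL.circle_insert_ne hT hx
  obtain ⟨C, hC, hC'⟩ : ∃ C, L.circle (insert x T) L.mark ≠ C ∧
      ((L.circle (insert x T) (L.rot (L.gapDart false x)) = C ∧
        L.circle (insert x T) (L.rot (L.rot (L.gapDart false x))) ≠ C) ∨
       (L.circle (insert x T) (L.rot (L.gapDart false x)) ≠ C ∧
        L.circle (insert x T) (L.rot (L.rot (L.gapDart false x))) = C)) := by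
    rcases circle_insert_eq_or hT hx L.mark with h | h
    · exact ⟨_, by rw [h]; exact hne, Or.inr ⟨hne, rfl⟩⟩
    · exact ⟨_, by rw [h]; exact hne.symm, Or.inl ⟨rfl, hne.symm⟩⟩
  obtain ⟨φ, h0, hφ, hg⟩ := hL.exists_jump_circle _ C
  refine ⟨φ, rooted_of_jump_mark h0 (by rw [hφ, if_neg hC]), ?_, fun y hy => ?_⟩
  · rw [decide_eq_false hx, gap_eq_jump, hφ, hφ]
    rcases hC' with ⟨h1, h2⟩ | ⟨h1, h2⟩ <;> simp [h1, h2]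
  · rw [← hg y]
    simp [hy]

omit [DecidableEq X] [Finite D] in
theorem checkerboard_gapDart {χ : L.Face → ZMod 2} (hχ : ∀ d, L.jump χ d = 1) (b : Bool) (y : X) :
    χ (L.face (L.rot (L.rot (L.gapDart b y)))) = χ (L.face (L.gapDart b y)) := by
  rw [checkerboard_rot hχ, checkerboard_rot hχ]
  generalize χ _ = k
  revert k; decide

omit [Finite D] in
/-- A cut region has one colour. -/
theorem IsPlanar.gap_isCut_eq_zero (hL : L.IsPlanar) (hT : L.IsSingleCircle T)
    {φ : L.Face → ZMod 2} (hφ : IsCut T x φ) {χ : L.Face → ZMod 2} (hχ : ∀ d, L.jump χ d = 1)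
    {b : Bool} {y : X} (hb : χ (L.face (L.gapDart b y)) ≠
      χ (L.face (L.gapDart (decide (x ∈ T)) x))) : L.gap b y φ = 0 := by
  classical
  -- Opposite corners at a crossing have the same colour, so restricting `φ` to the colour of the
  -- gap at `x` gives a cut function again; uniqueness then forces `φ` to be supported on that
  -- colour.
  let ψ : L.Face → ZMod 2 := fun f =>
    if χ f = χ (L.face (L.gapDart (decide (x ∈ T)) x)) then φ f else 0
  have hgap : ∀ b y, L.gap b y ψ = if χ (L.face (L.gapDart b y)) =
      χ (L.face (L.gapDart (decide (x ∈ T)) x)) then L.gap b y φ else 0 := by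
    intro b y
    simp only [gap_apply, ψ, checkerboard_gapDart hχ]
    split_ifs <;> simp
  have hψ : IsCut T x ψ := by
    refine ⟨⟨?_, ?_⟩, ?_, fun y hy => ?_⟩
    · simp [ψ, hφ.rooted.1]
    · simp [ψ, hφ.rooted.2]
    · rw [hgap, if_pos rfl, hφ.gap_self]
    · rw [hgap, hφ.gap_of_ne y hy, ite_self]
  rw [hL.isCut_unique hT hφ hψ, hgap, if_neg hb]

omit [Finite D] in
-- The two resolutions of a crossing join corners of opposite colours, and a cut region has one
-- colour: the interlacement matrix has zero diagonal. The next lemma gives its vanishing between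
-- crossings of equal colour.
theorem IsPlanar.gap_true_self (hL : L.IsPlanar) (hT : L.IsSingleCircle T)
    {χ : L.Face → ZMod 2} (hχ : ∀ d, L.jump χ d = 1) (hx : x ∉ T)
    {φ : L.Face → ZMod 2} (hφ : IsCut T x φ) : L.gap true x φ = 0 := by
  refine hL.gap_isCut_eq_zero hT hφ hχ ?_
  rw [decide_eq_false hx, gapDart_true, checkerboard_rot hχ]
  simp

omit [Finite D] in
theorem IsPlanar.gap_true_of_color_eq (hL : L.IsPlanar) (hT : L.IsSingleCircle T)
    {χ : L.Face → ZMod 2} (hχ : ∀ d, L.jump χ d = 1) (hx : x ∉ T)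
    {φ : L.Face → ZMod 2} (hφ : IsCut T x φ) {y : X}
    (hy : χ (L.face (L.gapDart false y)) = χ (L.face (L.gapDart false x))) :
    L.gap true y φ = 0 := by
  refine hL.gap_isCut_eq_zero hT hφ hχ ?_
  rw [decide_eq_false hx, gapDart_true, checkerboard_rot hχ, hy]
  simp

end Insert

end LinkDiagram

namespace LinkDiagram

variable {D X : Type*} {L : LinkDiagram D X} [DecidableEq X]

/-! ### Symmetry of the interlacement matrix -/

section Isotropy

variable [Finite D]

open Classical in
omit [Finite D] in
theorem sum_darts_at [Fintype D] {M : Type*} [AddCommMonoid M] (x : X) (s : D → M) :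
    ∑ d with L.crossing d = some x, s d =
      s (L.gapDart false x) + (s (L.rot (L.gapDart false x)) +
        (s (L.rot (L.rot (L.gapDart false x))) +
          s (L.rot (L.rot (L.rot (L.gapDart false x)))))) := by
  set p := L.gapDart false x with hp
  have hc : L.crossing p = some x := L.crossing_gapDart false x
  have h : (Finset.univ.filter fun d => L.crossing d = some x) =
      {p, L.rot p, L.rot (L.rot p), L.rot (L.rot (L.rot p))} := by
    ext d
    simp only [Finset.mem_filter, Finset.mem_univ, true_and, Finset.mem_insert,
      Finset.mem_singleton]
    refine ⟨fun h => L.crossing_eq p d x hc h, ?_⟩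
    rintro (rfl | rfl | rfl | rfl) <;> simp [L.crossing_rot, hc]
  have h1 := L.rot_two_ne p x hc
  have h2 := L.rot_ne p
  have h3 : L.rot (L.rot (L.rot p)) ≠ p := by
    intro e
    apply L.rot_ne p
    conv_rhs => rw [← L.rot_four p x hc, e]
  rw [h, Finset.sum_insert, Finset.sum_insert, Finset.sum_pair]
  · exact fun e => h2 (L.rot.injective (L.rot.injective e.symm))
  · simp only [Finset.mem_insert, Finset.mem_singleton, not_or]
    exact ⟨fun e => h2 (L.rot.injective e.symm), fun e => h1 (L.rot.injective e.symm)⟩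
  · simp only [Finset.mem_insert, Finset.mem_singleton, not_or]
    exact ⟨h2.symm, h1.symm, h3.symm⟩

/-- The intersection number of the boundaries of two sets of faces vanishes. -/
theorem sum_gap_mul_gap [Fintype X] (φ ψ : L.Face → ZMod 2) :
    ∑ x, (L.gap false x φ * L.gap true x ψ + L.gap true x φ * L.gap false x ψ) = 0 := by
  classical
  have := Fintype.ofFinite D
  let s : D → ZMod 2 := fun d =>
    φ (L.face d) * ψ (L.face (L.edge d)) + φ (L.face (L.edge d)) * ψ (L.face d)
  have htot : ∑ d, s d = 0 := by
    refine Finset.sum_involution (fun d _ => L.edge d) (fun d _ => ?_)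
      (fun d _ _ => L.edge_ne d) (fun d _ => Finset.mem_univ _) (fun d _ => L.edge_edge d)
    simp only [s, L.edge_edge]
    rw [ZMod.two_add_eq_zero_iff, add_comm]
  have hnone : ∑ d with L.crossing d = none, s d = 0 := by
    refine Finset.sum_involution (fun d _ => L.rot d) (fun d hd => ?_)
      (fun d _ _ => L.rot_ne d) (fun d hd => ?_) (fun d hd => ?_)
    · have h : L.rot.symm d = L.rot d := by
        rw [Equiv.symm_apply_eq, L.bivalent_rot d (by simpa using hd)]
      simp only [s, face_edge_rot]
      rw [L.face_edge d, h, ZMod.two_add_eq_zero_iff, add_comm]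
    · simpa [L.crossing_rot] using hd
    · exact L.bivalent_rot d (by simpa using hd)
  rw [← Finset.sum_fiberwise Finset.univ L.crossing s, Fintype.sum_option, hnone, zero_add] at htot
  rw [← htot]
  refine Finset.sum_congr rfl fun x _ => ?_
  -- The sum of `φ_i ψ_{i+1} + φ_{i+1} ψ_i` over the four corners in cyclic order factors into
  -- differences of opposite corners.
  rw [sum_darts_at]
  simp only [s, gap_apply, gapDart_true, face_edge_rot]
  rw [L.face_edge (L.gapDart false x), rot_symm_gapDart]
  ring

/-- In the intersection number of `φ` and `ψ` a crossing contributes only if one of them has a gap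
there for `T`. Only `x` and `y` remain, with contributions equal to the two sides. -/
theorem IsCut.gap_true_comm [Finite X] {T : Finset X} {x y : X} (hx : x ∉ T) (hy : y ∉ T)
    {φ ψ : L.Face → ZMod 2} (hφ : IsCut T x φ) (hψ : IsCut T y ψ) :
    L.gap true y φ = L.gap true x ψ := by
  have := Fintype.ofFinite X
  have h := sum_gap_mul_gap φ ψ
  have key : ∀ z, L.gap false z φ * L.gap true z ψ + L.gap true z φ * L.gap false z ψ =
      (if z = x then L.gap true x ψ else 0) + (if z = y then L.gap true y φ else 0) := by
    intro z
    have h1 := hφ.gap_self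
    have h2 := hψ.gap_self
    have h3 := hφ.gap_of_ne z
    have h4 := hψ.gap_of_ne z
    rw [decide_eq_false hx] at h1
    rw [decide_eq_false hy] at h2
    by_cases hz : z ∈ T
    · have hzx : z ≠ x := by rintro rfl; exact hx hz
      have hzy : z ≠ y := by rintro rfl; exact hy hz
      rw [decide_eq_true hz] at h3 h4
      rw [h3 hzx, h4 hzy, if_neg hzx, if_neg hzy]
      simp
    · rw [decide_eq_false hz] at h3 h4
      congr 1
      · split_ifs with hzx
        · rw [hzx, h1, one_mul]
        · rw [h3 hzx, zero_mul]
      · split_ifs with hzy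
        · rw [hzy, h2, mul_one]
        · rw [h4 hzy, mul_zero]
  simp only [key, Finset.sum_add_distrib, Finset.sum_ite_eq', Finset.mem_univ, if_true] at h
  exact (ZMod.two_add_eq_zero_iff.1 h).symm

end Isotropy

/-! ### The two sides of a circle, and cut regions as cut functions -/

section Sides

variable {S : Finset X} {C : L.Circle S}

variable (S C) in
/-- The relation of lying on the same side of a circle. -/
def sideSetoid : Setoid L.Face := ⟨L.SameSide S C, Relation.EqvGen.is_equivalence _⟩

theorem eq_or_eq_of_isOver_iff {d : D} {x : X} (h : L.crossing d = some x)
    (ho : L.isOver d = true ↔ x ∉ S) : d = L.gapDart (decide (x ∈ S)) x ∨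
      d = L.rot (L.rot (L.gapDart (decide (x ∈ S)) x)) := by
  rcases L.eq_of_crossing_eq (decide (x ∈ S)) h with e | e | e | e
  · exact Or.inl e
  · rw [e, isOver_rot_gapDart] at ho
    simp at ho
  · exact Or.inr e
  · rw [e, isOver_rot_rot_rot_gapDart] at ho
    simp at ho

theorem sameSide_gapDart (x : X) : L.SameSide S C (L.face (L.gapDart (decide (x ∈ S)) x))
    (L.face (L.rot (L.rot (L.gapDart (decide (x ∈ S)) x)))) :=
  Relation.EqvGen.rel _ _ (Or.inl ⟨_, x, L.crossing_gapDart _ x, by simp [isOver_gapDart], rfl, rfl⟩)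

theorem eq_of_sameSide {φ : L.Face → ZMod 2} (hg : ∀ x, L.gap (decide (x ∈ S)) x φ = 0)
    (hj : ∀ d, L.circle S d ≠ C → L.jump φ d = 0) {f f' : L.Face} (h : L.SameSide S C f f') :
    φ f = φ f' := by
  induction h with
  | rel f f' h =>
    rcases h with ⟨d, x, hd, ho, rfl, rfl⟩ | ⟨d, hd, rfl, rfl⟩
    · have := hg x
      rw [gap_apply, ZMod.two_add_eq_zero_iff] at this
      rcases eq_or_eq_of_isOver_iff hd ho with rfl | rfl
      · exact this
      · rw [rot_four_gapDart]
        exact this.symm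
    · exact ZMod.two_add_eq_zero_iff.1 (hj d hd)
  | refl _ => rfl
  | symm _ _ _ h => exact h.symm
  | trans _ _ _ _ _ h h' => exact h.trans h'

/-- The strand enters the vertex against `d` and leaves along `turn S d`; left and right of the
darts are exchanged while, up to passing through the gap, the strand keeps the same faces on its
sides. -/
theorem side_turn (d : D) :
    (⟦L.face (L.turn S d)⟧ : Quotient (sideSetoid S C)) = ⟦L.face (L.edge d)⟧ ∧
    (⟦L.face (L.edge (L.turn S d))⟧ : Quotient (sideSetoid S C)) = ⟦L.face d⟧ := by
  cases hd : L.crossing d with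
  | none =>
    have h : L.rot.symm d = L.rot d := by rw [Equiv.symm_apply_eq, L.bivalent_rot d hd]
    rw [L.turn_of_eq_none S hd, face_edge_rot, L.face_edge d, h]
    exact ⟨rfl, rfl⟩
  | some x =>
    have hg : (⟦L.face (L.gapDart (decide (x ∈ S)) x)⟧ : Quotient (sideSetoid S C)) =
        ⟦L.face (L.rot (L.rot (L.gapDart (decide (x ∈ S)) x)))⟧ :=
      Quotient.sound (sameSide_gapDart x)
    rcases L.eq_of_crossing_eq (decide (x ∈ S)) hd with rfl | rfl | rfl | rfl
    · rw [turn_gapDart, face_edge_rot, L.face_edge (L.gapDart _ x), rot_symm_gapDart]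
      exact ⟨rfl, hg.symm⟩
    · rw [turn_rot_gapDart, face_edge_rot, face_edge_rot]
      exact ⟨hg.symm, rfl⟩
    · rw [turn_rot_rot_gapDart, face_edge_rot, face_edge_rot]
      exact ⟨rfl, hg⟩
    · rw [turn_rot_rot_rot_gapDart, face_edge_rot, L.face_edge (L.gapDart _ x), rot_symm_gapDart]
      exact ⟨hg, rfl⟩

/-- A circle has at most two sides. -/
theorem IsPlanar.side_eq_or (hL : L.IsPlanar) {d₀ : D} (h₀ : L.circle S d₀ = C) (f : L.Face) :
    (⟦f⟧ : Quotient (sideSetoid S C)) = ⟦L.face d₀⟧ ∨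
      (⟦f⟧ : Quotient (sideSetoid S C)) = ⟦L.face (L.edge d₀)⟧ := by
  refine hL.face_induction (P := fun f => (⟦f⟧ : Quotient (sideSetoid S C)) = ⟦L.face d₀⟧ ∨
      (⟦f⟧ : Quotient (sideSetoid S C)) = ⟦L.face (L.edge d₀)⟧) (fun d hd => ?_)
      (f := L.face d₀) (Or.inl rfl) f
  by_cases hC : L.circle S d = C
  · let u : D → Sym2 (Quotient (sideSetoid S C)) := fun d =>
      s(⟦L.face d⟧, ⟦L.face (L.edge d)⟧)
    have hu : u d = u d₀ := by
      refine eq_of_circle_eq u (fun d => ?_) (fun d => ?_) (hC.trans h₀.symm)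
      · simp only [u, L.edge_edge]
        exact Sym2.eq_swap
      · simp only [u]
        rw [(side_turn d).1, (side_turn d).2]
        exact Sym2.eq_swap
    simp only [u, Sym2.eq_iff] at hu
    rcases hu with h | h
    · exact Or.inr h.2
    · exact Or.inl h.2
  · have : (⟦L.face d⟧ : Quotient (sideSetoid S C)) = ⟦L.face (L.edge d)⟧ :=
      Quotient.sound (Relation.EqvGen.rel _ _ (Or.inr ⟨d, hC, rfl, rfl⟩))
    rwa [← this]

variable [Finite D]

/-- The region cut off from the marked point. -/
theorem IsPlanar.cutRegion_eq (hL : L.IsPlanar) {T : Finset X} (hT : L.IsSingleCircle T) {x : X}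
    (hx : x ∉ T) {φ : L.Face → ZMod 2} (hφ : IsCut T x φ) :
    L.cutRegion (insert x T) = {f | φ f = 1} := by
  obtain ⟨χ, hχ⟩ := hL.exists_checkerboard
  have hg : ∀ y, L.gap (decide (y ∈ insert x T)) y φ = 0 := by
    intro y
    by_cases hy : y = x
    · rw [hy]
      simpa using hL.gap_true_self hT hχ hx hφ
    · rw [← hφ.gap_of_ne y hy]
      simp [hy]
  -- There are at most two circles, so all darts off an unmarked circle lie on the marked one, where
  -- `φ` has no jump.
  have hcirc : ∀ C : L.Circle (insert x T), C ≠ L.circle (insert x T) L.mark →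
      ∀ d, L.circle (insert x T) d ≠ C → L.circle (insert x T) d = L.circle (insert x T) L.mark := by
    intro C
    induction C using Quotient.inductionOn with
    | h d₀ =>
      intro hC d hd
      change L.circle _ d₀ ≠ _ at hC
      change _ ≠ L.circle _ d₀ at hd
      rcases circle_insert_eq_or hT hx d with h | h <;>
      rcases circle_insert_eq_or hT hx d₀ with h' | h' <;>
      rcases circle_insert_eq_or hT hx L.mark with h'' | h'' <;> simp_all
  have hjump : ∀ C : L.Circle (insert x T), C ≠ L.circle (insert x T) L.mark →
      ∀ d, L.circle (insert x T) d ≠ C → L.jump φ d = 0 := fun C hC d hd => by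
    rw [jump_eq_of_circle_eq hg (hcirc C hC d hd), jump_mark hφ.rooted]
  obtain ⟨d₀, hd₀⟩ : ∃ d, L.jump φ d ≠ 0 := by
    by_contra! hcon
    apply hφ.ne_zero
    ext f
    rw [hL.eq_of_jump_eq_zero hcon f (L.face L.mark), hφ.rooted.1]
    rfl
  have hd₀m : L.circle (insert x T) d₀ ≠ L.circle (insert x T) L.mark := fun h =>
    hd₀ (by rw [jump_eq_of_circle_eq hg h, jump_mark hφ.rooted])
  ext f
  constructor
  · rintro ⟨C, hC, hf⟩
    have hd₀C : L.circle (insert x T) d₀ = C := by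
      by_contra h
      exact hd₀ (hjump C hC d₀ h)
    rw [Set.mem_ofPred_eq, ← ZMod.two_ne_zero_iff]
    intro hf0
    apply hf
    have hside : ∀ {f f' : L.Face}, (⟦f⟧ : Quotient (sideSetoid (insert x T) C)) = ⟦f'⟧ →
        φ f = φ f' := fun h => eq_of_sameSide hg (hjump C hC) (Quotient.exact h)
    have hne : φ (L.face d₀) ≠ φ (L.face (L.edge d₀)) := fun h =>
      hd₀ (ZMod.two_add_eq_zero_iff.2 h)
    suffices h : (⟦f⟧ : Quotient (sideSetoid (insert x T) C)) = ⟦L.face L.mark⟧ from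
      Quotient.exact h
    -- The circle has at most two sides and `φ` takes different values on them, so `f` and the
    -- marked face, where `φ` is zero, lie on the same side.
    rcases hL.side_eq_or hd₀C f with h | h <;>
    rcases hL.side_eq_or hd₀C (L.face L.mark) with h' | h'
    · exact h.trans h'.symm
    · exact absurd (by rw [← hside h, ← hside h', hf0, hφ.rooted.1]) hne
    · exact absurd (by rw [← hside h, ← hside h', hf0, hφ.rooted.1]) hne
    · exact h.trans h'.symm
  · intro hf
    refine ⟨L.circle (insert x T) d₀, hd₀m, fun h => ?_⟩
    rw [Set.mem_ofPred_eq, eq_of_sameSide hg (hjump _ hd₀m) h, hφ.rooted.1] at hf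
    exact zero_ne_one hf

end Sides

/-! ### Areas of regions given by functions modulo two -/

section Area

omit [DecidableEq X] in
theorem faceField_add_self (a : L.FaceField) : a + a = 0 := by
  have h : (1 + 1 : L.FaceField) = 0 := by
    have h1 : (1 + 1 : L.FaceRing) = 0 := by
      rw [← map_one (MvPolynomial.C : ZMod 2 →+* L.FaceRing), ← map_add]
      exact map_zero _
    rw [← map_one (algebraMap L.FaceRing L.FaceField), ← map_add, h1, map_zero]
  rw [← one_mul a, ← add_mul, h, zero_mul]

variable [Finite D]

/-- The formal area of the region with the given indicator function. -/
noncomputable def weight : (L.Face → ZMod 2) →+ L.FaceField where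
  toFun φ := ∑ f, if φ f = 1 then L.var f else 0
  map_zero' := by simp
  map_add' φ ψ := by
    rw [← Finset.sum_add_distrib]
    refine Finset.sum_congr rfl fun f _ => ?_
    rw [Pi.add_apply]
    -- A face in both regions is counted twice, which is zero in characteristic two.
    have h := faceField_add_self (L.var f)
    have h01 : ∀ a : ZMod 2, a = 0 ∨ a = 1 := by decide
    have h2 : (1 + 1 : ZMod 2) = 0 := rfl
    rcases h01 (φ f) with ha | ha <;> rcases h01 (ψ f) with hb | hb <;> simp [ha, hb, h2, h]

omit [DecidableEq X] in
-- The face variables are linearly independent over `ℤ/2`. This keeps all denominators nonzero.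
theorem weight_eq_zero {φ : L.Face → ZMod 2} (h : weight φ = 0) : φ = 0 := by
  classical
  have h1 : (∑ f, if φ f = 1 then (MvPolynomial.X f : L.FaceRing) else 0) = 0 := by
    apply IsFractionRing.injective L.FaceRing L.FaceField
    rw [map_zero, map_sum, ← h]
    refine Finset.sum_congr rfl fun f _ => ?_
    split_ifs
    · rfl
    · simp
  ext f
  have h2 := congrArg (MvPolynomial.coeff (Finsupp.single f 1)) h1
  rw [MvPolynomial.coeff_sum, Finset.sum_eq_single f] at h2
  · by_contra hf
    rw [Pi.zero_apply, ← ne_eq, ZMod.two_ne_zero_iff] at hf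
    rw [if_pos hf] at h2
    simp at h2
  · intro g _ hg
    split_ifs
    · rw [MvPolynomial.coeff_X, if_neg]
      intro e
      exact hg (Finsupp.single_left_injective one_ne_zero e)
    · simp
  · simp

theorem IsPlanar.area_cutRegion (hL : L.IsPlanar) {T : Finset X} (hT : L.IsSingleCircle T) {x : X}
    (hx : x ∉ T) {φ : L.Face → ZMod 2} (hφ : IsCut T x φ) :
    L.area (L.cutRegion (insert x T)) = weight φ := by
  classical
  rw [hL.cutRegion_eq hT hx hφ, area, Finset.sum_filter]
  refine Finset.sum_congr rfl fun f _ => ?_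
  simp

end Area

end LinkDiagram

/-! ### The rational function identities -/

/-- With `z = x + y` the left side is `(x + y + z) / (x y z)`, and `x + y + z = 2 z = 0`. -/
theorem inv_mul_inv_add_of_two_eq_zero {K : Type*} [Field K] (h2 : (2 : K) = 0) {x y : K}
    (hx : x ≠ 0) (hy : y ≠ 0) (hxy : x + y ≠ 0) :
    x⁻¹ * y⁻¹ + x⁻¹ * (x + y)⁻¹ + y⁻¹ * (x + y)⁻¹ = 0 := by
  field_simp
  linear_combination (x + y) * h2

/-- The identity behind `∂² = 0` for four chords which form a path in the interlacement graph. -/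
theorem sum_inv_mul_inv_of_two_eq_zero {K : Type*} [Field K] (h2 : (2 : K) = 0) {x y u v : K}
    (hx : x ≠ 0) (hy : y ≠ 0) (hxy : x + y ≠ 0) (hu : u ≠ 0) (hv : v ≠ 0) (huv : u + v ≠ 0) :
    (x⁻¹ + u⁻¹) * (y⁻¹ + (u + v)⁻¹) + (y⁻¹ + v⁻¹) * ((x + y)⁻¹ + u⁻¹) +
      (x⁻¹ + v⁻¹) * ((x + y)⁻¹ + (u + v)⁻¹) = 0 := by
  -- On expanding, the terms in `x, y` alone and those in `u, v` alone are two instances of the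
  -- previous identity; the mixed terms occur in equal pairs.
  linear_combination inv_mul_inv_add_of_two_eq_zero h2 hx hy hxy +
    inv_mul_inv_add_of_two_eq_zero h2 hu hv huv +
    (x⁻¹ * (u + v)⁻¹ + u⁻¹ * y⁻¹ + v⁻¹ * (x + y)⁻¹) * h2

namespace LinkDiagram

variable {D X : Type*} {L : LinkDiagram D X} [DecidableEq X] [Finite D] [Finite X]

/-! ### Pivoting: changing two crossings at once -/

section Exchange

variable {T : Finset X} {x y k l : X} {φ ψ η θ : L.Face → ZMod 2}

/-- If the entry is zero, `φ` is gapless for `T ∪ {x, y}`. If it is one, a gapless rooted function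
is a combination of `φ` and `ψ`, whose new gaps at `x` and `y` form the invertible matrix with rows
`0 1` and `1 0`. -/
theorem IsPlanar.isSingleCircle_insert_insert_iff (hL : L.IsPlanar) (hT : L.IsSingleCircle T)
    (hx : x ∉ T) (hy : y ∉ T) (hxy : x ≠ y) (hφ : IsCut T x φ) (hψ : IsCut T y ψ) :
    L.IsSingleCircle (insert y (insert x T)) ↔ L.gap true y φ = 1 := by
  obtain ⟨χ, hχ⟩ := hL.exists_checkerboard
  have hxx := hL.gap_true_self hT hχ hx hφ
  have hyy := hL.gap_true_self hT hχ hy hψ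
  have hcomm := hφ.gap_true_comm hx hy hψ
  constructor
  · intro h
    rw [← ZMod.two_ne_zero_iff]
    intro h0
    refine hφ.ne_zero (hL.eq_zero_of_gap h hφ.rooted fun z => ?_)
    by_cases hzx : z = x
    · simpa [hzx] using hxx
    by_cases hzy : z = y
    · simpa [hzy] using h0
    · rw [← hφ.gap_of_ne z hzx]
      simp [hzx, hzy]
  · intro h
    refine hL.isSingleCircle_of_gap fun η hη hg => ?_
    have hx' := hφ.gap_self
    have hy' := hψ.gap_self
    rw [decide_eq_false hx] at hx'
    rw [decide_eq_false hy] at hy'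
    have hyx : L.gap false y φ = 0 := by rw [← hφ.gap_of_ne y hxy.symm, decide_eq_false hy]
    have hxy' : L.gap false x ψ = 0 := by rw [← hψ.gap_of_ne x hxy, decide_eq_false hx]
    -- For `T` the function `η` can have gaps only at `x` and `y`; subtracting these multiples of
    -- the cut functions removes them.
    have key : η + (L.gap false x η • φ + L.gap false y η • ψ) = 0 := by
      refine hL.eq_zero_of_gap hT (Submodule.add_mem _ hη (Submodule.add_mem _
        (Submodule.smul_mem _ _ hφ.rooted) (Submodule.smul_mem _ _ hψ.rooted))) fun z => ?_
      simp only [map_add, map_smul, smul_eq_mul]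
      by_cases hzx : z = x
      · subst hzx
        rw [decide_eq_false hx, hx', hxy']
        generalize L.gap false z η = a, L.gap false y η = b
        revert a b; decide
      by_cases hzy : z = y
      · subst hzy
        rw [decide_eq_false hy, hy', hyx]
        generalize L.gap false z η = a, L.gap false x η = b
        revert a b; decide
      · have e := hg z
        rw [show decide (z ∈ insert y (insert x T)) = decide (z ∈ T) by simp [hzx, hzy]] at e
        rw [hφ.gap_of_ne z hzx, hψ.gap_of_ne z hzy, e]
        simp
    have g1 := congrArg (L.gap true x) key
    have g2 := congrArg (L.gap true y) key
    have e1 := hg x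
    have e2 := hg y
    simp only [Finset.mem_insert, true_or, or_true, decide_true] at e1 e2
    simp only [map_add, map_smul, smul_eq_mul, map_zero, e1, e2, hxx, hyy, h, ← hcomm, mul_zero,
      mul_one, zero_add, add_zero] at g1 g2
    simpa [g1, g2] using key

/-- The pivot on the block of `x` and `y`. Since `φ` has new gaps `0, 1` and `ψ` has `1, 0` at `x,
y`, the correction cancels those of `η`; it leaves all gaps at other crossings unchanged. -/
theorem IsPlanar.isCut_insert_insert (hL : L.IsPlanar) (hT : L.IsSingleCircle T)
    (hx : x ∉ T) (hy : y ∉ T) (hxy : x ≠ y) (hφ : IsCut T x φ) (hψ : IsCut T y ψ)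
    (h1 : L.gap true y φ = 1) (hk : k ∉ T) (hkx : k ≠ x) (hky : k ≠ y) (hη : IsCut T k η) :
    IsCut (insert y (insert x T)) k (η + (L.gap true x η • ψ + L.gap true y η • φ)) := by
  obtain ⟨χ, hχ⟩ := hL.exists_checkerboard
  have hxx := hL.gap_true_self hT hχ hx hφ
  have hyy := hL.gap_true_self hT hχ hy hψ
  have hcomm := hφ.gap_true_comm hx hy hψ
  refine ⟨Submodule.add_mem _ hη.rooted (Submodule.add_mem _
        (Submodule.smul_mem _ _ hψ.rooted) (Submodule.smul_mem _ _ hφ.rooted)), ?_, fun z hz => ?_⟩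
  · have hk' : k ∉ insert y (insert x T) := by simp [hk, hkx, hky]
    have a1 := hη.gap_self
    have a2 := hφ.gap_of_ne k hkx
    have a3 := hψ.gap_of_ne k hky
    rw [decide_eq_false hk] at a1 a2 a3
    rw [decide_eq_false hk']
    simp only [map_add, map_smul, smul_eq_mul, a1, a2, a3, mul_zero, add_zero]
  · simp only [map_add, map_smul, smul_eq_mul]
    by_cases hzx : z = x
    · subst hzx
      simp only [Finset.mem_insert, true_or, or_true, decide_true, hxx, ← hcomm, h1]
      simp [ZMod.two_add_eq_zero_iff]
    by_cases hzy : z = y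
    · subst hzy
      simp only [Finset.mem_insert, true_or, decide_true, hyy, h1]
      simp [ZMod.two_add_eq_zero_iff]
    · have e : decide (z ∈ insert y (insert x T)) = decide (z ∈ T) := by simp [hzx, hzy]
      rw [e, hη.gap_of_ne z hz, hφ.gap_of_ne z hzx, hψ.gap_of_ne z hzy]
      simp

omit [Finite X] in
theorem IsPlanar.pairing_eq (hL : L.IsPlanar) (hT : L.IsSingleCircle T)
    (hx : x ∉ T) (hy : y ∉ T) (hxy : x ≠ y) (hφ : IsCut T x φ) (hψ : IsCut T y ψ) :
    L.pairing T (insert y (insert x T)) = (weight φ)⁻¹ + (weight ψ)⁻¹ := by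
  have h : insert y (insert x T) \ T = {x, y} := by
    ext z
    simp only [Finset.mem_sdiff, Finset.mem_insert, Finset.mem_singleton]
    constructor
    · tauto
    · rintro (rfl | rfl) <;> tauto
  rw [pairing, h, Finset.sum_pair hxy, hL.area_cutRegion hT hx hφ, hL.area_cutRegion hT hy hψ]

omit [Finite X] in
-- If the row of `x` were zero on `T'' \ T`, then `φ` would be a nonzero gapless function for `T''`.
theorem IsPlanar.exists_partner (hL : L.IsPlanar) (hT : L.IsSingleCircle T) {T'' : Finset X}
    (hT'' : L.IsSingleCircle T'') (hsub : T ⊆ T'') (hx : x ∈ T'' \ T) (hφ : IsCut T x φ) :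
    ∃ y ∈ T'' \ T, y ≠ x ∧ L.gap true y φ = 1 := by
  obtain ⟨χ, hχ⟩ := hL.exists_checkerboard
  rw [Finset.mem_sdiff] at hx
  have hxx := hL.gap_true_self hT hχ hx.2 hφ
  by_contra! hcon
  refine hφ.ne_zero (hL.eq_zero_of_gap hT'' hφ.rooted fun z => ?_)
  by_cases hzx : z = x
  · rw [hzx, decide_eq_true hx.1, hxx]
  by_cases hz : z ∈ T''
  · rw [decide_eq_true hz]
    by_cases hzT : z ∈ T
    · rw [← hφ.gap_of_ne z hzx, decide_eq_true hzT]
    · by_contra h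
      exact hcon z (Finset.mem_sdiff.2 ⟨hz, hzT⟩) hzx (ZMod.two_ne_zero_iff.1 h)
  · rw [← hφ.gap_of_ne z hzx, decide_eq_false hz, decide_eq_false (fun h => hz (hsub h))]

end Exchange

/-- The matrix entries of the differential. -/
noncomputable def coeff (L : LinkDiagram D X) (T T' : Finset X) : L.FaceField :=
  if T ⊆ T' ∧ T'.card = T.card + 2 then L.pairing T T' else 0

/-! ### The square of the differential on four crossings -/

section Square

variable {T T'' : Finset X} {x y k l : X} {φ ψ η θ : L.Face → ZMod 2}

open Classical in
-- Both factors are written with cut functions of `T` alone; those of the intermediate resolution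
-- come from the pivot.
theorem IsPlanar.coeff_mul_coeff (hL : L.IsPlanar) (hT : L.IsSingleCircle T)
    (hx : x ∉ T) (hy : y ∉ T) (hk : k ∉ T) (hl : l ∉ T) (hxy : x ≠ y) (hxk : x ≠ k) (hxl : x ≠ l)
    (hyk : y ≠ k) (hyl : y ≠ l) (hkl : k ≠ l)
    (hφ : IsCut T x φ) (hψ : IsCut T y ψ) (hη : IsCut T k η) (hθ : IsCut T l θ)
    (hT'' : T'' = insert l (insert k (insert y (insert x T)))) :
    (if L.IsSingleCircle (insert y (insert x T)) then
      L.coeff T (insert y (insert x T)) * L.coeff (insert y (insert x T)) T'' else 0) =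
    if L.gap true y φ = 1 then ((weight φ)⁻¹ + (weight ψ)⁻¹) *
      ((weight (η + (L.gap true x η • ψ + L.gap true y η • φ)))⁻¹ +
        (weight (θ + (L.gap true x θ • ψ + L.gap true y θ • φ)))⁻¹) else 0 := by
  have hiff := hL.isSingleCircle_insert_insert_iff hT hx hy hxy hφ hψ
  by_cases h1 : L.gap true y φ = 1
  · rw [if_pos h1, if_pos (hiff.2 h1)]
    have hk' : k ∉ insert y (insert x T) := by simp [hk, hxk.symm, hyk.symm]
    have hl' : l ∉ insert y (insert x T) := by simp [hl, hxl.symm, hyl.symm]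
    have hl'' : l ∉ insert k (insert y (insert x T)) := by simp [hl, hxl.symm, hyl.symm, hkl.symm]
    have c1 : (insert y (insert x T)).card = T.card + 2 := by
      rw [Finset.card_insert_of_notMem (by simp [hy, hxy.symm]), Finset.card_insert_of_notMem hx]
    have c2 : T''.card = (insert y (insert x T)).card + 2 := by
      rw [hT'', Finset.card_insert_of_notMem hl'', Finset.card_insert_of_notMem hk']
    have s1 : T ⊆ insert y (insert x T) := fun z hz => by simp [hz]
    have s2 : insert y (insert x T) ⊆ T'' := by
      rw [hT'']
      intro z hz
      simp only [Finset.mem_insert] at hz ⊢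
      tauto
    rw [coeff, coeff, if_pos ⟨s1, c1⟩, if_pos ⟨s2, c2⟩, hL.pairing_eq hT hx hy hxy hφ hψ, hT'',
      hL.pairing_eq (hiff.2 h1) hk' hl' hkl
        (hL.isCut_insert_insert hT hx hy hxy hφ hψ h1 hk hxk.symm hyk.symm hη)
        (hL.isCut_insert_insert hT hx hy hxy hφ hψ h1 hl hxl.symm hyl.symm hθ)]
  · rw [if_neg h1, if_neg (fun h => h1 (hiff.1 h))]

omit [DecidableEq X] [Finite X] in
theorem weight_ne_zero_of_gap {b : Bool} (h : L.gap b x φ ≠ 0) : weight φ ≠ 0 := by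
  intro h0
  rw [weight_eq_zero h0, map_zero] at h
  exact h rfl

open Classical in
omit [Finite X] in
-- Of the six pairs among four crossings, `{a₁, a₂}` and `{b₁, b₂}` do not give single circles. In
-- the application these are the pairs of equal colour.
theorem sum_coeff_mul_coeff_eq [Fintype X] {a₁ a₂ b₁ b₂ : X}
    (hT'' : T'' = insert b₂ (insert a₂ (insert b₁ (insert a₁ T))))
    (naa : ¬ L.IsSingleCircle (insert a₂ (insert a₁ T)))
    (nbb : ¬ L.IsSingleCircle (insert b₂ (insert b₁ T))) :
    ∑ T' : Finset X, (if L.IsSingleCircle T' then L.coeff T T' * L.coeff T' T'' else 0) =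
      ∑ T' ∈ ({insert b₁ (insert a₁ T), insert b₂ (insert a₂ T), insert b₂ (insert a₁ T),
        insert b₁ (insert a₂ T)} : Finset (Finset X)),
        (if L.IsSingleCircle T' then L.coeff T T' * L.coeff T' T'' else 0) := by
  symm
  refine Finset.sum_subset (Finset.subset_univ _) fun T' _ hT' => ?_
  by_contra hne
  have hs : L.IsSingleCircle T' := by
    by_contra h
    exact hne (if_neg h)
  rw [if_pos hs] at hne
  have hc1 : T ⊆ T' ∧ T'.card = T.card + 2 := by
    by_contra h
    exact hne (by rw [coeff, if_neg h, zero_mul])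
  have hc2 : T' ⊆ T'' ∧ T''.card = T'.card + 2 := by
    by_contra h
    exact hne (by rw [show L.coeff T' T'' = 0 from if_neg h, mul_zero])
  have hcard : (T' \ T).card = 2 := by
    rw [Finset.card_sdiff_of_subset hc1.1, hc1.2]; omega
  obtain ⟨p, q, hpq, hP⟩ := Finset.card_eq_two.1 hcard
  have hT'e : T' = insert q (insert p T) := by
    rw [← Finset.sdiff_union_of_subset hc1.1, hP]
    ext z; simp only [Finset.mem_union, Finset.mem_insert, Finset.mem_singleton]; tauto
  have hmem : ∀ z ∈ ({p, q} : Finset X), z = a₁ ∨ z = a₂ ∨ z = b₁ ∨ z = b₂ := by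
    intro z hz
    rw [← hP, Finset.mem_sdiff] at hz
    have := hc2.1 hz.1
    rw [hT''] at this
    simp only [Finset.mem_insert] at this
    tauto
  have hp := hmem p (by simp)
  have hq := hmem q (by simp)
  subst hT'e
  simp only [Finset.mem_insert, Finset.mem_singleton, not_or] at hT'
  obtain ⟨n1, n2, n3, n4⟩ := hT'
  have hpq' : insert q (insert p T) = insert p (insert q T) := Finset.insert_comm _ _ _
  rcases hp with rfl | rfl | rfl | rfl <;> rcases hq with rfl | rfl | rfl | rfl
  · exact hpq rfl
  · exact naa hs
  · exact n1 rfl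
  · exact n3 rfl
  · exact naa (hpq' ▸ hs)
  · exact hpq rfl
  · exact n4 rfl
  · exact n2 rfl
  · exact n1 hpq'
  · exact n4 hpq'
  · exact hpq rfl
  · exact nbb hs
  · exact n3 hpq'
  · exact n2 hpq'
  · exact nbb (hpq' ▸ hs)
  · exact hpq rfl

open Classical in
-- The interlacement graph is bipartite between the `aᵢ` and the `bᵢ`. Its two by two matrix has
-- first entry one and determinant one, which leaves four matrices: three paths and one pair of
-- disjoint edges.
theorem IsPlanar.sum_coeff_mul_coeff_aux [Fintype X] (hL : L.IsPlanar) (hT : L.IsSingleCircle T)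
    {a₁ a₂ b₁ b₂ : X} {α₁ α₂ β₁ β₂ : L.Face → ZMod 2}
    (ha₁ : a₁ ∉ T) (ha₂ : a₂ ∉ T) (hb₁ : b₁ ∉ T) (hb₂ : b₂ ∉ T)
    (haa : a₁ ≠ a₂) (h11 : a₁ ≠ b₁) (h12 : a₁ ≠ b₂) (h21 : a₂ ≠ b₁) (h22 : a₂ ≠ b₂)
    (hbb : b₁ ≠ b₂)
    (hα₁ : IsCut T a₁ α₁) (hα₂ : IsCut T a₂ α₂) (hβ₁ : IsCut T b₁ β₁) (hβ₂ : IsCut T b₂ β₂)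
    (hT'' : T'' = insert b₂ (insert a₂ (insert b₁ (insert a₁ T))))
    (haa0 : L.gap true a₂ α₁ = 0) (hbb0 : L.gap true b₂ β₁ = 0) (hab : L.gap true b₁ α₁ = 1)
    (hdet : L.gap true b₂ α₂ + L.gap true b₂ α₁ * L.gap true b₁ α₂ = 1) :
    ∑ T' : Finset X, (if L.IsSingleCircle T' then L.coeff T T' * L.coeff T' T'' else 0) = 0 := by
  have h2 : (2 : L.FaceField) = 0 := by
    rw [← one_add_one_eq_two]; exact faceField_add_self 1
  have haa0' := (hα₁.gap_true_comm ha₁ ha₂ hα₂).symm.trans haa0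
  have hbb0' := (hβ₁.gap_true_comm hb₁ hb₂ hβ₂).symm.trans hbb0
  have c11 := (hα₁.gap_true_comm ha₁ hb₁ hβ₁)
  have c12 := (hα₁.gap_true_comm ha₁ hb₂ hβ₂)
  have c21 := (hα₂.gap_true_comm ha₂ hb₁ hβ₁)
  have c22 := (hα₂.gap_true_comm ha₂ hb₂ hβ₂)
  have e11 := hL.coeff_mul_coeff hT ha₁ hb₁ ha₂ hb₂ h11 haa h12 h21.symm hbb h22 hα₁ hβ₁ hα₂ hβ₂
    hT''
  have e22 := hL.coeff_mul_coeff hT ha₂ hb₂ ha₁ hb₁ h22 haa.symm h21 h12.symm hbb.symm h11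
    hα₂ hβ₂ hα₁ hβ₁ (T'' := T'') (by rw [hT'']; ext z; simp only [Finset.mem_insert]; tauto)
  have e12 := hL.coeff_mul_coeff hT ha₁ hb₂ ha₂ hb₁ h12 haa h11 h22.symm hbb.symm h21
    hα₁ hβ₂ hα₂ hβ₁ (T'' := T'') (by rw [hT'']; ext z; simp only [Finset.mem_insert]; tauto)
  have e21 := hL.coeff_mul_coeff hT ha₂ hb₁ ha₁ hb₂ h21 haa.symm h22 h11.symm hbb h12
    hα₂ hβ₁ hα₁ hβ₂ (T'' := T'') (by rw [hT'']; ext z; simp only [Finset.mem_insert]; tauto)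
  have naa : ¬ L.IsSingleCircle (insert a₂ (insert a₁ T)) := by
    rw [hL.isSingleCircle_insert_insert_iff hT ha₁ ha₂ haa hα₁ hα₂, haa0]
    exact zero_ne_one
  have nbb : ¬ L.IsSingleCircle (insert b₂ (insert b₁ T)) := by
    rw [hL.isSingleCircle_insert_insert_iff hT hb₁ hb₂ hbb hβ₁ hβ₂, hbb0]
    exact zero_ne_one
  have hne : ∀ {A B : Finset X} (z : X), z ∈ A → z ∉ B → A ≠ B := fun z hA hB h => hB (h ▸ hA)
  rw [sum_coeff_mul_coeff_eq hT'' naa nbb, Finset.sum_insert, Finset.sum_insert, Finset.sum_pair,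
    e11, e22, e12, e21]
  rotate_left
  · exact hne a₁ (by simp) (by simp [haa, h11, ha₁])
  · simp only [Finset.mem_insert, Finset.mem_singleton, not_or]
    exact ⟨hne a₂ (by simp) (by simp [haa.symm, h22, ha₂]),
      hne b₂ (by simp) (by simp [hbb.symm, h22.symm, hb₂])⟩
  · simp only [Finset.mem_insert, Finset.mem_singleton, not_or]
    exact ⟨hne a₁ (by simp) (by simp [haa, h12, ha₁]),
      hne b₁ (by simp) (by simp [hbb, h11.symm, hb₁]),
      hne a₁ (by simp) (by simp [haa, h11, ha₁])⟩
  have wa₁ : weight α₁ ≠ 0 := weight_ne_zero_of_gap (by rw [hα₁.gap_self]; exact one_ne_zero)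
  have wa₂ : weight α₂ ≠ 0 := weight_ne_zero_of_gap (by rw [hα₂.gap_self]; exact one_ne_zero)
  have wb₁ : weight β₁ ≠ 0 := weight_ne_zero_of_gap (by rw [hβ₁.gap_self]; exact one_ne_zero)
  have wb₂ : weight β₂ ≠ 0 := weight_ne_zero_of_gap (by rw [hβ₂.gap_self]; exact one_ne_zero)
  have waa : weight α₁ + weight α₂ ≠ 0 := by
    rw [← map_add]
    refine weight_ne_zero_of_gap (x := a₁) (b := decide (a₁ ∈ T)) ?_
    rw [map_add, hα₁.gap_self, hα₂.gap_of_ne a₁ haa]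
    simp
  have wbb : weight β₁ + weight β₂ ≠ 0 := by
    rw [← map_add]
    refine weight_ne_zero_of_gap (x := b₁) (b := decide (b₁ ∈ T)) ?_
    rw [map_add, hβ₁.gap_self, hβ₂.gap_of_ne b₁ hbb]
    simp
  simp only [haa0, haa0', hbb0, hbb0', hab, ← c11, ← c12, ← c21, ← c22, zero_smul, one_smul,
    add_zero, zero_add, if_true]
  have ha := add_comm (weight α₂) (weight α₁)
  have hb := add_comm (weight β₂) (weight β₁)
  have h01 : ∀ a : ZMod 2, a = 0 ∨ a = 1 := by decide
  have h10 : ¬ (0 : ZMod 2) = 1 := zero_ne_one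
  generalize L.gap true b₂ α₂ = m22, L.gap true b₂ α₁ = m12, L.gap true b₁ α₂ = m21 at hdet ⊢
  rcases h01 m22 with rfl | rfl <;> rcases h01 m12 with rfl | rfl <;>
  rcases h01 m21 with rfl | rfl <;>
  first
  | exact absurd hdet (by decide)
  | simp only [zero_smul, one_smul, add_zero, zero_add, if_true, if_neg h10, map_add, ha, hb]
  -- A path: three intermediate resolutions contribute. The remaining two path cases are
  -- permutations of this one.
  · have := sum_inv_mul_inv_of_two_eq_zero h2 wa₁ wa₂ waa wb₂ wb₁ (hb.trans_ne wbb)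
    rw [hb] at this
    linear_combination this
  -- Two disjoint edges: the pivots change nothing, and the two orders of the two moves give the
  -- same product.
  · linear_combination ((weight α₁)⁻¹ + (weight β₁)⁻¹) * ((weight α₂)⁻¹ + (weight β₂)⁻¹) * h2
  · have := sum_inv_mul_inv_of_two_eq_zero h2 wa₂ wa₁ (ha.trans_ne waa) wb₂ wb₁ (hb.trans_ne wbb)
    rw [ha, hb] at this
    linear_combination this
  · have := sum_inv_mul_inv_of_two_eq_zero h2 wa₁ wa₂ waa wb₁ wb₂ wbb
    linear_combination this

end Square

end LinkDiagram

namespace LinkDiagram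

variable {D X : Type*} {L : LinkDiagram D X} [DecidableEq X] [Finite D] [Finite X]

omit [Finite X] in
theorem eq_insert_of_erase_erase {T T'' : Finset X} {a b k l : X} (hsub : T ⊆ T'')
    (ha : a ∈ T'' \ T) (hb : b ∈ T'' \ T) (hba : b ≠ a)
    (h : ((T'' \ T).erase a).erase b = {k, l}) :
    T'' = insert l (insert k (insert b (insert a T))) := by
  rw [← Finset.sdiff_union_of_subset hsub, ← Finset.insert_erase ha,
    ← Finset.insert_erase (Finset.mem_erase.2 ⟨hba, hb⟩), h]
  clear h ha hb hba hsub
  ext z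
  simp only [Finset.mem_union, Finset.mem_insert, Finset.mem_singleton]
  tauto

open Classical in
-- Pick a crossing `a` of `T'' \ T`, a partner `b`, and pivot on them. Since `L_{T''}` is a single
-- circle, the pivoted entry between the other two crossings is one; this is the determinant
-- condition. As interlaced crossings have different colours, two crossings of each colour are
-- present.
theorem IsPlanar.sum_coeff_mul_coeff [Fintype X] (hL : L.IsPlanar) {T T'' : Finset X}
    (hT : L.IsSingleCircle T) (hT'' : L.IsSingleCircle T'') :
    ∑ T' : Finset X, (if L.IsSingleCircle T' then L.coeff T T' * L.coeff T' T'' else 0) = 0 := by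
  by_cases hsub : T ⊆ T'' ∧ T''.card = T.card + 4
  swap
  · refine Finset.sum_eq_zero fun T' _ => ?_
    by_cases h1 : T ⊆ T' ∧ T'.card = T.card + 2
    · by_cases h2 : T' ⊆ T'' ∧ T''.card = T'.card + 2
      · exact absurd ⟨h1.1.trans h2.1, by rw [h2.2, h1.2]⟩ hsub
      · rw [show L.coeff T' T'' = 0 from if_neg h2, mul_zero, ite_self]
    · rw [show L.coeff T T' = 0 from if_neg h1, zero_mul, ite_self]
  obtain ⟨hsub, hcard⟩ := hsub
  obtain ⟨χ, hχ⟩ := hL.exists_checkerboard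
  have hS : (T'' \ T).card = 4 := by
    rw [Finset.card_sdiff_of_subset hsub, hcard]; omega
  obtain ⟨a, ha⟩ : (T'' \ T).Nonempty := Finset.card_pos.1 (by omega)
  have ha' := (Finset.mem_sdiff.1 ha).2
  obtain ⟨α, hα⟩ := hL.exists_isCut hT ha'
  obtain ⟨b, hb, hba, hab⟩ := hL.exists_partner hT hT'' hsub ha hα
  have hb' := (Finset.mem_sdiff.1 hb).2
  obtain ⟨β, hβ⟩ := hL.exists_isCut hT hb'
  have hcard2 : (((T'' \ T).erase a).erase b).card = 2 := by
    rw [Finset.card_erase_of_mem (Finset.mem_erase.2 ⟨hba, hb⟩), Finset.card_erase_of_mem ha, hS]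
  obtain ⟨k, l, hkl, hkle⟩ := Finset.card_eq_two.1 hcard2
  have hmem : ∀ z, z = k ∨ z = l ↔ z ≠ b ∧ z ≠ a ∧ z ∈ T'' ∧ z ∉ T := by
    intro z
    have := congrArg (z ∈ ·) hkle
    simpa using this.symm
  obtain ⟨hkb, hka, -, hk⟩ := (hmem k).1 (Or.inl rfl)
  obtain ⟨hlb, hla, -, hl⟩ := (hmem l).1 (Or.inr rfl)
  obtain ⟨η, hη⟩ := hL.exists_isCut hT hk
  obtain ⟨θ, hθ⟩ := hL.exists_isCut hT hl
  have hT''e : T'' = insert l (insert k (insert b (insert a T))) :=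
    eq_insert_of_erase_erase hsub ha hb hba hkle
  have hT1 := (hL.isSingleCircle_insert_insert_iff hT ha' hb' hba.symm hα hβ).2 hab
  have hk1 : k ∉ insert b (insert a T) := by simp [hkb, hka, hk]
  have hl1 : l ∉ insert b (insert a T) := by simp [hlb, hla, hl]
  have cη := hL.isCut_insert_insert hT ha' hb' hba.symm hα hβ hab hk hka hkb hη
  have cθ := hL.isCut_insert_insert hT ha' hb' hba.symm hα hβ hab hl hla hlb hθ
  have hdet := (hL.isSingleCircle_insert_insert_iff hT1 hk1 hl1 hkl cη cθ).1 (hT''e ▸ hT'')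
  have hcolor : χ (L.face (L.gapDart false l)) ≠ χ (L.face (L.gapDart false k)) := fun h => by
    rw [hL.gap_true_of_color_eq hT1 hχ hk1 cη h] at hdet
    exact zero_ne_one hdet
  have hcolor' : χ (L.face (L.gapDart false b)) ≠ χ (L.face (L.gapDart false a)) := fun h => by
    rw [hL.gap_true_of_color_eq hT hχ ha' hα h] at hab
    exact zero_ne_one hab
  simp only [map_add, map_smul, smul_eq_mul] at hdet
  have hαη := hα.gap_true_comm ha' hk hη
  have hβη := hβ.gap_true_comm hb' hk hη
  have hαθ := hα.gap_true_comm ha' hl hθ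
  have hβθ := hβ.gap_true_comm hb' hl hθ
  have hηθ := hη.gap_true_comm hk hl hθ
  have htwo : ∀ {p q r : ZMod 2}, p ≠ q → r ≠ q → p = r := by decide
  -- Which of `k` and `l` has the colour of `a` decides how the four crossings are split into colour
  -- classes.
  by_cases hka' : χ (L.face (L.gapDart false k)) = χ (L.face (L.gapDart false a))
  · have hlb' := htwo (hka' ▸ hcolor) hcolor'
    have h0 := hL.gap_true_of_color_eq hT hχ ha' hα hka'
    have h0' := hL.gap_true_of_color_eq hT hχ hb' hβ hlb'
    refine hL.sum_coeff_mul_coeff_aux hT (a₁ := a) (a₂ := k) (b₁ := b) (b₂ := l) ha' hk hb' hl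
      hka.symm hba.symm hla.symm hkb hkl hlb.symm hα hη hβ hθ hT''e h0 h0' hab ?_
    rw [← hdet, ← hαη, h0]
    ring
  · have hkb' := htwo hka' hcolor'
    have hla' : χ (L.face (L.gapDart false l)) = χ (L.face (L.gapDart false a)) :=
      htwo (hkb' ▸ hcolor) hcolor'.symm
    have h0 := hL.gap_true_of_color_eq hT hχ ha' hα hla'
    have h0' := hL.gap_true_of_color_eq hT hχ hb' hβ hkb'
    refine hL.sum_coeff_mul_coeff_aux hT (a₁ := a) (a₂ := l) (b₁ := b) (b₂ := k) ha' hl hb' hk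
      hla.symm hba.symm hka.symm hlb hkl.symm hkb.symm hα hθ hβ hη ?_ h0 h0' hab ?_
    · rw [hT''e]
      exact Finset.insert_comm _ _ _
    · rw [← hdet, ← hβη, h0', hαη, ← hβθ, hηθ]
      ring

theorem del_single (i j : ℤ) (T : L.Single i) (a : L.FaceField) :
    L.del i j (Finsupp.single T a) =
      ∑ T' : L.Single j, Finsupp.single T' (a * L.coeff T.1 T'.1) := by
  rw [del, Finsupp.linearCombination_single, Finset.smul_sum]
  refine Finset.sum_congr rfl fun T' _ => ?_
  rw [coeff]
  split_ifs <;> simp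

omit [Finite D] in
theorem sum_single_eq [Fintype X] {M : Type*} [AddCommMonoid M] (j : ℤ) (F : Finset X → M)
    (hF : ∀ T, (T.card : ℤ) ≠ j → F T = 0) :
    open Classical in ∑ T : L.Single j, F T.1 =
      ∑ T : Finset X, if L.IsSingleCircle T then F T else 0 := by
  classical
  rw [← Finset.sum_filter]
  have h1 : ∑ T with L.IsSingleCircle T, F T =
      ∑ T with (L.IsSingleCircle T ∧ (T.card : ℤ) = j), F T := by
    symm
    refine Finset.sum_subset (fun T hT => ?_) fun T hT hT' => ?_
    · simp only [Finset.mem_filter, Finset.mem_univ, true_and] at hT ⊢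
      exact hT.1
    · simp only [Finset.mem_filter, Finset.mem_univ, true_and] at hT hT'
      exact hF T fun h => hT' ⟨hT, h⟩
  have : Fintype {T // L.IsSingleCircle T ∧ (T.card : ℤ) = j} := Fintype.ofFinite _
  rw [h1, Finset.sum_subtype (p := fun T => L.IsSingleCircle T ∧ (T.card : ℤ) = j) (F := this)]
  · refine Finset.sum_equiv (Equiv.refl _) (by simp) fun _ _ => rfl
  · simp

theorem IsPlanar.del_comp_del (hL : L.IsPlanar) (i j k : ℤ) : L.del j k ∘ₗ L.del i j = 0 := by
  classical
  have := Fintype.ofFinite X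
  refine Finsupp.lhom_ext fun T a => ?_
  rw [LinearMap.comp_apply, del_single, map_sum, LinearMap.zero_apply]
  simp only [del_single]
  rw [Finset.sum_comm]
  refine Finset.sum_eq_zero fun T'' _ => ?_
  rw [← Finsupp.single_finsetSum]
  simp only [mul_assoc]
  rw [← Finset.mul_sum]
  suffices h : ∑ T' : L.Single j, L.coeff T.1 T'.1 * L.coeff T'.1 T''.1 = 0 by
    rw [h, mul_zero, Finsupp.single_zero]
  by_cases hj : j = i + 2
  · rw [sum_single_eq j (fun T' => L.coeff T.1 T' * L.coeff T' T''.1),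
      hL.sum_coeff_mul_coeff T.2.1 T''.2.1]
    intro T' hT'
    rw [show L.coeff T.1 T' = 0 from if_neg fun h => hT' ?_, zero_mul]
    have := T.2.2
    rw [h.2]
    push_cast
    omega
  · refine Finset.sum_eq_zero fun T' _ => ?_
    rw [show L.coeff T.1 T'.1 = 0 from if_neg fun h => hj ?_, zero_mul]
    have h1 := T.2.2
    have h2 := T'.2.2
    rw [h.2] at h2
    push_cast at h2
    omega

end LinkDiagram

/-! ### Resolutions of a resolved diagram as resolutions of the diagram -/

namespace LinkDiagram

variable {D X : Type*} [DecidableEq X] {L : LinkDiagram D X} {c : X} {b : Bool}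

/-- The resolution of `L` which agrees with the resolution `T` of the diagram resolved at `c`. -/
def extend (c : X) (b : Bool) (T : Finset {x : X // x ≠ c}) : Finset X :=
  if b then insert c (lift c T) else lift c T

omit [DecidableEq X] in
theorem mem_lift {T : Finset {x : X // x ≠ c}} {x : X} : x ∈ lift c T ↔ ∃ h : x ≠ c, ⟨x, h⟩ ∈ T := by
  simp [lift]

theorem mem_extend_self {T : Finset {x : X // x ≠ c}} : c ∈ extend c b T ↔ b = true := by
  cases b <;> simp [extend, mem_lift]

theorem mem_extend {T : Finset {x : X // x ≠ c}} {x : X} (hx : x ≠ c) :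
    x ∈ extend c b T ↔ ⟨x, hx⟩ ∈ T := by
  cases b <;> simp [extend, mem_lift, hx]

theorem card_extend (T : Finset {x : X // x ≠ c}) :
    (extend c b T).card = T.card + b.toNat := by
  cases b
  · simp [extend, lift]
  · simp [extend, lift]

theorem extend_subset_extend {b' : Bool} {T T' : Finset {x : X // x ≠ c}} :
    extend c b T ⊆ extend c b' T' ↔ b ≤ b' ∧ T ⊆ T' := by
  constructor
  · intro h
    refine ⟨fun hb => mem_extend_self.1 (h (mem_extend_self.2 hb)), fun x hx => ?_⟩
    exact (mem_extend (b := b') x.2).1 (h ((mem_extend x.2).2 hx))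
  · rintro ⟨hb, h⟩ x hx
    by_cases hxc : x = c
    · subst hxc
      exact mem_extend_self.2 (hb (mem_extend_self.1 hx))
    · exact (mem_extend hxc).2 (h ((mem_extend hxc).1 hx))

theorem extend_injective {T T' : Finset {x : X // x ≠ c}} (h : extend c b T = extend c b T') :
    T = T' :=
  Finset.Subset.antisymm (extend_subset_extend.1 h.le).2 (extend_subset_extend.1 h.ge).2

theorem exists_extend_eq (c : X) (S : Finset X) :
    ∃ T, extend c (decide (c ∈ S)) T = S := by
  refine ⟨S.subtype _, ?_⟩
  ext x
  by_cases hx : x = c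
  · subst hx
    rw [mem_extend_self, decide_eq_true_iff]
  · rw [mem_extend hx, Finset.mem_subtype]

theorem insert_extend (T : Finset {x : X // x ≠ c}) (x : {x : X // x ≠ c}) :
    insert x.1 (extend c b T) = extend c b (insert x T) := by
  ext y
  rw [Finset.mem_insert]
  by_cases hy : y = c
  · subst hy
    simp [mem_extend_self, x.2.symm]
  · rw [mem_extend hy, mem_extend hy, Finset.mem_insert, Subtype.ext_iff]

theorem extend_sdiff_extend (T T' : Finset {x : X // x ≠ c}) :
    extend c b T' \ extend c b T = (T' \ T).map (Function.Embedding.subtype _) := by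
  ext y
  rw [Finset.mem_sdiff]
  by_cases hy : y = c
  · subst hy
    simp [mem_extend_self]
  · simp [mem_extend hy, hy]

section Circles

/-- At `c` the new bivalent vertices are made by exactly the rule which defines the strands of a
complete resolution; nothing changes elsewhere. Hence circles can be compared without moving any
dart. -/
theorem turn_resolve (T : Finset {x : X // x ≠ c}) (d : D) :
    (L.resolve c b).turn T d = L.turn (extend c b T) d := by
  have hr : (L.resolve c b).rot = L.resolveRot c b := rfl
  have ho : (L.resolve c b).isOver = L.isOver := rfl
  cases hd : L.crossing d with
  | none =>
    rw [(L.resolve c b).turn_of_eq_none T ((L.resolveCrossing_eq_none c d).2 (Or.inl hd)),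
      L.turn_of_eq_none _ hd, hr, L.resolveRot_of_ne c b d (by simp [hd])]
  | some x =>
    by_cases hx : x = c
    · subst hx
      rw [(L.resolve x b).turn_of_eq_none T ((L.resolveCrossing_eq_none x d).2 (Or.inr hd)),
        L.turn_of_eq_some _ hd, hr, L.resolveRot_of_eq x b d hd]
      simp only [mem_extend_self]
      cases L.isOver d <;> cases b <;> simp
    · have hne : L.crossing d ≠ some c := by simp [hd, hx]
      rw [(L.resolve c b).turn_of_eq_some T (x := ⟨x, hx⟩) ((L.resolveCrossing_eq_some c d _).2 hd),
        L.turn_of_eq_some _ hd, hr, L.resolveRot_of_ne c b d hne, ho]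
      simp only [mem_extend hx]
      congr 1
      rw [Equiv.symm_apply_eq, L.resolveRot_of_ne c b _ (by rwa [L.crossing_rot_symm]),
        Equiv.apply_symm_apply]

theorem circleSetoid_resolve (T : Finset {x : X // x ≠ c}) :
    (L.resolve c b).circleSetoid T = L.circleSetoid (extend c b T) := by
  unfold circleSetoid
  simp only [turn_resolve]
  rfl

theorem circle_resolve_eq_iff {T : Finset {x : X // x ≠ c}} {d d' : D} :
    (L.resolve c b).circle T d = (L.resolve c b).circle T d' ↔
      L.circle (extend c b T) d = L.circle (extend c b T) d' := by
  unfold circle Circle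
  rw [Quotient.eq, Quotient.eq, circleSetoid_resolve]

theorem isSingleCircle_resolve {T : Finset {x : X // x ≠ c}} :
    (L.resolve c b).IsSingleCircle T ↔ L.IsSingleCircle (extend c b T) := by
  simp only [IsSingleCircle, circle_resolve_eq_iff]

/-- Merged faces are joined through the gap at `c`, which is open in every resolution with this
state of `c`. -/
theorem sameSide_of_faceMap_eq {S : Finset X} (hS : c ∈ S ↔ b = true) {C : L.Circle S}
    {f f' : L.Face} (h : L.faceMap c b f = L.faceMap c b f') : L.SameSide S C f f' := by
  have hle : L.resolveSameFace c b ≤ (sideSetoid S C).comap L.face := by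
    refine sup_le (fun d d' hd => ?_) (Setoid.eqvGen_le ?_)
    · have : L.face d = L.face d' := Quotient.sound hd
      change L.SameSide S C (L.face d) (L.face d')
      rw [this]
      exact Relation.EqvGen.refl _
    · rintro d _ ⟨hd, ho, rfl⟩
      refine Relation.EqvGen.rel _ _ (Or.inl ⟨d, c, hd, ?_, rfl, rfl⟩)
      rw [hS, ho]
      cases b <;> simp
  induction f using Quotient.inductionOn with
  | h d =>
    induction f' using Quotient.inductionOn with
    | h d' => exact hle (Quotient.exact h)

/-- A passage through the gap at `c` becomes an equality of faces in the resolved diagram; all other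
passages correspond. -/
theorem sameSide_resolve {T : Finset {x : X // x ≠ c}} {d₀ : D} {f f' : L.Face} :
    (L.resolve c b).SameSide T ((L.resolve c b).circle T d₀) (L.faceMap c b f)
      (L.faceMap c b f') ↔ L.SameSide (extend c b T) (L.circle (extend c b T) d₀) f f' := by
  have hr : (L.resolve c b).rot = L.resolveRot c b := rfl
  have hrot : ∀ {d x}, L.crossing d = some x → x ≠ c →
      L.resolveRot c b (L.resolveRot c b d) = L.rot (L.rot d) := by
    intro d x hd hx
    have h1 : L.crossing d ≠ some c := by simp [hd, hx]
    rw [L.resolveRot_of_ne c b d h1, L.resolveRot_of_ne c b _ (by rwa [L.crossing_rot])]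
  constructor
  -- The induction quantifies over all lifts of the two faces, since in the transitive case a lift
  -- of the middle face has to be chosen.
  · have key : ∀ g g', (L.resolve c b).SameSide T ((L.resolve c b).circle T d₀) g g' →
        ∀ f f', L.faceMap c b f = g → L.faceMap c b f' = g' →
          L.SameSide (extend c b T) (L.circle (extend c b T) d₀) f f' := by
      intro g g' h
      induction h with
      | rel g g' h =>
        rintro f f' rfl rfl
        rcases h with ⟨d, x, hd, ho, h1, h2⟩ | ⟨d, hd, h1, h2⟩
        · have hd' := (L.resolveCrossing_eq_some c d x).1 hd
          rw [hr, hrot hd' x.2] at h2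
          refine (sameSide_of_faceMap_eq (f' := L.face d) mem_extend_self h1).trans _ _ _
            (Relation.EqvGen.trans _ _ _ (Relation.EqvGen.rel _ _
              (Or.inl ⟨d, x.1, hd', ?_, rfl, rfl⟩))
            (sameSide_of_faceMap_eq (f := L.face (L.rot (L.rot d))) mem_extend_self h2.symm))
          rw [mem_extend x.2]
          exact ho
        · refine (sameSide_of_faceMap_eq (f' := L.face d) mem_extend_self h1).trans _ _ _
            (Relation.EqvGen.trans _ _ _ (Relation.EqvGen.rel _ _
              (Or.inr ⟨d, ?_, rfl, rfl⟩))
            (sameSide_of_faceMap_eq (f := L.face (L.edge d)) mem_extend_self h2.symm))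
          rwa [ne_eq, ← circle_resolve_eq_iff]
      | refl g =>
        rintro f f' rfl h
        exact sameSide_of_faceMap_eq mem_extend_self h.symm
      | symm g g' _ ih => exact fun f f' h h' => (ih f' f h' h).symm
      | trans g₁ g₂ g₃ _ _ ih ih' =>
        intro f f' h h'
        obtain ⟨f₂, h₂⟩ := L.faceMap_surjective c b g₂
        exact (ih f f₂ h h₂).trans _ _ _ (ih' f₂ f' h₂ h')
    exact fun h => key _ _ h f f' rfl rfl
  · intro h
    induction h with
    | rel f f' h =>
      rcases h with ⟨d, x, hd, ho, rfl, rfl⟩ | ⟨d, hd, rfl, rfl⟩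
      · by_cases hx : x = c
        · subst hx
          have : L.faceMap x b (L.face d) = L.faceMap x b (L.face (L.rot (L.rot d))) := by
            refine Quotient.sound (s := L.resolveSameFace x b) ?_
            refine (le_sup_right : _ ≤ L.resolveSameFace x b) (Relation.EqvGen.rel _ _
              ⟨hd, ?_, rfl⟩)
            rw [mem_extend_self] at ho
            revert ho
            cases b <;> simp
          rw [this]
          exact Relation.EqvGen.refl _
        · refine Relation.EqvGen.rel _ _ (Or.inl ⟨d, ⟨x, hx⟩,
            (L.resolveCrossing_eq_some c d _).2 hd, ?_, rfl, ?_⟩)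
          · rw [mem_extend hx] at ho
            exact ho
          · rw [hr, hrot hd hx]
            rfl
      · refine Relation.EqvGen.rel _ _ (Or.inr ⟨d, ?_, rfl, rfl⟩)
        rwa [ne_eq, circle_resolve_eq_iff]
    | refl f => exact Relation.EqvGen.refl _
    | symm f f' _ ih => exact ih.symm
    | trans f f' f'' _ _ ih ih' => exact ih.trans _ _ _ ih'

theorem cutRegion_resolve (T : Finset {x : X // x ≠ c}) :
    L.cutRegion (extend c b T) = L.faceMap c b ⁻¹' (L.resolve c b).cutRegion T := by
  ext f
  have hmark : ∀ d₀ : D, f ∈ L.interior (extend c b T) (L.circle _ d₀) ↔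
      L.faceMap c b f ∈ (L.resolve c b).interior T ((L.resolve c b).circle T d₀) := fun d₀ =>
    not_congr (sameSide_resolve (f' := L.face L.mark)).symm
  constructor
  · rintro ⟨C, hC, hf⟩
    induction C using Quotient.inductionOn with
    | h d₀ =>
      exact ⟨(L.resolve c b).circle T d₀, fun h => hC (circle_resolve_eq_iff.1 h), (hmark d₀).1 hf⟩
  · rintro ⟨C, hC, hf⟩
    induction C using Quotient.inductionOn with
    | h d₀ =>
      exact ⟨L.circle _ d₀, fun h => hC (circle_resolve_eq_iff.2 h), (hmark d₀).2 hf⟩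

end Circles

section Coefficients

variable [Finite D]

open Classical in
theorem fieldMap_var (g : (L.resolve c b).Face) : L.fieldMap c b ((L.resolve c b).var g) =
    ∑ f : L.Face with L.faceMap c b f = g, L.var f := by
  unfold var fieldMap
  rw [IsFractionRing.lift_algebraMap]
  simp [faceRingMap]

theorem fieldMap_area (A : Set (L.resolve c b).Face) :
    L.fieldMap c b ((L.resolve c b).area A) = L.area (L.faceMap c b ⁻¹' A) := by
  classical
  unfold area
  rw [map_sum]
  simp only [fieldMap_var, Finset.sum_filter]
  have : ∀ g : (L.resolve c b).Face, (if g ∈ A then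
      ∑ f : L.Face, (if L.faceMap c b f = g then L.var f else 0) else 0) =
      ∑ f : L.Face, (if L.faceMap c b f = g then (if g ∈ A then L.var f else 0) else 0) := by
    intro g
    split_ifs <;> simp
  simp only [this]
  rw [Finset.sum_comm]
  refine Finset.sum_congr rfl fun f _ => ?_
  simp

theorem fieldMap_pairing (T T' : Finset {x : X // x ≠ c}) :
    L.fieldMap c b ((L.resolve c b).pairing T T') =
      L.pairing (extend c b T) (extend c b T') := by
  rw [pairing, pairing, map_sum, extend_sdiff_extend, Finset.sum_map]
  refine Finset.sum_congr rfl fun x _ => ?_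
  rw [map_inv₀, fieldMap_area, ← cutRegion_resolve, ← insert_extend]
  rfl

theorem fieldMap_coeff [Finite X] (T T' : Finset {x : X // x ≠ c}) :
    L.fieldMap c b ((L.resolve c b).coeff T T') = L.coeff (extend c b T) (extend c b T') := by
  have h : (extend c b T ⊆ extend c b T' ∧
      (extend c b T').card = (extend c b T).card + 2) ↔ (T ⊆ T' ∧ T'.card = T.card + 2) := by
    rw [extend_subset_extend, card_extend, card_extend]
    simp only [le_refl, true_and, and_congr_right_iff]
    intro _
    omega
  rw [coeff, coeff, apply_ite (L.fieldMap c b), map_zero, fieldMap_pairing]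
  simp only [h]

theorem coeff_extend_true_false [Finite X] (T T' : Finset {x : X // x ≠ c}) :
    L.coeff (extend c true T) (extend c false T') = 0 := by
  rw [coeff, if_neg]
  rintro ⟨h, -⟩
  exact absurd (extend_subset_extend.1 h).1 (by decide)

theorem coeff_extend_false_true [Finite X] (T T' : Finset {x : X // x ≠ c}) :
    L.coeff (extend c false T) (extend c true T') =
      if T ⊆ T' ∧ T'.card = T.card + 1 then L.pairing (lift c T) (insert c (lift c T')) else 0 := by
  simp only [coeff, extend_subset_extend, card_extend]
  simp [extend]

end Coefficients

end LinkDiagram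

/-! ### The spanning tree complex as a mapping cone -/

namespace LinkDiagram

variable {D X : Type*} [DecidableEq X] {L : LinkDiagram D X} {c : X} {b : Bool}

/-- A single circle resolution of a resolved diagram, as a resolution of the original diagram. -/
def Single.extend {i j : ℤ} (h : j = i + b.toNat) (T : (L.resolve c b).Single i) : L.Single j :=
  ⟨LinkDiagram.extend c b T.1, isSingleCircle_resolve.1 T.2.1, by
    have := T.2.2
    rw [card_extend, h]
    push_cast
    omega⟩

variable (L c) in
/-- The single circle resolutions of a diagram are those of its two resolutions at a crossing. -/
noncomputable def singleEquiv (i : ℤ) :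
    (L.resolve c false).Single i ⊕ (L.resolve c true).Single (i - 1) ≃ L.Single i :=
  Equiv.ofBijective
    (Sum.elim (Single.extend (by simp)) (Single.extend (by simp))) <| by
    constructor
    · rintro (T | T) (T' | T') h
      · exact congrArg Sum.inl (Subtype.ext (extend_injective (b := false) (congrArg Subtype.val h)))
      · exact absurd (extend_subset_extend.1 (congrArg Subtype.val h).ge).1 (by decide)
      · exact absurd (extend_subset_extend.1 (congrArg Subtype.val h).le).1 (by decide)
      · exact congrArg Sum.inr (Subtype.ext (extend_injective (b := true) (congrArg Subtype.val h)))
    · intro S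
      obtain ⟨T, hT⟩ := exists_extend_eq c S.1
      have h1 := S.2.1
      have h2 := S.2.2
      by_cases hc : c ∈ S.1
      · rw [decide_eq_true hc] at hT
        rw [← hT] at h1 h2
        rw [card_extend] at h2
        refine ⟨Sum.inr ⟨T, isSingleCircle_resolve.2 h1, ?_⟩, Subtype.ext hT⟩
        push_cast [Bool.toNat_true] at h2
        omega
      · rw [decide_eq_false hc] at hT
        rw [← hT] at h1 h2
        rw [card_extend] at h2
        refine ⟨Sum.inl ⟨T, isSingleCircle_resolve.2 h1, ?_⟩, Subtype.ext hT⟩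
        push_cast [Bool.toNat_false] at h2
        omega

theorem singleEquiv_inl {i : ℤ} (T : (L.resolve c false).Single i) :
    (L.singleEquiv c i (Sum.inl T)).1 = LinkDiagram.extend c false T.1 := rfl

theorem singleEquiv_inr {i : ℤ} (T : (L.resolve c true).Single (i - 1)) :
    (L.singleEquiv c i (Sum.inr T)).1 = LinkDiagram.extend c true T.1 := rfl

variable [Finite D] [Finite X]

variable (L c b) in
/-- The basis of `CT_i(L₀) ⊗ 𝔽_L` or `CT_i(L₁) ⊗ 𝔽_L` consisting of single circle resolutions. -/
noncomputable def resolvedBasis (i : ℤ) :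
    Module.Basis ((L.resolve c b).Single i) L.FaceField (L.CTResolved c b i) :=
  Algebra.TensorProduct.basis L.FaceField
    (Finsupp.basisSingleOne (R := (L.resolve c b).FaceField) (ι := (L.resolve c b).Single i))

omit [Finite X] in
theorem resolvedBasis_apply (i : ℤ) (T : (L.resolve c b).Single i) :
    L.resolvedBasis c b i T = 1 ⊗ₜ[(L.resolve c b).FaceField] Finsupp.single T 1 := by
  rw [resolvedBasis, Algebra.TensorProduct.basis_apply, Finsupp.coe_basisSingleOne]

theorem delResolved_resolvedBasis (i j : ℤ) (T : (L.resolve c b).Single i) :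
    L.delResolved c b i j (L.resolvedBasis c b i T) =
      ∑ T' : (L.resolve c b).Single j, L.coeff (LinkDiagram.extend c b T.1)
        (LinkDiagram.extend c b T'.1) • L.resolvedBasis c b j T' := by
  rw [resolvedBasis_apply, delResolved, LinearMap.baseChange_tmul, del_single,
    TensorProduct.tmul_sum]
  refine Finset.sum_congr rfl fun T' _ => ?_
  rw [resolvedBasis_apply, ← fieldMap_coeff, one_mul, TensorProduct.smul_tmul', smul_eq_mul,
    mul_one]
  have h : Finsupp.single T' ((L.resolve c b).coeff T.1 T'.1) =
      (L.resolve c b).coeff T.1 T'.1 • Finsupp.single T' 1 := by simp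
  rw [h, ← TensorProduct.smul_tmul, Algebra.smul_def, mul_one]
  rfl

theorem tau_resolvedBasis (i j : ℤ) (T : (L.resolve c false).Single i) :
    L.tau c i j (L.resolvedBasis c false i T) =
      ∑ T' : (L.resolve c true).Single j, L.coeff (LinkDiagram.extend c false T.1)
        (LinkDiagram.extend c true T'.1) • L.resolvedBasis c true j T' := by
  rw [tau, resolvedBasis, Module.Basis.constr_basis]
  refine Finset.sum_congr rfl fun T' _ => ?_
  rw [coeff_extend_false_true, ite_smul, zero_smul, resolvedBasis_apply]

variable (L c) in
/-- The isomorphism of `CT(L)` with the mapping cone of `τ_c`. -/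
noncomputable def coneEquiv (i : ℤ) : L.CT i ≃ₗ[L.FaceField] L.Cone c i :=
  (Finsupp.basisSingleOne (R := L.FaceField) (ι := L.Single i)).equiv
    ((L.resolvedBasis c false i).prod (L.resolvedBasis c true (i - 1))) (L.singleEquiv c i).symm

omit [Finite X] in
theorem coneEquiv_single (i : ℤ) (s : (L.resolve c false).Single i ⊕
    (L.resolve c true).Single (i - 1)) :
    L.coneEquiv c i (Finsupp.single (L.singleEquiv c i s) 1) =
      (L.resolvedBasis c false i).prod (L.resolvedBasis c true (i - 1)) s := by
  have h := (Finsupp.basisSingleOne (R := L.FaceField) (ι := L.Single i)).equiv_apply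
    (L.singleEquiv c i s) ((L.resolvedBasis c false i).prod (L.resolvedBasis c true (i - 1)))
    (L.singleEquiv c i).symm
  rw [Finsupp.coe_basisSingleOne, Equiv.symm_apply_apply] at h
  exact h

/-- On basis vectors this compares four blocks of the matrix of `∂`, sorted by the state of `c`. Two
are the differentials of `L₀` and `L₁`, one is `τ_c`, and the block which would remove `c` from `T`
vanishes because `T ⊆ T'`. -/
theorem coneEquiv_del (i j : ℤ) (m : L.CT i) :
    L.coneEquiv c j (L.del i j m) = L.coneDel c i j (L.coneEquiv c i m) := by
  classical
  suffices h : (L.coneEquiv c j).toLinearMap ∘ₗ L.del i j =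
      L.coneDel c i j ∘ₗ (L.coneEquiv c i).toLinearMap from LinearMap.congr_fun h m
  refine ((Finsupp.basisSingleOne (R := L.FaceField) (ι := L.Single i)).reindex
    (L.singleEquiv c i).symm).ext fun s => ?_
  rw [Module.Basis.reindex_apply, Equiv.symm_symm, Finsupp.coe_basisSingleOne,
    LinearMap.comp_apply, LinearMap.comp_apply, LinearEquiv.coe_coe, LinearEquiv.coe_coe,
    coneEquiv_single, del_single]
  have h1 : ∑ T' : L.Single j, Finsupp.single T' (1 * L.coeff (L.singleEquiv c i s).1 T'.1) =
      ∑ s' : (L.resolve c false).Single j ⊕ (L.resolve c true).Single (j - 1),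
        L.coeff (L.singleEquiv c i s).1 (L.singleEquiv c j s').1 •
          Finsupp.single (L.singleEquiv c j s') (1 : L.FaceField) := by
    symm
    refine Finset.sum_equiv (L.singleEquiv c j) (by simp) fun s' _ => ?_
    simp
  rw [h1, map_sum]
  simp only [map_smul, coneEquiv_single]
  rw [Fintype.sum_sum_type]
  simp only [Module.Basis.prod_apply, singleEquiv_inl, singleEquiv_inr, Sum.elim_inl, Sum.elim_inr,
    Function.comp_apply]
  rcases s with T | T
  · simp only [Sum.elim_inl, singleEquiv_inl, coneDel, LinearMap.coe_inl, LinearMap.coe_inr]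
    ext1
    · simp [Prod.fst_sum, delResolved_resolvedBasis]
    · simp [Prod.snd_sum, delResolved_resolvedBasis, tau_resolvedBasis]
  · simp only [Sum.elim_inr, singleEquiv_inr, coneDel, LinearMap.coe_inl, LinearMap.coe_inr,
      coeff_extend_true_false]
    ext1
    · simp [Prod.fst_sum, delResolved_resolvedBasis]
    · simp [Prod.snd_sum, delResolved_resolvedBasis]

section Cone

theorem IsPlanar.coneDel_coneDel (hL : L.IsPlanar) (i j k : ℤ) (m : L.Cone c i) :
    L.coneDel c j k (L.coneDel c i j m) = 0 := by
  obtain ⟨m, rfl⟩ := (L.coneEquiv c i).surjective m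
  rw [← coneEquiv_del, ← coneEquiv_del, ← LinearMap.comp_apply, hL.del_comp_del,
    LinearMap.zero_apply, map_zero]

theorem coneDel_apply (i j : ℤ) (a : L.CTResolved c false i) (a' : L.CTResolved c true (i - 1)) :
    L.coneDel c i j (a, a') = (L.delResolved c false i j a,
      L.tau c i (j - 1) a + L.delResolved c true (i - 1) (j - 1) a') := rfl

/-- These are the diagonal blocks of the squared cone differential, so planarity of `L` suffices. -/
theorem IsPlanar.delResolved_delResolved (hL : L.IsPlanar) (i j k : ℤ) (m : L.CTResolved c b i) :
    L.delResolved c b j k (L.delResolved c b i j m) = 0 := by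
  cases b with
  | false =>
    have h := hL.coneDel_coneDel i j k (m, 0)
    simp only [coneDel_apply, Prod.mk_eq_zero] at h
    exact h.1
  | true =>
    -- The second summand of the cone in degree `i` has degree `i - 1`.
    obtain ⟨i, rfl⟩ : ∃ i', i = i' - 1 := ⟨i + 1, by ring⟩
    obtain ⟨j, rfl⟩ : ∃ j', j = j' - 1 := ⟨j + 1, by ring⟩
    obtain ⟨k, rfl⟩ : ∃ k', k = k' - 1 := ⟨k + 1, by ring⟩
    have h := hL.coneDel_coneDel i j k (0, m)
    simp only [coneDel_apply, map_zero, zero_add, Prod.mk_eq_zero] at h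
    exact h.2

/-- The off-diagonal block of the squared cone differential is the sum of the two sides; in
characteristic two its vanishing is their equality. -/
theorem IsPlanar.delResolved_tau (hL : L.IsPlanar) (i j k l : ℤ) (hk : k = j + 1)
    (m : L.CTResolved c false i) :
    L.delResolved c true j l (L.tau c i j m) = L.tau c k l (L.delResolved c false i k m) := by
  obtain rfl : j = k - 1 := by omega
  obtain ⟨l, rfl⟩ : ∃ l', l = l' - 1 := ⟨l + 1, by ring⟩
  have h := hL.coneDel_coneDel i k l (m, 0)
  simp only [coneDel_apply, map_zero, add_zero, Prod.mk_eq_zero] at h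
  have h2 : ∀ x : L.CTResolved c true (l - 1), x + x = 0 := fun x => by
    rw [← one_smul L.FaceField x, ← add_smul, faceField_add_self, zero_smul]
  exact ((add_eq_zero_iff_eq_neg.1 h.2).trans (add_eq_zero_iff_eq_neg.1 (h2 _)).symm).symm

/-- The identity holds after the field extension `𝔽_L`, which is faithfully flat. -/
theorem IsPlanar.del_comp_del_resolve (hL : L.IsPlanar) (i j k : ℤ) :
    (L.resolve c b).del j k ∘ₗ (L.resolve c b).del i j = 0 := by
  ext1 T
  ext1
  have h := hL.delResolved_delResolved (b := b) i j k (1 ⊗ₜ Finsupp.single T 1)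
  simp only [delResolved, LinearMap.baseChange_tmul] at h
  exact Module.FaithfullyFlat.tensorProduct_mk_injective (A := (L.resolve c b).FaceField)
    (B := L.FaceField) ((L.resolve c b).CT k) (h.trans (TensorProduct.tmul_zero _ _).symm)

end Cone

end LinkDiagram

/-! ### The long exact sequence of a cone, for homology given by representatives -/

/-- `R` is the graph of the correspondence between the cycles in `M_i`, for a differential of degree
two, and their classes in `H`. -/
structure IsHomology {K : Type*} [Field K] {M : ℤ → Type*} [∀ i, AddCommGroup (M i)]
    [∀ i, Module K (M i)] {H : Type*} [AddCommGroup H] [Module K H]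
    (d : ∀ i j, M i →ₗ[K] M j) (i : ℤ) (R : Submodule K (H × M i)) : Prop where
  -- The neighbouring degree is a variable with an equation, so that forms such as `i - 1 + 2` and
  -- `i + 2 - 1` can be used interchangeably without transport.
  cycle_iff : ∀ j, j = i + 2 → ∀ m, d i j m = 0 ↔ ∃ x, (x, m) ∈ R
  exists_rep : ∀ x, ∃ m, (x, m) ∈ R
  eq_zero_iff : ∀ j, j = i - 2 → ∀ x m, (x, m) ∈ R → (x = 0 ↔ ∃ u, d j i u = m)

namespace IsHomology

section Basic

variable {K : Type*} [Field K] {M : ℤ → Type*} [∀ i, AddCommGroup (M i)] [∀ i, Module K (M i)]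
  {H : Type*} [AddCommGroup H] [Module K H] {d : ∀ i j, M i →ₗ[K] M j} {i : ℤ}
  {R : Submodule K (H × M i)}

theorem eq_of_sub_eq (hR : IsHomology d i R) {x x' : H} {m m' : M i} (h : (x, m) ∈ R)
    (h' : (x', m') ∈ R) {j : ℤ} (hj : j = i - 2) (u : M j) (hu : d j i u = m - m') : x = x' := by
  rw [← sub_eq_zero]
  exact (hR.eq_zero_iff j hj _ _ (R.sub_mem h h')).2 ⟨u, hu⟩

theorem eq_of_rep (hR : IsHomology d i R) {x x' : H} {m : M i} (h : (x, m) ∈ R)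
    (h' : (x', m) ∈ R) : x = x' :=
  hR.eq_of_sub_eq h h' rfl 0 (by simp)

theorem exists_map (hR : IsHomology d i R) {N : ℤ → Type*} [∀ i, AddCommGroup (N i)]
    [∀ i, Module K (N i)] {H' : Type*} [AddCommGroup H'] [Module K H']
    {d' : ∀ i j, N i →ₗ[K] N j} {i' : ℤ} {R' : Submodule K (H' × N i')}
    (hR' : IsHomology d' i' R') (F : M i →ₗ[K] N i')
    (hF : ∀ m, d i (i + 2) m = 0 → d' i' (i' + 2) (F m) = 0)
    (hF' : ∀ u, ∃ v, d' (i' - 2) i' v = F (d (i - 2) i u)) :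
    ∃ G : H →ₗ[K] H', ∀ x m, (x, m) ∈ R → (G x, F m) ∈ R' := by
  have hex : ∀ x, ∃ y, ∀ m, (x, m) ∈ R → (y, F m) ∈ R' := by
    intro x
    obtain ⟨m, hm⟩ := hR.exists_rep x
    obtain ⟨y, hy⟩ := (hR'.cycle_iff _ rfl (F m)).1 (hF m ((hR.cycle_iff _ rfl m).2 ⟨x, hm⟩))
    refine ⟨y, fun m' hm' => ?_⟩
    have h0 := R.sub_mem hm hm'
    obtain ⟨y', hy'⟩ := (hR'.cycle_iff _ rfl (F m')).1 (hF m' ((hR.cycle_iff _ rfl m').2 ⟨x, hm'⟩))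
    obtain ⟨u, hu⟩ := (hR.eq_zero_iff _ rfl _ _ h0).1 (sub_self x)
    obtain ⟨v, hv⟩ := hF' u
    have : y = y' := hR'.eq_of_sub_eq hy hy' rfl v (by rw [hv, hu]; exact map_sub F m m')
    rwa [this]
  choose G hG using hex
  refine ⟨⟨⟨G, fun x y => ?_⟩, fun a x => ?_⟩, fun x m => hG x m⟩
  · obtain ⟨m, hm⟩ := hR.exists_rep x
    obtain ⟨m', hm'⟩ := hR.exists_rep y
    refine hR'.eq_of_rep (m := F (m + m')) (hG _ _ (R.add_mem hm hm')) ?_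
    rw [map_add]
    exact R'.add_mem (hG _ _ hm) (hG _ _ hm')
  · obtain ⟨m, hm⟩ := hR.exists_rep x
    refine hR'.eq_of_rep (m := F (a • m)) (hG _ _ (R.smul_mem a hm)) ?_
    rw [map_smul]
    exact R'.smul_mem a (hG _ _ hm)

end Basic

section Cone

variable {K : Type*} [Field K] {A B C : ℤ → Type*}
  [∀ i, AddCommGroup (A i)] [∀ i, Module K (A i)] [∀ i, AddCommGroup (B i)] [∀ i, Module K (B i)]
  [∀ i, AddCommGroup (C i)] [∀ i, Module K (C i)]
  {HA HB HC : ℤ → Type*}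
  [∀ i, AddCommGroup (HA i)] [∀ i, Module K (HA i)] [∀ i, AddCommGroup (HB i)]
  [∀ i, Module K (HB i)] [∀ i, AddCommGroup (HC i)] [∀ i, Module K (HC i)]
  {dA : ∀ i j, A i →ₗ[K] A j} {dB : ∀ i j, B i →ₗ[K] B j} {dC : ∀ i j, C i →ₗ[K] C j}
  {RA : ∀ i, Submodule K (HA i × A i)} {RB : ∀ i, Submodule K (HB i × B i)}
  {RC : ∀ i, Submodule K (HC i × C i)}
  (hA : ∀ i, IsHomology dA i (RA i)) (hB : ∀ i, IsHomology dB i (RB i))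
  (hC : ∀ i, IsHomology dC i (RC i))
  {τ : ∀ i j, C i →ₗ[K] A j} {Φ : ∀ i, B i ≃ₗ[K] C i × A (i - 1)}
  (hΦ : ∀ i j m, Φ j (dB i j m) =
    (dC i j (Φ i m).1, τ i (j - 1) (Φ i m).1 + dA (i - 1) (j - 1) (Φ i m).2))
  (f : ∀ j i, HA j →ₗ[K] HB i) (g : ∀ i l, HB i →ₗ[K] HC l) (h : ∀ l j, HC l →ₗ[K] HA j)
  (hf : ∀ i x m, (x, m) ∈ RA (i - 1) → (f (i - 1) i x, (Φ i).symm (0, m)) ∈ RB i)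
  (hg : ∀ i x m, (x, m) ∈ RB i → (g i i x, (Φ i m).1) ∈ RC i)
  (hh : ∀ i j x m, j = i + 1 → (x, m) ∈ RC i → (h i j x, τ i j m) ∈ RA j)

include hΦ in
theorem cone_symm (i j : ℤ) (a : C i) (a' : A (i - 1)) : dB i j ((Φ i).symm (a, a')) =
    (Φ j).symm (dC i j a, τ i (j - 1) a + dA (i - 1) (j - 1) a') := by
  rw [LinearEquiv.eq_symm_apply, hΦ]
  simp

include hA hB hC hΦ in
theorem exists_cone_maps (hτ : ∀ i j k l m, k = j + 1 → dA j l (τ i j m) = τ k l (dC i k m)) :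
    ∃ (f : ∀ j i, HA j →ₗ[K] HB i) (g : ∀ i l, HB i →ₗ[K] HC l) (h : ∀ l j, HC l →ₗ[K] HA j),
      (∀ i x m, (x, m) ∈ RA (i - 1) → (f (i - 1) i x, (Φ i).symm (0, m)) ∈ RB i) ∧
      (∀ i x m, (x, m) ∈ RB i → (g i i x, (Φ i m).1) ∈ RC i) ∧
      (∀ i j x m, j = i + 1 → (x, m) ∈ RC i → (h i j x, τ i j m) ∈ RA j) := by
  have hf : ∀ i, ∃ F : HA (i - 1) →ₗ[K] HB i, ∀ x m, (x, m) ∈ RA (i - 1) →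
      (F x, (Φ i).symm (0, m)) ∈ RB i := by
    intro i
    refine (hA (i - 1)).exists_map (hB i)
      ((Φ i).symm.toLinearMap ∘ₗ LinearMap.inr K (C i) (A (i - 1))) (fun m hm => ?_) fun u => ?_
    · simp only [LinearMap.comp_apply, LinearEquiv.coe_coe, LinearMap.inr_apply]
      have hm' : dA (i - 1) (i + 2 - 1) m = 0 := by
        -- Representing a class does not mention the target degree, so it carries the cycle
        -- condition from `i - 1 + 2` to `i + 2 - 1`.
        rw [((hA (i - 1)).cycle_iff _ (by ring) m), ← (hA (i - 1)).cycle_iff _ rfl m]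
        exact hm
      rw [cone_symm hΦ, hm']
      simp
    · have key : ∀ k, k = i - 2 - 1 → ∀ u : A k, ∃ v, dB (i - 2) i v =
          (Φ i).symm (0, dA k (i - 1) u) := by
        rintro k rfl u
        exact ⟨(Φ (i - 2)).symm (0, u), by rw [cone_symm hΦ]; simp⟩
      exact key _ (by ring) u
  have hg : ∀ i, ∃ F : HB i →ₗ[K] HC i, ∀ x m, (x, m) ∈ RB i → (F x, (Φ i m).1) ∈ RC i := by
    intro i
    refine (hB i).exists_map (hC i) (LinearMap.fst K (C i) (A (i - 1)) ∘ₗ (Φ i).toLinearMap)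
      (fun m hm => ?_) fun u => ⟨(Φ (i - 2) u).1, ?_⟩
    · have := hΦ i (i + 2) m
      rw [hm, map_zero] at this
      exact (congrArg Prod.fst this).symm
    · simp [hΦ]
  have hh : ∀ i, ∃ F : HC i →ₗ[K] HA (i + 1), ∀ x m, (x, m) ∈ RC i →
      (F x, τ i (i + 1) m) ∈ RA (i + 1) := by
    intro i
    refine (hC i).exists_map (hA (i + 1)) (τ i (i + 1)) (fun m hm => ?_) fun u =>
      ⟨τ (i - 2) (i + 1 - 2) u, ?_⟩
    · rw [hτ i (i + 1) (i + 2) _ m (by ring), hm, map_zero]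
    · exact hτ _ _ _ _ _ (by ring)
  choose f0 hf0 using hf
  choose g0 hg0 using hg
  choose h0 hh0 using hh
  -- The families are indexed by independent degrees and are zero where the degrees do not fit; this
  -- lets shifted gradings be used later by arithmetic alone.
  refine ⟨fun j i => if e : j = i - 1 then e ▸ f0 i else 0,
    fun i l => if e : l = i then e ▸ g0 i else 0,
    fun l j => if e : j = l + 1 then e ▸ h0 l else 0, ?_, ?_, ?_⟩
  · intro i x m hx
    simpa using hf0 i x m hx
  · intro i x m hx
    simpa using hg0 i x m hx
  · rintro i j x m rfl hx
    simpa using hh0 i x m hx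

include hA hB hC hΦ hf hg in
-- If the first component of a cycle is a boundary `∂ e`, subtracting the boundary of `(e, 0)` moves
-- the cycle into the subcomplex.
theorem exact_inclusion_projection (hd : ∀ i j k m, dB j k (dB i j m) = 0) {j i l : ℤ}
    (hj : j = i - 1) (hl : l = i) : Function.Exact (f j i) (g i l) := by
  subst hj hl
  intro y
  constructor
  · intro hy
    obtain ⟨m, hm⟩ := (hB l).exists_rep y
    obtain ⟨e, he⟩ := ((hC l).eq_zero_iff _ rfl _ _ (hg l y m hm)).1 hy
    have hcyc := ((hB l).cycle_iff _ rfl m).2 ⟨y, hm⟩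
    set u := (Φ (l - 2)).symm (e, 0)
    obtain ⟨x, hx⟩ : ∃ x, (x, m - dB (l - 2) l u) ∈ RB l :=
      ((hB l).cycle_iff _ rfl _).1 (by rw [map_sub, hcyc, hd, sub_zero])
    have hyx : y = x := (hB l).eq_of_sub_eq hm hx rfl u (by abel)
    obtain ⟨a, ha⟩ : ∃ a, m - dB (l - 2) l u = (Φ l).symm (0, a) := by
      refine ⟨(Φ l (m - dB (l - 2) l u)).2, ?_⟩
      rw [LinearEquiv.eq_symm_apply]
      refine Prod.ext ?_ rfl
      rw [map_sub, hΦ]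
      simp [u, he]
    have ha0 := ((hB l).cycle_iff _ rfl _).2 ⟨x, hx⟩
    rw [ha, cone_symm hΦ, LinearEquiv.map_eq_zero_iff] at ha0
    have ha1 := congrArg Prod.snd ha0
    simp only [map_zero, zero_add, Prod.snd_zero] at ha1
    obtain ⟨w, hw⟩ := ((hA (l - 1)).cycle_iff _ (by ring) a).1 ha1
    refine ⟨w, ?_⟩
    rw [hyx]
    exact (hB l).eq_of_rep (hf l w a hw) (ha ▸ hx)
  · rintro ⟨x, rfl⟩
    obtain ⟨m, hm⟩ := (hA (l - 1)).exists_rep x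
    have h1 := hg l _ _ (hf l x m hm)
    rw [LinearEquiv.apply_symm_apply] at h1
    exact ((hC l).eq_zero_iff _ rfl _ _ h1).2 ⟨0, by simp⟩

include hA hB hC hΦ hg hh in
-- If `τ a = ∂ e` for a cycle `a`, then `(a, -e)` is a cycle of the cone over `a`; conversely a
-- cycle `(a, a')` exhibits `τ a` as the boundary of `-a'`.
theorem exact_projection_connecting {i l j : ℤ} (hl : l = i) (hj : j = i + 1) :
    Function.Exact (g i l) (h l j) := by
  subst hl
  obtain rfl : j = l + 2 - 1 := by omega
  intro x
  constructor
  · intro hx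
    obtain ⟨a, ha⟩ := (hC l).exists_rep x
    obtain ⟨e, he⟩ := ((hA (l + 2 - 1)).eq_zero_iff (l - 1) (by ring) _ _
      (hh l (l + 2 - 1) x a (by ring) ha)).1 hx
    have ha0 := ((hC l).cycle_iff _ rfl a).2 ⟨x, ha⟩
    obtain ⟨y, hy⟩ := ((hB l).cycle_iff _ rfl ((Φ l).symm (a, -e))).1 (by
      rw [cone_symm hΦ, ha0, map_neg, he, add_neg_cancel]
      exact map_zero _)
    refine ⟨y, (hC l).eq_of_rep (m := a) ?_ ha⟩
    have := hg l y _ hy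
    rwa [LinearEquiv.apply_symm_apply] at this
  · rintro ⟨y, rfl⟩
    obtain ⟨m, hm⟩ := (hB l).exists_rep y
    have hcyc := hΦ l (l + 2) m
    rw [((hB l).cycle_iff _ rfl m).2 ⟨y, hm⟩, map_zero] at hcyc
    have h2 := congrArg Prod.snd hcyc
    simp only [Prod.snd_zero] at h2
    refine ((hA (l + 2 - 1)).eq_zero_iff (l - 1) (by ring) _ _
      (hh l (l + 2 - 1) _ _ (by ring) (hg l y m hm))).2 ⟨-(Φ l m).2, ?_⟩
    rw [map_neg]
    exact (eq_neg_of_add_eq_zero_left h2.symm).symm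

include hA hB hC hΦ hf hh in
-- That `(0, a)` is the boundary of `(w, u)` means precisely that `w` is a cycle and `a = τ w + ∂
-- u`.
theorem exact_connecting_inclusion {l j i : ℤ} (hl : l = i - 2) (hj : j = i - 1) :
    Function.Exact (h l j) (f j i) := by
  subst hl hj
  intro x
  constructor
  · intro hx
    obtain ⟨a, ha⟩ := (hA (i - 1)).exists_rep x
    obtain ⟨u, hu⟩ := ((hB i).eq_zero_iff _ rfl _ _ (hf i x a ha)).1 hx
    rw [LinearEquiv.eq_symm_apply, hΦ] at hu
    obtain ⟨h1, h2⟩ := Prod.ext_iff.1 hu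
    obtain ⟨w, hw⟩ := ((hC (i - 2)).cycle_iff i (by ring) _).1 h1
    refine ⟨w, ((hA (i - 1)).eq_of_sub_eq ha (hh (i - 2) (i - 1) w _ (by ring) hw)
      (j := i - 2 - 1) (by ring) (Φ (i - 2) u).2 ?_).symm⟩
    rw [eq_sub_iff_add_eq, add_comm]
    exact h2
  · rintro ⟨w, rfl⟩
    obtain ⟨e, he⟩ := (hC (i - 2)).exists_rep w
    have he0 := ((hC (i - 2)).cycle_iff i (by ring) e).2 ⟨w, he⟩
    refine ((hB i).eq_zero_iff _ rfl _ _ (hf i _ _ (hh (i - 2) (i - 1) w e (by ring) he))).2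
      ⟨(Φ (i - 2)).symm (e, 0), ?_⟩
    rw [cone_symm hΦ, he0, map_zero, add_zero]

end Cone

end IsHomology

/-! ### Homology and its extension of scalars -/

section GradedHomology

variable {k : Type*} [Field k] {M : ℤ → Type*} [∀ i, AddCommGroup (M i)] [∀ i, Module k (M i)]

namespace GradedHomology

/-- The graph of the correspondence `GradedHomology.Represents`. -/
def repr (d : ∀ i j, M i →ₗ[k] M j) (i : ℤ) : Submodule k (GradedHomology d i × M i) :=
  LinearMap.range ((Submodule.mkQ ((LinearMap.range (d (i - 2) i)).submoduleOf
    (LinearMap.ker (d i (i + 2))))).prod (LinearMap.ker (d i (i + 2))).subtype)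

theorem mem_repr {d : ∀ i j, M i →ₗ[k] M j} {i : ℤ} {x : GradedHomology d i} {m : M i} :
    (x, m) ∈ repr d i ↔ Represents d i x m := by
  simp [repr, Represents, LinearMap.mem_range, Prod.ext_iff]

theorem isHomology_repr (d : ∀ i j, M i →ₗ[k] M j) (i : ℤ) : IsHomology d i (repr d i) where
  cycle_iff := by
    rintro _ rfl m
    constructor
    · intro hm
      exact ⟨_, mem_repr.2 ⟨⟨m, hm⟩, rfl, rfl⟩⟩
    · rintro ⟨x, hx⟩
      obtain ⟨z, -, rfl⟩ := mem_repr.1 hx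
      exact z.2
  exists_rep x := by
    obtain ⟨z, rfl⟩ := Submodule.Quotient.mk_surjective _ x
    exact ⟨z, mem_repr.2 ⟨z, rfl, rfl⟩⟩
  eq_zero_iff := by
    rintro _ rfl x m hx
    obtain ⟨z, rfl, rfl⟩ := mem_repr.1 hx
    rw [Submodule.Quotient.mk_eq_zero]
    rfl

variable (K : Type*) [Field K] [Algebra k K]

/-- The graph of the correspondence `GradedHomology.RepresentsTensor`. -/
def reprTensor (d : ∀ i j, M i →ₗ[k] M j) (i : ℤ) :
    Submodule K ((K ⊗[k] GradedHomology d i) × (K ⊗[k] M i)) :=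
  LinearMap.range (((Submodule.mkQ ((LinearMap.range (d (i - 2) i)).submoduleOf
    (LinearMap.ker (d i (i + 2))))).baseChange K).prod
      ((LinearMap.ker (d i (i + 2))).subtype.baseChange K))

variable {K}

theorem mem_reprTensor {d : ∀ i j, M i →ₗ[k] M j} {i : ℤ} {x : K ⊗[k] GradedHomology d i}
    {m : K ⊗[k] M i} : (x, m) ∈ reprTensor K d i ↔ RepresentsTensor K d i x m := by
  simp [reprTensor, RepresentsTensor, LinearMap.mem_range, Prod.ext_iff]

/-- Flatness preserves the kernel of `∂` and the injectivity of its inclusion, and right exactness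
preserves the quotient by boundaries. So the extended homology is the homology of the extended
complex. -/
theorem isHomology_reprTensor {d : ∀ i j, M i →ₗ[k] M j}
    (hd : ∀ i j l, d j l ∘ₗ d i j = 0) (i : ℤ) :
    IsHomology (fun i j => (d i j).baseChange K) i (reprTensor K d i) where
  cycle_iff := by
    rintro _ rfl m
    have hex : Function.Exact ((LinearMap.ker (d i (i + 2))).subtype.baseChange K)
        ((d i (i + 2)).baseChange K) := by
      have := Module.Flat.lTensor_exact K
        (LinearMap.exact_subtype_ker_map (d i (i + 2)))
      exact this
    rw [hex m]
    constructor
    · rintro ⟨w, hw⟩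
      exact ⟨_, mem_reprTensor.2 ⟨w, rfl, hw⟩⟩
    · rintro ⟨x, hx⟩
      obtain ⟨w, -, hw⟩ := mem_reprTensor.1 hx
      exact ⟨w, hw⟩
  exists_rep x := by
    have hs : Function.Surjective ((Submodule.mkQ ((LinearMap.range (d (i - 2) i)).submoduleOf
        (LinearMap.ker (d i (i + 2))))).baseChange K) :=
      LinearMap.lTensor_surjective K (Submodule.mkQ_surjective _)
    obtain ⟨w, hw⟩ := hs x
    exact ⟨_, mem_reprTensor.2 ⟨w, hw, rfl⟩⟩
  eq_zero_iff := by
    rintro _ rfl x m hx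
    obtain ⟨w, rfl, rfl⟩ := mem_reprTensor.1 hx
    let δ : M (i - 2) →ₗ[k] LinearMap.ker (d i (i + 2)) :=
      (d (i - 2) i).codRestrict _ fun u => LinearMap.congr_fun (hd (i - 2) i (i + 2)) u
    have hδ : LinearMap.range δ = (LinearMap.range (d (i - 2) i)).submoduleOf
        (LinearMap.ker (d i (i + 2))) := by
      ext z
      simp only [LinearMap.mem_range, Submodule.submoduleOf, Submodule.mem_comap,
        Submodule.subtype_apply, δ, Subtype.ext_iff]
      rfl
    have hex : Function.Exact (δ.baseChange K) ((Submodule.mkQ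
        ((LinearMap.range (d (i - 2) i)).submoduleOf
          (LinearMap.ker (d i (i + 2))))).baseChange K) := by
      refine lTensor_exact K ?_ (Submodule.mkQ_surjective _)
      rw [LinearMap.exact_iff, Submodule.ker_mkQ, hδ]
    have hinj : Function.Injective ((LinearMap.ker (d i (i + 2))).subtype.baseChange K) :=
      Module.Flat.lTensor_preserves_injective_linearMap _ (Submodule.subtype_injective _)
    have hcomp : ∀ u, (LinearMap.ker (d i (i + 2))).subtype.baseChange K (δ.baseChange K u) =
        (d (i - 2) i).baseChange K u := fun u => by
      rw [← LinearMap.comp_apply, ← LinearMap.baseChange_comp]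
      rfl
    rw [hex w]
    exact exists_congr fun u => by rw [← hcomp, hinj.eq_iff]

end GradedHomology

end GradedHomology

/-! ### Positive crossings under inherited orientations -/

namespace LinkDiagram

variable {D X : Type*} [DecidableEq X] {L : LinkDiagram D X} {c : X} {b : Bool}

namespace Orientation

theorem inherit_isPositive_iff {o : L.Orientation}
    {h : ∀ d, L.crossing d = some c → L.isOver d = b → o.out (L.rot d) = !o.out d}
    {x : {x : X // x ≠ c}} : (o.inherit c b h).IsPositive x ↔ o.IsPositive x.1 := by
  have hr : (L.resolve c b).rot = L.resolveRot c b := rfl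
  refine exists_congr fun d => ?_
  rw [hr]
  refine (and_congr_left fun _ => L.resolveCrossing_eq_some c d x).trans
    (and_congr_right fun hd => ?_)
  rw [L.resolveRot_of_ne c b d (by simp [hd, x.2])]
  rfl

open Classical in
theorem nPlus_inherit [Finite X] (o : L.Orientation)
    (h : ∀ d, L.crossing d = some c → L.isOver d = b → o.out (L.rot d) = !o.out d) :
    (o.inherit c b h).nPlus = o.nPlus - if o.IsPositive c then 1 else 0 := by
  have := Fintype.ofFinite X
  have e : (Finset.univ.filter fun x => (o.inherit c b h).IsPositive x).map
      (Function.Embedding.subtype _) = (Finset.univ.filter fun x => o.IsPositive x).erase c := by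
    ext x
    simp only [inherit_isPositive_iff, Finset.mem_map, Finset.mem_filter, Finset.mem_univ,
      true_and, Function.Embedding.subtype_apply, Finset.mem_erase]
    constructor
    · rintro ⟨y, hy, rfl⟩
      exact ⟨y.2, hy⟩
    · rintro ⟨hx, hx'⟩
      exact ⟨⟨x, hx⟩, hx', rfl⟩
  have e' := congrArg Finset.card e
  rw [Finset.card_map] at e'
  rw [nPlus, nPlus, Nat.card_eq_fintype_card, Nat.card_eq_fintype_card, Fintype.card_subtype,
    Fintype.card_subtype, e']
  split_ifs with hc
  · rw [Finset.card_erase_of_mem (by simpa using hc), Nat.cast_sub, Nat.cast_one]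
    exact Finset.card_pos.2 ⟨c, by simpa using hc⟩
  · rw [Finset.erase_eq_of_notMem (by simpa using hc), sub_zero]

theorem nPlus_resolvePositive [Finite X] (o : L.Orientation) (hc : o.IsPositive c) :
    (o.resolvePositive hc).nPlus = o.nPlus - 1 := by
  classical
  rw [resolvePositive, nPlus_inherit, if_pos hc]

omit [DecidableEq X] in
theorem IsNegative.not_isPositive {o : L.Orientation} (hc : o.IsNegative c) :
    ¬ o.IsPositive c := by
  rintro ⟨d, hd, ho, h0, h1⟩
  rw [out_rot_of_isNegative hc d hd ho, h0] at h1
  exact absurd h1 (by decide)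

theorem nPlus_resolveNegative [Finite X] (o : L.Orientation) (hc : o.IsNegative c) :
    (o.resolveNegative hc).nPlus = o.nPlus := by
  classical
  rw [resolveNegative, nPlus_inherit, if_neg hc.not_isPositive, sub_zero]

end Orientation

end LinkDiagram

/-! ### The cone and its exact sequences -/

theorem mainTheorem9 {D X : Type*} [Finite D] [Finite X] [DecidableEq X]
    (L : LinkDiagram D X) (hL : L.IsPlanar) (c : X) :
    -- `CT(L)`, `CT(L₀)` and `CT(L₁)` are complexes
    (∀ i j k : ℤ, L.del j k ∘ₗ L.del i j = 0) ∧
    (∀ (b : Bool) (i j k : ℤ), (L.resolve c b).del j k ∘ₗ (L.resolve c b).del i j = 0) ∧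
    -- `τ_c` is a chain map
    (∀ i j k l : ℤ, j = i + 1 → k = i + 2 → l = i + 3 →
      L.delResolved c true j l ∘ₗ L.tau c i j = L.tau c k l ∘ₗ L.delResolved c false i k) ∧
    -- `CT(L)` is isomorphic to the mapping cone of `τ_c`
    ∃ Φ : ∀ i : ℤ, L.CT i ≃ₗ[L.FaceField] L.Cone c i,
      (∀ (i j : ℤ) (m : L.CT i), Φ j (L.del i j m) = L.coneDel c i j (Φ i m)) ∧
      -- the maps of the long exact sequences
      ∃ (f : ∀ j i : ℤ, L.unHTResolved c true j →ₗ[L.FaceField] L.unHT i)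
        (g : ∀ i l : ℤ, L.unHT i →ₗ[L.FaceField] L.unHTResolved c false l)
        (h : ∀ l j : ℤ, L.unHTResolved c false l →ₗ[L.FaceField] L.unHTResolved c true j),
        -- they are induced by the inclusion into the cone, the projection, and `τ_c`
        (∀ i x m, GradedHomology.RepresentsTensor L.FaceField (L.resolve c true).del (i - 1) x m →
          GradedHomology.Represents L.del i (f (i - 1) i x) ((Φ i).symm (0, m))) ∧
        (∀ i x m, GradedHomology.Represents L.del i x m →
          GradedHomology.RepresentsTensor L.FaceField (L.resolve c false).del i
            (g i i x) (Φ i m).1) ∧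
        (∀ i j x m, j = i + 1 →
          GradedHomology.RepresentsTensor L.FaceField (L.resolve c false).del i x m →
          GradedHomology.RepresentsTensor L.FaceField (L.resolve c true).del j
            (h i j x) (L.tau c i j m)) ∧
        -- the unshifted long exact sequence
        IsLongExact 0 0 f g h ∧
        -- the long exact sequence at a positive crossing, for any orientation of `L₁`
        (∀ (o : L.Orientation) (hc : o.IsPositive c) (o₁ : (L.resolve c true).Orientation)
            (e : ℤ), e = o.nPlus - o₁.nPlus →
          IsLongExact (A := L.HTResolved c true o₁) (B := L.HT o)
            (C := L.HTResolved c false (o.resolvePositive hc)) e 1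
            (fun j i => f (j + o₁.nPlus) (i + o.nPlus))
            (fun i l => g (i + o.nPlus) (l + (o.resolvePositive hc).nPlus))
            (fun l j => h (l + (o.resolvePositive hc).nPlus) (j + o₁.nPlus))) ∧
        -- the long exact sequence at a negative crossing, for any orientation of `L₀`
        (∀ (o : L.Orientation) (hc : o.IsNegative c) (o₀ : (L.resolve c false).Orientation)
            (e : ℤ), e = o.nPlus - o₀.nPlus →
          IsLongExact (A := L.HTResolved c true (o.resolveNegative hc)) (B := L.HT o)
            (C := L.HTResolved c false o₀) 0 e
            (fun j i => f (j + (o.resolveNegative hc).nPlus) (i + o.nPlus))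
            (fun i l => g (i + o.nPlus) (l + o₀.nPlus))
            (fun l j => h (l + o₀.nPlus) (j + (o.resolveNegative hc).nPlus))) := by
  have hB := fun i => GradedHomology.isHomology_repr L.del i
  have hA := fun i => GradedHomology.isHomology_reprTensor (K := L.FaceField)
    (fun i j k => hL.del_comp_del_resolve (c := c) (b := true) i j k) i
  have hC := fun i => GradedHomology.isHomology_reprTensor (K := L.FaceField)
    (fun i j k => hL.del_comp_del_resolve (c := c) (b := false) i j k) i
  have hd : ∀ i j k m, L.del j k (L.del i j m) = 0 := fun i j k m =>
    LinearMap.congr_fun (hL.del_comp_del i j k) m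
  have hτ : ∀ i j k l m, k = j + 1 →
      L.delResolved c true j l (L.tau c i j m) = L.tau c k l (L.delResolved c false i k m) :=
    fun i j k l m hk => hL.delResolved_tau i j k l hk m
  have hΦ := L.coneEquiv_del (c := c)
  obtain ⟨f, g, h, hf, hg, hh⟩ := IsHomology.exists_cone_maps (A := L.CTResolved c true)
    (B := L.CT) (C := L.CTResolved c false) (HA := L.unHTResolved c true) (HB := L.unHT)
    (HC := L.unHTResolved c false) hA hB hC hΦ hτ
  have x1 : ∀ {j i l : ℤ}, j = i - 1 → l = i → Function.Exact (f j i) (g i l) := fun hj hl =>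
    IsHomology.exact_inclusion_projection (τ := L.tau c) hA hB hC hΦ f g hf hg hd hj hl
  have x2 : ∀ {i l j : ℤ}, l = i → j = i + 1 → Function.Exact (g i l) (h l j) := fun hl hj =>
    IsHomology.exact_projection_connecting hA hB hC hΦ g h hg hh hl hj
  have x3 : ∀ {l j i : ℤ}, l = i - 2 → j = i - 1 → Function.Exact (h l j) (f j i) := fun hl hj =>
    IsHomology.exact_connecting_inclusion hA hB hC hΦ f h hf hh hl hj
  refine ⟨hL.del_comp_del, fun b => hL.del_comp_del_resolve, ?_, L.coneEquiv c, hΦ, f, g, h,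
    fun i x m hx => GradedHomology.mem_repr.1 (hf i x m (GradedHomology.mem_reprTensor.2 hx)),
    fun i x m hx => GradedHomology.mem_reprTensor.1 (hg i x m (GradedHomology.mem_repr.2 hx)),
    fun i j x m hj hx => GradedHomology.mem_reprTensor.1 (hh i j x m hj (GradedHomology.mem_reprTensor.2 hx)), ?_, ?_, ?_⟩
  · intro i j k l hj hk hl
    exact LinearMap.ext fun m => hτ i j k l m (by omega)
  · intro i
    exact ⟨x1 (by ring) (by ring), x2 (by ring) (by ring), x3 (by ring) (by ring)⟩
  · intro o hc o₁ e he i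
    -- The shift by one for `L₀` compensates the loss of the positive crossing `c`, and `e`
    -- compensates the choice of orientation of `L₁`; in unshifted degrees this is the previous
    -- sequence at `i + n₊(L)`.
    have hn := o.nPlus_resolvePositive hc
    exact ⟨x1 (by omega) (by omega), x2 (by omega) (by omega), x3 (by omega) (by omega)⟩
  · intro o hc o₀ e he i
    have hn := o.nPlus_resolveNegative hc
    exact ⟨x1 (by omega) (by omega), x2 (by omega) (by omega), x3 (by omega) (by omega)⟩
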